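/- Notation. Let $\mathrm{dA}=\pi^{-1}\,dx\,dy$ and $\varDelta=\partial\bar\partial$ (one quarter of the usual Laplacian). For $Q:\mathbb C\to\mathbb R$, $w_0\in\mathbb C$ and $\tau\ge 0$, let $\mathrm{SH}_{\tau,w_0}$ be the set of subharmonic functions $q:\mathbb C\to[-\infty,\infty)$ with $q(z)\le\tau\log|z-w_0|+\mathrm O(1)$ as $z\to w_0$, let $$\hat Q_{\tau,w_0}(z)=\sup\{q(z):\ q\in \mathrm{SH}_{\tau,w_0},\ q\le Q \text{ on }\mathbb C\},\qquad \mathcal S_{\tau,w_0}=\{z:\ \hat Q_{\tau,w_0}(z)=Q(z)\},$$ and let $\Omega_{\tau,w_0}$ be the connected component of $\mathbb C\setminus\mathcal S_{\tau,w_0}$ containing $w_0$. The potential $Q$ is $(\tau,w_0)$-admissible if (i) $Q$ is $C^2$-smooth and $\liminf_{|z|\to\infty}Q(z)/\log|z|>0$; (ii) $Q$ is real-analytic with $\varDelta Q>0$ in a neighborhood of $\partial\mathcal S_{\tau,w_0}$; (iii) $w_0\notin\mathcal S_{\tau,w_0}$, and $\Omega_{\tau,w_0}$ is bounded and simply connected,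 and its boundary is a real-analytically smooth Jordan curve. For an interval $I\subset[0,\infty)$, $Q$ is $(I,w_0)$-admissible if it is $(\tau,w_0)$-admissible for every $\tau\in I$ and the domains $\Omega_{\tau,w_0}$, $\tau\in I$, form a smooth flow, that is, the curves $\partial\Omega_{\tau,w_0}$ have regular, simple, $2\pi$-periodic parametrizations $\gamma(\tau,\theta)$ which are $C^\infty$-smooth jointly in $(\tau,\theta)\in I\times\mathbb R$. Let $\varphi_{\tau,w_0}$ denote the conformal map of $\Omega_{\tau,w_0}$ onto the unit disk with $\varphi_{\tau,w_0}(w_0)=0$ and $\varphi_{\tau,w_0}'(w_0)>0$, extended conformally across $\partial\Omega_{\tau,w_0}$. Proposition. Let $Q$ be $(I_0,w_0)$-admissible, where $I_0=[a,b]$ with $0\le a<b<\infty$. (1) For $\tau,\tau'\in I_0$ with $\tau'<\tau$, and for any bounded harmonic function $h$ on $\Omega_{\tau,w_0}$, the function $h\,\varDelta Q$ is integrable on $\Omega_{\tau,w_0}\setminus\Omega_{\tau',w_0}$ and $$\int_{\Omega_{\tau,w_0}\setminus\Omega_{\tau',w_0}}h\,2\varDelta Q\,\mathrm{dA}=(\tau-\tau')\,h(w_0).$$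 (2) Let $\tau\in I_0$ and $\zeta\in\partial\Omega_{\tau,w_0}$, and let $\mathrm n_{\tau,w_0}(\zeta)$ be the outer unit normal to $\Omega_{\tau,w_0}$ at $\zeta$ and $\nu_\tau(\zeta)=-\mathrm n_{\tau,w_0}(\zeta)$ the inner one. For all sufficiently small real $\varepsilon$ with $\tau-\varepsilon\in I_0$, the intersection $$\big(\zeta+\mathrm{sgn}(\varepsilon)\,\nu_\tau(\zeta)\,\mathbb R_+\big)\cap\partial\Omega_{\tau-\varepsilon,w_0},\qquad \mathbb R_+=[0,\infty),$$ has a point $\zeta_\varepsilon$ closest to $\zeta$, and, as $\varepsilon\to0$ with $\tau-\varepsilon\in I_0$, $$\zeta_\varepsilon=\zeta+\varepsilon\,\nu_\tau(\zeta)\,\frac{|\varphi_{\tau,w_0}'(\zeta)|}{4\varDelta Q(\zeta)}+\mathrm O(\varepsilon^2),\qquad \mathrm n_{\tau-\varepsilon,w_0}(\zeta_\varepsilon)=\mathrm n_{\tau,w_0}(\zeta)+\mathrm O(\varepsilon),$$ where $\mathrm n_{\tau-\varepsilon,w_0}(\zeta_\varepsilon)$ is the outer unit normal to $\Omega_{\tau-\varepsilon,w_0}$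 at $\zeta_\varepsilon$. -/

import Mathlib

open Set Filter Topology MeasureTheory Asymptotics
open scoped ContDiff

noncomputable section

namespace LaplacianGrowth

/-- The normalized area measure `dA = dx dy / π`, for which the unit disk has area `1`. -/
def area : Measure ℂ := ENNReal.ofReal (1 / Real.pi) • (volume : Measure ℂ)

/-- `ΔQ = ∂∂̄Q`, one quarter of the usual Laplacian. -/
def ddbar (Q : ℂ → ℝ) (z : ℂ) : ℝ := (1 / 4) * Laplacian.laplacian Q z

/-- Subharmonic functions on the plane, with values in `[-∞, ∞)` (the constant `-∞` is included):
upper semicontinuous functions which satisfy the sub-mean-value principle in the form of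
domination, on every closed disk, by harmonic majorants of the boundary values. -/
structure IsSubharmonic (q : ℂ → EReal) : Prop where
  lt_top : ∀ z, q z < ⊤
  upperSemicontinuous : UpperSemicontinuous q
  le_harmonic : ∀ (c : ℂ) (r : ℝ), 0 < r → ∀ h : ℂ → ℝ,
    ContinuousOn h (Metric.closedBall c r) →
    InnerProductSpace.HarmonicOnNhd h (Metric.ball c r) →
    (∀ z ∈ Metric.sphere c r, q z ≤ (h z : EReal)) →
    ∀ z ∈ Metric.ball c r, q z ≤ (h z : EReal)

/-- The class `SH_{τ,w₀}` of subharmonic functions `q` on the plane with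
`q(z) ≤ τ log|z - w₀| + O(1)` as `z → w₀`. -/
def SH (τ : ℝ) (w₀ : ℂ) : Set (ℂ → EReal) :=
  {q | IsSubharmonic q ∧
    ∃ C : ℝ, ∀ᶠ z in 𝓝[≠] w₀, q z ≤ ((τ * Real.log ‖z - w₀‖ + C : ℝ) : EReal)}

/-- The solution `Q̂_{τ,w₀}` of the obstacle problem. -/
def obstacle (Q : ℂ → ℝ) (τ : ℝ) (w₀ z : ℂ) : EReal :=
  ⨆ q ∈ {q | q ∈ SH τ w₀ ∧ ∀ w, q w ≤ (Q w : EReal)}, q z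

/-- The spectral droplet `S_{τ,w₀}`: the contact set of the obstacle problem. -/
def droplet (Q : ℂ → ℝ) (τ : ℝ) (w₀ : ℂ) : Set ℂ :=
  {z | obstacle Q τ w₀ z = (Q z : EReal)}

/-- The off-spectral component `Ω_{τ,w₀}`: the connected component of the complement of the
droplet which contains `w₀`. -/
def offSpectral (Q : ℂ → ℝ) (w₀ : ℂ) (τ : ℝ) : Set ℂ :=
  connectedComponentIn (droplet Q τ w₀)ᶜ w₀

/-- `γ` is a regular `2π`-periodic parametrization, simple over a period, of the closed
curve `J`. -/
structure IsRegularJordanParam (γ : ℝ → ℂ) (J : Set ℂ) : Prop where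
  periodic : Function.Periodic γ (2 * Real.pi)
  injOn : InjOn γ (Ico 0 (2 * Real.pi))
  deriv_ne_zero : ∀ θ, deriv γ θ ≠ 0
  range_eq : range γ = J

/-- Real-analytically smooth Jordan curves. -/
def IsAnalyticJordanCurve (J : Set ℂ) : Prop :=
  ∃ γ : ℝ → ℂ, AnalyticOnNhd ℝ γ univ ∧ IsRegularJordanParam γ J

/-- `(τ, w₀)`-admissible potentials. -/
structure IsAdmissible (Q : ℂ → ℝ) (w₀ : ℂ) (τ : ℝ) : Prop where
  contDiff : ContDiff ℝ 2 Q
  growth : (0 : EReal) <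
    liminf (fun z : ℂ => ((Q z / Real.log ‖z‖ : ℝ) : EReal)) (cocompact ℂ)
  regular : ∃ U : Set ℂ, IsOpen U ∧ frontier (droplet Q τ w₀) ⊆ U ∧
    AnalyticOnNhd ℝ Q U ∧ ∀ z ∈ U, 0 < ddbar Q z
  notMem_droplet : w₀ ∉ droplet Q τ w₀
  isBounded : Bornology.IsBounded (offSpectral Q w₀ τ)
  isSimplyConnected : IsSimplyConnected (offSpectral Q w₀ τ)
  boundary : IsAnalyticJordanCurve (frontier (offSpectral Q w₀ τ))

/-- The domains `Ω τ`, `τ ∈ I`, form a smooth flow: their boundaries are regular Jordan curves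
with a parametrization which is `C^∞`-smooth jointly in `τ ∈ I` and in the curve parameter. -/
def IsSmoothFlow (I : Set ℝ) (Ω : ℝ → Set ℂ) : Prop :=
  ∃ γ : ℝ → ℝ → ℂ, ContDiffOn ℝ ∞ (fun p : ℝ × ℝ => γ p.1 p.2) (I ×ˢ univ) ∧
    ∀ τ ∈ I, IsRegularJordanParam (γ τ) (frontier (Ω τ))

/-- `(I, w₀)`-admissible potentials. -/
structure IsAdmissibleOn (Q : ℂ → ℝ) (w₀ : ℂ) (I : Set ℝ) : Prop where
  admissible : ∀ τ ∈ I, IsAdmissible Q w₀ τ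
  smoothFlow : IsSmoothFlow I (offSpectral Q w₀)

/-- `φ` is the conformal map of `Ω` onto the unit disk with `φ(w₀) = 0` and `φ'(w₀) > 0`,
extended conformally to a neighborhood of the closure of `Ω`. -/
structure IsRiemannMap (Ω : Set ℂ) (w₀ : ℂ) (φ : ℂ → ℂ) : Prop where
  conformal : ∃ U : Set ℂ, IsOpen U ∧ closure Ω ⊆ U ∧ DifferentiableOn ℂ φ U ∧ InjOn φ U
  bijOn : BijOn φ Ω (Metric.ball 0 1)
  map_root : φ w₀ = 0
  deriv_re_pos : 0 < (deriv φ w₀).re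
  deriv_im : (deriv φ w₀).im = 0

/-- `n` is the outer unit normal to `Ω` at its boundary point `ζ`: it is a unit vector orthogonal
to the tangent line of `∂Ω` at `ζ`, and it points out of `Ω`. -/
structure IsOuterUnitNormal (Ω : Set ℂ) (ζ n : ℂ) : Prop where
  norm_eq_one : ‖n‖ = 1
  orthogonal :
    (fun z : ℂ => inner ℝ (z - ζ) n) =o[𝓝[frontier Ω] ζ] (fun z : ℂ => z - ζ)
  inside : ∀ᶠ t : ℝ in 𝓝[>] 0, ζ - t • n ∈ Ω
  outside : ∀ᶠ t : ℝ in 𝓝[>] 0, ζ + t • n ∉ closure Ω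

/-- The closed ray `ζ + v ℝ₊`. -/
def ray (ζ v : ℂ) : Set ℂ := {z | ∃ t : ℝ, 0 ≤ t ∧ z = ζ + t • v}

/-- `z` is a point of `A` closest to `ζ`. -/
def IsClosestPoint (A : Set ℂ) (ζ z : ℂ) : Prop := z ∈ A ∧ ∀ w ∈ A, dist ζ z ≤ dist ζ w

end LaplacianGrowth

end

open LaplacianGrowth

namespace LaplacianGrowth

open InnerProductSpace Metric

/-! The first assertion is a quadrature identity on each single domain, subtracted for two
parameters. Write `Ω` for the off-spectral component at `τ`. Since `Q` is continuous, the upper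
semicontinuous regularization of the obstacle function is again a competitor, so the obstacle
function is the largest element of its class (`obstacle_mem`). Off the contact set a Poisson
modification in a small disk stays below `Q`, and maximality makes the obstacle function harmonic
there. At `w₀` the same argument with the extremal logarithm shows that it equals `τ log|z - w₀| +
H` with `H` harmonic in all of `Ω` (`exists_harmonic_part`).

Let `L` be a `C²` function that equals the logarithm off a small disk about `w₀`, and put `u = Q - τ
L - H`. This is positive in `Ω` and, near the boundary, it is the gap between `Q` and the obstacle
function. Since `Q` is `C²`, its Taylor bound at the contact points and Harnack's inequality give `u
≤ C dist(z, ∂Ω)²`, and then `|∇u|² ≤ C u` (`exists_gap`). Hence `u` can be truncated smoothly at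
height `1/n`. The truncations have compact support, so their Laplacians are orthogonal to harmonic
`h`, and the error terms are bounded and vanish pointwise in the limit
(`setIntegral_mul_laplacian_eq_zero`). So `∫ h ΔQ = τ ∫ h ΔL`, and `ΔL` has the mass of the
logarithm, which gives `setIntegral_harmonic_mul_ddbar`. No regularity of `∂Ω` enters here.

For the second assertion, the smooth flow `γ` of the boundary curves has a velocity `A = ∂γ/∂τ`, and
only its normal component `V` has to be found. In the coordinate of the Riemann map `φ`, the domains
at parameter `τ + s` are, to first order along each radius, `r < 1 + s κ` with `κ = V |φ'|`. Testing
the quadrature identity with `h = Re (c φ^k)`, which is harmonic on a neighborhood of the closure of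
`Ω` and so on all nearby domains, and differentiating in the parameter shows that all Fourier
moments of `2ΔQ κ / |φ'|² - 1/2` on the circle vanish (`weight_mul_radial_velocity`). Therefore `V =
|φ'| / (4ΔQ)`. Since `V > 0`, Taylor's formula for the flow and the intermediate value theorem
locate the intersection of a nearby curve with the normal line up to a quadratic error
(`exists_motion_bound`).

On which side of its boundary a domain lies is settled without the Jordan curve theorem. A connected
set that misses the boundary of a domain and meets the domain lies in it
(`subset_of_isPreconnected_of_disjoint_frontier`). Applied to cones about the normal, which nearby
curves avoid, this yields inner and outer cones that are uniform in the parameter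
(`exists_uniform_cones`). -/

/-- The Poisson integral over the circle `|z - c| = R` of the boundary data `g`. -/
noncomputable def poissonIntegral (g : ℂ → ℝ) (c : ℂ) (R : ℝ) (w : ℂ) : ℝ :=
  Real.circleAverage (poissonKernel c w • g) c R

/-! ### Poisson integrals and the Dirichlet problem in a disk. -/

section Poisson

variable {c w : ℂ} {R : ℝ} {f g : ℂ → ℝ}

theorem continuousOn_poissonKernel_sphere (hw : w ∈ ball c R) :
    ContinuousOn (poissonKernel c w) (sphere c |R|) := by
  rw [poissonKernel_eq_re_herglotzRieszKernel]
  exact Complex.continuous_re.comp_continuousOn (continuousOn_herglotzRieszKernel_sphere hw)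

theorem circleIntegrable_poissonKernel_smul (hg : CircleIntegrable g c R) (hw : w ∈ ball c R) :
    CircleIntegrable (poissonKernel c w • g) c R :=
  hg.continuousOn_smul (continuousOn_poissonKernel_sphere hw)

theorem poissonKernel_lower {z : ℂ} (hz : z ∈ sphere c R) (hw : w ∈ ball c R) :
    (R - ‖w - c‖) / (R + ‖w - c‖) ≤ poissonKernel c w z := by
  rw [poissonKernel_eq_re_herglotzRieszKernel]
  exact le_re_herglotzRieszKernel hz hw

theorem poissonKernel_pos {z : ℂ} (hz : z ∈ sphere c R) (hw : w ∈ ball c R) :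
    0 < poissonKernel c w z := by
  refine lt_of_lt_of_le ?_ (poissonKernel_lower hz hw)
  have : ‖w - c‖ < R := by simpa [dist_eq_norm] using hw
  have := norm_nonneg (w - c)
  exact div_pos (by linarith) (by linarith)

theorem poissonIntegral_mono (hf : CircleIntegrable f c R) (hg : CircleIntegrable g c R)
    (hw : w ∈ ball c R) (h : ∀ z ∈ sphere c R, f z ≤ g z) :
    poissonIntegral f c R w ≤ poissonIntegral g c R w := by
  have hR : |R| = R := abs_of_pos (pos_of_mem_ball hw)
  refine Real.circleAverage_mono (circleIntegrable_poissonKernel_smul hf hw)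
    (circleIntegrable_poissonKernel_smul hg hw) fun z hz => ?_
  rw [hR] at hz
  exact mul_le_mul_of_nonneg_left (h z hz) (poissonKernel_pos hz hw).le

theorem poissonIntegral_of_harmonic (hf : HarmonicOnNhd f (closedBall c R)) (hw : w ∈ ball c R) :
    poissonIntegral f c R w = f w :=
  hf.circleAverage_poissonKernel_smul hw

/-- The Poisson integral is the real part of the Herglotz–Riesz integral, which is analytic in the
disk. The centre is moved to `0` by a translation. -/
theorem harmonicOnNhd_poissonIntegral (hg : CircleIntegrable g c R) :
    HarmonicOnNhd (poissonIntegral g c R) (ball c R) := by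
  have hg0 : CircleIntegrable (fun z => g (z + c)) 0 R := by
    simpa [CircleIntegrable, circleMap, add_comm] using hg
  have key : ∀ w ∈ ball c R, poissonIntegral g c R w =
      ((fun w => Real.circleAverage (fun ζ ↦ herglotzRieszKernel 0 w ζ • (g (ζ + c) : ℂ)) 0 R)
        (w - c)).re := by
    intro w hw
    have hw' : w - c ∈ ball (0 : ℂ) R := by simpa [dist_eq_norm] using hw
    have := re_circleAverage_herglotzRieszKernel_smul hg0 hw'
    simp only [this]
    rw [poissonIntegral, ← Real.circleAverage_map_add_const, poissonKernel_eq_re_herglotzRieszKernel]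
    congr 1
    funext z
    simp [herglotzRieszKernel_add_const]
  have hgC : CircleIntegrable (fun z => (g (z + c) : ℂ)) 0 R := by
    simp only [CircleIntegrable, intervalIntegrable_iff] at hg0 ⊢
    exact Complex.ofRealCLM.integrable_comp hg0
  intro w hw
  have hw' : w - c ∈ ball (0 : ℂ) R := by simpa [dist_eq_norm] using hw
  have han := analyticOnNhd_circleAverage_herglotzRieszKernel_smul hgC (w - c) hw'
  have hcomp : AnalyticAt ℂ (fun w => (fun w => Real.circleAverage
      (fun ζ ↦ herglotzRieszKernel 0 w ζ • (g (ζ + c) : ℂ)) 0 R) (w - c)) w :=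
    AnalyticAt.fun_comp (f := fun w => w - c) han (by fun_prop)
  refine (harmonicAt_congr_nhds ?_).2 hcomp.harmonicAt_re
  filter_upwards [isOpen_ball.mem_nhds hw] with z hz using key z hz

theorem circleIntegrable_of_continuousOn (hR : 0 < R) (hf : ContinuousOn f (sphere c R)) :
    CircleIntegrable f c R :=
  hf.circleIntegrable hR.le

/-- Harnack's inequality, in the form of a lower bound. -/
theorem harnack_lower {p : ℂ → ℝ} (hp : HarmonicOnNhd p (ball c R))
    (hp0 : ∀ z ∈ ball c R, 0 ≤ p z) (hw : w ∈ ball c R) :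
    (R - ‖w - c‖) / (R + ‖w - c‖) * p c ≤ p w := by
  have hwR : ‖w - c‖ < R := by simpa [dist_eq_norm] using hw
  have hn := norm_nonneg (w - c)
  -- The function is harmonic only in the open ball, so the bound is proved on circles of radius `r
  -- < R` and then `r` tends to `R`.
  have hr : ∀ r ∈ Ioo ‖w - c‖ R, (r - ‖w - c‖) / (r + ‖w - c‖) * p c ≤ p w := by
    intro r hr
    have hr0 : 0 < r := hn.trans_lt hr.1
    have hsub : closedBall c r ⊆ ball c R := closedBall_subset_ball hr.2
    have hpr : HarmonicOnNhd p (closedBall c r) := hp.mono hsub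
    have hwr : w ∈ ball c r := by simpa [dist_eq_norm] using hr.1
    rw [← poissonIntegral_of_harmonic hpr hwr]
    have hpc : Real.circleAverage p c r = p c :=
      InnerProductSpace.HarmonicOnNhd.circleAverage_eq (by rwa [abs_of_pos hr0])
    have hci : CircleIntegrable p c r :=
      circleIntegrable_of_continuousOn hr0 (hpr.continuousOn.mono sphere_subset_closedBall)
    rw [← hpc, ← smul_eq_mul, ← Real.circleAverage_smul]
    refine Real.circleAverage_mono hci.const_smul
      (circleIntegrable_poissonKernel_smul hci hwr) fun z hz => ?_
    rw [abs_of_pos hr0] at hz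
    exact mul_le_mul_of_nonneg_right (poissonKernel_lower hz hwr)
      (hp0 z (hsub (sphere_subset_closedBall hz)))
  have hlim : Tendsto (fun r : ℝ => (r - ‖w - c‖) / (r + ‖w - c‖) * p c) (𝓝[<] R)
      (𝓝 ((R - ‖w - c‖) / (R + ‖w - c‖) * p c)) := by
    have : ContinuousAt (fun r : ℝ => (r - ‖w - c‖) / (r + ‖w - c‖) * p c) R := by
      have : R + ‖w - c‖ ≠ 0 := by linarith
      fun_prop (disch := assumption)
    exact this.tendsto.mono_left nhdsWithin_le_nhds
  refine le_of_tendsto hlim ?_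
  filter_upwards [Ioo_mem_nhdsLT hwR] with r hr' using hr r hr'

theorem harmonicOnNhd_re_of_differentiable {F : ℂ → ℂ} (hF : Differentiable ℂ F) (s : Set ℂ) :
    HarmonicOnNhd (fun z => (F z).re) s := fun z _ =>
  (hF.analyticAt z).harmonicAt_re

/-- On the circle `|z - c| = R`, the function `|z - ζ|²` coincides with a harmonic function. -/
theorem poissonIntegral_quadratic_bound {ζ : ℂ} {A K : ℝ} (hζ : ζ ∈ sphere c R)
    (hg : CircleIntegrable g c R) (hw : w ∈ ball c R)
    (h : ∀ z ∈ sphere c R, g z ≤ A + K * ‖z - ζ‖ ^ 2) :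
    poissonIntegral g c R w ≤
      A + K * (2 * (R ^ 2 - ((w - c) * (starRingEnd ℂ) (ζ - c)).re)) := by
  set F : ℂ → ℂ := fun z => A + K * (2 * (R ^ 2 - (z - c) * (starRingEnd ℂ) (ζ - c))) with hF
  have hR : 0 < R := pos_of_mem_ball hw
  have hFd : Differentiable ℂ F := by unfold F; fun_prop
  have hre : ∀ z, (F z).re = A + K * (2 * (R ^ 2 - ((z - c) * (starRingEnd ℂ) (ζ - c)).re)) := by
    intro z
    simp only [hF, Complex.add_re, Complex.ofReal_re, Complex.re_ofReal_mul]
    rw [← Complex.ofReal_ofNat, Complex.re_ofReal_mul, Complex.sub_re, ← Complex.ofReal_pow,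
      Complex.ofReal_re]
  have hh := harmonicOnNhd_re_of_differentiable hFd (closedBall c R)
  rw [← hre w, ← poissonIntegral_of_harmonic hh hw]
  refine poissonIntegral_mono hg (circleIntegrable_of_continuousOn hR
    (hh.continuousOn.mono sphere_subset_closedBall)) hw fun z hz => ?_
  rw [hre]
  refine (h z hz).trans (le_of_eq ?_)
  have h1 : ‖z - c‖ = R := by simpa [dist_eq_norm] using hz
  have h2 : ‖ζ - c‖ = R := by simpa [dist_eq_norm] using hζ
  have : ‖z - ζ‖ ^ 2 = 2 * (R ^ 2 - ((z - c) * (starRingEnd ℂ) (ζ - c)).re) := by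
    have e : z - ζ = (z - c) - (ζ - c) := by ring
    rw [e, ← Complex.normSq_eq_norm_sq, Complex.normSq_sub, Complex.normSq_eq_norm_sq,
      Complex.normSq_eq_norm_sq, h1, h2]
    ring
  rw [this]

/-- Boundary behaviour of the Poisson integral of a function which is semicontinuous from above
at a boundary point. -/
theorem eventually_poissonIntegral_lt {ζ : ℂ} {M A : ℝ} (hζ : ζ ∈ sphere c R)
    (hg : CircleIntegrable g c R) (hM : ∀ z ∈ sphere c R, g z ≤ M)
    (hA : ∀ᶠ z in 𝓝[sphere c R] ζ, g z ≤ A) {B : ℝ} (hAB : A < B) :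
    ∀ᶠ w in 𝓝[ball c R] ζ, poissonIntegral g c R w < B := by
  obtain ⟨d, hd, hball⟩ := Metric.mem_nhdsWithin_iff.1 hA
  -- At distance at least `d` from `ζ` the term `K ‖z - ζ‖²` absorbs `M - A`. The resulting majorant
  -- has a harmonic extension into the disk with value `A` at `ζ`, and this is the barrier.
  set K : ℝ := |M - A| / d ^ 2
  have hb : ∀ z ∈ sphere c R, g z ≤ A + K * ‖z - ζ‖ ^ 2 := by
    intro z hz
    by_cases hzd : ‖z - ζ‖ < d
    · have : g z ≤ A := hball ⟨by simpa [dist_eq_norm] using hzd, hz⟩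
      have : 0 ≤ K * ‖z - ζ‖ ^ 2 := by positivity
      linarith
    · have h1 : d ^ 2 ≤ ‖z - ζ‖ ^ 2 := by gcongr; exact not_lt.1 hzd
      have h2 : |M - A| ≤ K * ‖z - ζ‖ ^ 2 := by
        calc |M - A| = K * d ^ 2 := by simp only [K]; field_simp
          _ ≤ _ := by gcongr
      linarith [hM z hz, le_abs_self (M - A)]
  have hcont : Continuous fun w : ℂ =>
      A + K * (2 * (R ^ 2 - ((w - c) * (starRingEnd ℂ) (ζ - c)).re)) := by fun_prop
  have hval : A + K * (2 * (R ^ 2 - ((ζ - c) * (starRingEnd ℂ) (ζ - c)).re)) = A := by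
    have h2 : ‖ζ - c‖ = R := by simpa [dist_eq_norm] using hζ
    rw [Complex.mul_conj, Complex.ofReal_re, Complex.normSq_eq_norm_sq, h2]
    ring
  have := (hcont.tendsto ζ).eventually_lt_const (hval.symm ▸ hAB)
  filter_upwards [this.filter_mono nhdsWithin_le_nhds, self_mem_nhdsWithin] with w hw hwb
  exact (poissonIntegral_quadratic_bound hζ hg hwb hb).trans_lt hw

theorem poissonIntegral_neg : poissonIntegral (-g) c R w = -poissonIntegral g c R w := by
  have : poissonKernel c w • (-g) = (-1 : ℝ) • (poissonKernel c w • g) := by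
    funext z; simp
  rw [poissonIntegral, this, Real.circleAverage_smul]
  simp [poissonIntegral]

theorem tendsto_poissonIntegral {ζ : ℂ} (hζ : ζ ∈ sphere c R) (hR : 0 < R)
    (hg : ContinuousOn g (sphere c R)) :
    Tendsto (poissonIntegral g c R) (𝓝[ball c R] ζ) (𝓝 (g ζ)) := by
  have up : ∀ f : ℂ → ℝ, ContinuousOn f (sphere c R) → ∀ B, f ζ < B →
      ∀ᶠ w in 𝓝[ball c R] ζ, poissonIntegral f c R w < B := by
    intro f hf B hB
    obtain ⟨A, hA1, hA2⟩ := exists_between hB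
    obtain ⟨M, hM⟩ := (isCompact_sphere c R).bddAbove_image hf
    refine eventually_poissonIntegral_lt (M := M) hζ (circleIntegrable_of_continuousOn hR hf)
      (fun z hz => hM (mem_image_of_mem f hz)) ?_ hA2
    filter_upwards [(hf ζ hζ).eventually_lt_const hA1] with z hz using hz.le
  rw [tendsto_order]
  refine ⟨fun B hB => ?_, up g hg⟩
  filter_upwards [up (-g) hg.neg (-B) (by simpa using hB)] with w hw
  rw [poissonIntegral_neg] at hw
  linarith

open Classical in
/-- The solution of the Dirichlet problem in a disk, equal to the data on the bounding circle. -/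
noncomputable def dirichletSolution (g : ℂ → ℝ) (c : ℂ) (R : ℝ) (w : ℂ) : ℝ :=
  if w ∈ ball c R then poissonIntegral g c R w else g w

theorem dirichletSolution_of_mem (hw : w ∈ ball c R) :
    dirichletSolution g c R w = poissonIntegral g c R w := if_pos hw

theorem dirichletSolution_of_notMem (hw : w ∉ ball c R) :
    dirichletSolution g c R w = g w := if_neg hw

theorem harmonicOnNhd_dirichletSolution (hg : CircleIntegrable g c R) :
    HarmonicOnNhd (dirichletSolution g c R) (ball c R) := fun w hw =>
  (harmonicAt_congr_nhds (by
    filter_upwards [isOpen_ball.mem_nhds hw] with z hz using dirichletSolution_of_mem hz)).2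
    (harmonicOnNhd_poissonIntegral hg w hw)

theorem continuousOn_dirichletSolution (hR : 0 < R) (hg : ContinuousOn g (sphere c R)) :
    ContinuousOn (dirichletSolution g c R) (closedBall c R) := by
  intro w hw
  by_cases hwb : w ∈ ball c R
  · exact ((harmonicOnNhd_dirichletSolution (circleIntegrable_of_continuousOn hR hg)
      w hwb).1.continuousAt).continuousWithinAt
  · have hws : w ∈ sphere c R := by
      rw [← closedBall_sdiff_ball]; exact ⟨hw, hwb⟩
    have hu : closedBall c R = ball c R ∪ sphere c R := ball_union_sphere.symm
    rw [ContinuousWithinAt, dirichletSolution_of_notMem hwb, hu, nhdsWithin_union, tendsto_sup]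
    constructor
    · refine (tendsto_poissonIntegral hws hR hg).congr' ?_
      filter_upwards [self_mem_nhdsWithin] with z hz using (dirichletSolution_of_mem hz).symm
    · refine (hg w hws).tendsto.congr' ?_
      filter_upwards [self_mem_nhdsWithin] with z hz
      refine (dirichletSolution_of_notMem ?_).symm
      rw [mem_sphere] at hz
      simp [hz]

end Poisson


/-! ### Local domination, the maximum principle and gluing. -/

/-- The local form of the sub-mean-value principle at a point. -/
def DominatedAt (q : ℂ → EReal) (z : ℂ) : Prop :=
  ∃ r₀ > 0, ∀ r, 0 < r → r < r₀ → ∀ h : ℂ → ℝ, ContinuousOn h (closedBall z r) →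
    HarmonicOnNhd h (ball z r) → (∀ w ∈ sphere z r, q w ≤ (h w : EReal)) → q z ≤ (h z : EReal)

theorem IsSubharmonic.dominatedAt {q : ℂ → EReal} (hq : IsSubharmonic q) (z : ℂ) :
    DominatedAt q z :=
  ⟨1, one_pos, fun r hr _ h hc hh hle => hq.le_harmonic z r hr h hc hh hle z (mem_ball_self hr)⟩

theorem DominatedAt.congr {q q' : ℂ → EReal} {z : ℂ} (hq : DominatedAt q z)
    (h : q =ᶠ[𝓝 z] q') : DominatedAt q' z := by
  obtain ⟨r₀, hr₀, H⟩ := hq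
  obtain ⟨d, hd, hball⟩ := Metric.eventually_nhds_iff_ball.1 h
  refine ⟨min r₀ d, lt_min hr₀ hd, fun r hr hrm f hc hh hle => ?_⟩
  rw [← hball z (mem_ball_self hd)]
  refine H r hr (hrm.trans_le (min_le_left _ _)) f hc hh fun w hw => ?_
  rw [hball w (sphere_subset_closedBall.trans
    (closedBall_subset_ball (hrm.trans_le (min_le_right _ _))) hw)]
  exact hle w hw

theorem dominatedAt_of_harmonicAt {p : ℂ → ℝ} {z : ℂ} (hp : HarmonicAt p z) :
    DominatedAt (fun w => (p w : EReal)) z := by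
  obtain ⟨d, hd, hball⟩ := Metric.eventually_nhds_iff_ball.1 hp.eventually
  refine ⟨d, hd, fun r hr hrd f hc hh hle => ?_⟩
  have hp' : HarmonicOnNhd p (closedBall z r) := fun w hw =>
    hball w (closedBall_subset_ball hrd hw)
  have e1 : Real.circleAverage p z r = p z :=
    InnerProductSpace.HarmonicOnNhd.circleAverage_eq (by rwa [abs_of_pos hr])
  have e2 : Real.circleAverage f z r = f z :=
    InnerProductSpace.HarmonicContOnCl.circleAverage_eq
      (by rw [abs_of_pos hr]; exact HarmonicContOnCl.mk_ball hh hc)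
  rw [EReal.coe_le_coe_iff, ← e1, ← e2]
  refine Real.circleAverage_mono
    (circleIntegrable_of_continuousOn hr (hp'.continuousOn.mono sphere_subset_closedBall))
    (circleIntegrable_of_continuousOn hr (hc.mono sphere_subset_closedBall)) fun w hw => ?_
  rw [abs_of_pos hr] at hw
  exact EReal.coe_le_coe_iff.1 (hle w hw)

theorem DominatedAt.sub_harmonicAt {q : ℂ → EReal} {p : ℂ → ℝ} {z : ℂ} (hq : DominatedAt q z)
    (hp : HarmonicAt p z) : DominatedAt (fun w => q w - (p w : EReal)) z := by
  obtain ⟨r₀, hr₀, H⟩ := hq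
  obtain ⟨d, hd, hball⟩ := Metric.eventually_nhds_iff_ball.1 hp.eventually
  refine ⟨min r₀ d, lt_min hr₀ hd, fun r hr hrm f hc hh hle => ?_⟩
  have hp' : HarmonicOnNhd p (closedBall z r) := fun w hw =>
    hball w (closedBall_subset_ball (hrm.trans_le (min_le_right _ _)) hw)
  have := H r hr (hrm.trans_le (min_le_left _ _)) (f + p) (hc.add hp'.continuousOn)
    (hh.add (hp'.mono ball_subset_closedBall)) fun w hw => by
      have := hle w hw
      rw [EReal.sub_le_iff_le_add (by simp) (by simp)] at this
      simpa using this
  rw [EReal.sub_le_iff_le_add (by simp) (by simp)]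
  simpa using this

/-- The real part of `(1 + w)³` is nonpositive on the part `re w ≤ 1/2` of the unit circle, and at
most `8` there. -/
theorem re_one_add_pow_three {w : ℂ} (hw : ‖w‖ = 1) :
    ((1 + w) ^ 3).re ≤ 8 ∧ (w.re ≤ 1 / 2 → ((1 + w) ^ 3).re ≤ 0) := by
  have h1 : w.re ^ 2 + w.im ^ 2 = 1 := by
    have := Complex.sq_norm w
    rw [hw, Complex.normSq_apply] at this
    linarith
  -- With `w = exp (iθ)` this is `8 cos³(θ/2) cos(3θ/2)`, so the sign changes exactly at `|θ| =
  -- π/3`.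
  have e : ((1 + w) ^ 3).re = 2 * (2 * w.re - 1) * (1 + w.re) ^ 2 := by
    simp only [pow_succ, pow_zero, one_mul, Complex.mul_re, Complex.add_re, Complex.one_re,
      Complex.add_im, Complex.one_im, Complex.mul_im, zero_add]
    have : w.im * w.im = 1 - w.re ^ 2 := by linarith
    linear_combination (-3 - 3 * w.re) * this
  have hle : w.re ≤ 1 := by nlinarith [sq_nonneg w.im]
  have hge : -1 ≤ w.re := by nlinarith [sq_nonneg w.im]
  rw [e]
  constructor
  · nlinarith [mul_nonneg (sub_nonneg.2 hle) (sub_nonneg.2 hge), sq_nonneg (1 + w.re),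
      mul_nonneg (sub_nonneg.2 hle) (sq_nonneg (1 + w.re))]
  · intro h
    nlinarith [sq_nonneg (1 + w.re), mul_nonneg (by linarith : (0:ℝ) ≤ 1 - 2 * w.re)
      (sq_nonneg (1 + w.re))]

/-- The harmonic function `Re (1 + (z - c) / s)³`. -/
noncomputable def cubicPeak (c s : ℂ) (z : ℂ) : ℝ := ((1 + (z - c) / s) ^ 3).re

theorem harmonicOnNhd_cubicPeak (c s : ℂ) (G : Set ℂ) : HarmonicOnNhd (cubicPeak c s) G :=
  harmonicOnNhd_re_of_differentiable (by fun_prop) G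

theorem cubicPeak_self (c s : ℂ) : cubicPeak c s c = 1 := by simp [cubicPeak]

/-- Maximum principle. -/
theorem le_zero_of_dominatedAt {G : Set ℂ} (hGo : IsOpen G) (hGb : Bornology.IsBounded G)
    {v : ℂ → EReal} (husc : UpperSemicontinuousOn v (closure G)) (htop : ∀ z ∈ G, v z < ⊤)
    (hdom : ∀ z ∈ G, DominatedAt v z) (hbd : ∀ z ∈ frontier G, v z ≤ 0) :
    ∀ z ∈ G, v z ≤ 0 := by
  intro z₁ hz₁
  by_contra hcon
  push Not at hcon
  have hK : IsCompact (closure G) := hGb.isCompact_closure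
  obtain ⟨z₂, hz₂, hmax⟩ := husc.exists_isMaxOn ⟨z₁, subset_closure hz₁⟩ hK
  have hm0 : 0 < v z₂ := hcon.trans_le (hmax (subset_closure hz₁))
  have hcl : ∀ z ∈ closure G, v z = v z₂ → z ∈ G := by
    intro z hz hv
    by_contra hzG
    have : z ∈ frontier G := by rw [frontier, hGo.interior_eq]; exact ⟨hz, hzG⟩
    exact absurd (hbd z this) (not_le.2 (hv ▸ hm0))
  have hA : IsCompact (closure G ∩ v ⁻¹' Ici (v z₂)) := husc.isCompact_inter_preimage_Ici hK _
  -- Among the maximum points one with the largest real part is chosen. On a small circle about it,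
  -- `v` is then strictly below the maximum on the right arc, so no integral of `v` is needed.
  obtain ⟨z₃, ⟨hz₃, hz₃v⟩, hz₃max⟩ := hA.exists_isMaxOn ⟨z₂, hz₂, show v z₂ ≤ v z₂ from le_rfl⟩
    Complex.continuous_re.continuousOn
  have hv₃ : v z₃ = v z₂ := le_antisymm (hmax hz₃) hz₃v
  have hz₃G := hcl z₃ hz₃ hv₃
  obtain ⟨m, hm⟩ : ∃ m : ℝ, v z₃ = m := by
    refine ⟨(v z₃).toReal, (EReal.coe_toReal (htop z₃ hz₃G).ne ?_).symm⟩
    rw [hv₃]; exact (bot_le.trans_lt hm0).ne'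
  have hle : ∀ z ∈ closure G, v z ≤ m := fun z hz => by rw [← hm, hv₃]; exact hmax hz
  have hlt : ∀ z ∈ closure G, z₃.re < z.re → v z < m := by
    intro z hz hre
    refine lt_of_le_of_ne (hle z hz) fun h => ?_
    have : z ∈ closure G ∩ v ⁻¹' Ici (v z₂) := ⟨hz, by
      rw [mem_preimage, mem_Ici, ← hv₃, hm, h]⟩
    exact absurd (hz₃max this) (not_le.2 hre)
  obtain ⟨r₀, hr₀, H⟩ := hdom z₃ hz₃G
  obtain ⟨d, hd, hball⟩ := Metric.isOpen_iff.1 hGo z₃ hz₃G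
  set r := min r₀ d / 2 with hr
  have hrpos : 0 < r := by positivity
  have hrr₀ : r < r₀ := by rw [hr]; linarith [min_le_left r₀ d]
  have hrd : r < d := by rw [hr]; linarith [min_le_right r₀ d]
  have hsub : sphere z₃ r ⊆ closure G := fun w hw =>
    subset_closure (hball (closedBall_subset_ball hrd (sphere_subset_closedBall hw)))
  -- the right arc of the circle
  set B : Set ℂ := sphere z₃ r ∩ {w | z₃.re + r / 2 ≤ w.re}
  have hB : IsCompact B := (isCompact_sphere z₃ r).inter_right
    (isClosed_le continuous_const Complex.continuous_re)
  obtain ⟨δ, hδ, hBδ⟩ : ∃ δ : ℝ, 0 < δ ∧ ∀ w ∈ B, v w ≤ ((m - δ : ℝ) : EReal) := by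
    have hBne : B.Nonempty := ⟨z₃ + r, by simp [abs_of_pos hrpos], by simp; linarith⟩
    obtain ⟨w₀, hw₀, hw₀max⟩ := (husc.mono (inter_subset_left.trans hsub)).exists_isMaxOn hBne hB
    have h1 : v w₀ < m := hlt w₀ (hsub hw₀.1) (by have := hw₀.2; simp at this; linarith)
    obtain ⟨y, hy1, hy2⟩ := EReal.lt_iff_exists_real_btwn.1 h1
    refine ⟨m - y, by have := EReal.coe_lt_coe_iff.1 hy2; linarith, fun w hw => ?_⟩
    have := (hw₀max hw : v w ≤ v w₀)
    simpa using this.trans hy1.le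
  -- The peak is at most `8` on the right arc, where `v ≤ m - δ`, and nonpositive on the rest of the
  -- circle, where `v ≤ m`. So the test function dominates `v` on the circle, while its value at the
  -- centre is `m - δ / 8 < m`.
  have hf := H r hrpos hrr₀ (fun z => m - δ / 8 * cubicPeak z₃ r z)
    (continuousOn_const.sub (continuousOn_const.mul
      (harmonicOnNhd_cubicPeak z₃ r _).continuousOn))
    ((harmonicOnNhd_const m).sub ((harmonicOnNhd_cubicPeak z₃ r _).const_smul (c := δ / 8)))
    fun w hw => by
      have hn : ‖(w - z₃) / (r : ℂ)‖ = 1 := by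
        rw [mem_sphere, dist_eq_norm] at hw
        rw [norm_div, hw, Complex.norm_real, Real.norm_eq_abs, abs_of_pos hrpos,
          div_self hrpos.ne']
      obtain ⟨h8, h0⟩ := re_one_add_pow_three hn
      by_cases hwB : w ∈ B
      · refine (hBδ w hwB).trans (EReal.coe_le_coe_iff.2 ?_)
        simp only [cubicPeak]
        nlinarith
      · refine (hle w (hsub hw)).trans (EReal.coe_le_coe_iff.2 ?_)
        have hre : ((w - z₃) / (r : ℂ)).re ≤ 1 / 2 := by
          rw [Complex.div_ofReal_re, Complex.sub_re, div_le_div_iff₀ hrpos two_pos]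
          have : ¬ (z₃.re + r / 2 ≤ w.re) := fun h => hwB ⟨hw, h⟩
          linarith
        have := h0 hre
        simp only [cubicPeak]
        nlinarith
  rw [hm, cubicPeak_self, EReal.coe_le_coe_iff] at hf
  linarith

theorem upperSemicontinuousWithinAt_sub {v : ℂ → EReal} {h : ℂ → ℝ} {s : Set ℂ} {z : ℂ}
    (hv : UpperSemicontinuousWithinAt v s z) (hh : ContinuousWithinAt h s z) :
    UpperSemicontinuousWithinAt (fun w => v w - (h w : EReal)) s z := by
  have h1 : ContinuousWithinAt (fun w => ((-h w : ℝ) : EReal)) s z :=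
    continuous_coe_real_ereal.continuousAt.comp_continuousWithinAt hh.neg
  have := hv.add' h1.upperSemicontinuousWithinAt
    (EReal.continuousAt_add (Or.inr (by simp)) (Or.inr (by simp)))
  simpa [sub_eq_add_neg] using this

theorem le_of_dominatedAt {G : Set ℂ} (hGo : IsOpen G) (hGb : Bornology.IsBounded G)
    {v : ℂ → EReal} {h : ℂ → ℝ} (husc : UpperSemicontinuousOn v (closure G))
    (htop : ∀ z ∈ G, v z < ⊤) (hdom : ∀ z ∈ G, DominatedAt v z)
    (hc : ContinuousOn h (closure G)) (hh : HarmonicOnNhd h G)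
    (hbd : ∀ z ∈ frontier G, v z ≤ (h z : EReal)) :
    ∀ z ∈ G, v z ≤ (h z : EReal) := by
  intro z hz
  have := le_zero_of_dominatedAt hGo hGb (v := fun w => v w - (h w : EReal))
    (fun z hz => upperSemicontinuousWithinAt_sub (husc z hz) (hc z hz))
    (fun z hz => ?_) (fun z hz => (hdom z hz).sub_harmonicAt (hh z hz))
    (fun z hz => ?_) z hz
  · rw [EReal.sub_le_iff_le_add (by simp) (by simp)] at this
    simpa using this
  · rw [sub_eq_add_neg]
    exact EReal.add_lt_top (htop z hz).ne (by rw [← EReal.coe_neg]; simp)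
  · rw [EReal.sub_le_iff_le_add (by simp) (by simp)]
    simpa using hbd z hz

/-- Comparison at the centres of small circles already gives the maximum principle, and that in turn
gives domination on arbitrary disks. Subharmonicity is thus a local property. -/
theorem isSubharmonic_of_dominatedAt {q : ℂ → EReal} (htop : ∀ z, q z < ⊤)
    (husc : UpperSemicontinuous q) (hdom : ∀ z, DominatedAt q z) : IsSubharmonic q where
  lt_top := htop
  upperSemicontinuous := husc
  le_harmonic c r hr h hc hh hle := by
    refine le_of_dominatedAt isOpen_ball isBounded_ball (husc.upperSemicontinuousOn _)
      (fun z _ => htop z) (fun z _ => hdom z) ?_ hh ?_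
    · rwa [closure_ball c hr.ne']
    · rwa [frontier_ball c hr.ne']

/-- Subharmonic functions are dominated by the Poisson integrals of continuous majorants. -/
theorem IsSubharmonic.le_poissonIntegral {q : ℂ → EReal} (hq : IsSubharmonic q) {c : ℂ} {R : ℝ}
    (hR : 0 < R) {f : ℂ → ℝ} (hf : ContinuousOn f (sphere c R))
    (hle : ∀ z ∈ sphere c R, q z ≤ (f z : EReal)) {w : ℂ} (hw : w ∈ ball c R) :
    q w ≤ (poissonIntegral f c R w : EReal) := by
  rw [← dirichletSolution_of_mem hw]
  refine hq.le_harmonic c R hR _ (continuousOn_dirichletSolution hR hf)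
    (harmonicOnNhd_dirichletSolution (circleIntegrable_of_continuousOn hR hf)) (fun z hz => ?_) w hw
  rw [dirichletSolution_of_notMem]
  · exact hle z hz
  · rw [mem_sphere] at hz
    simp [hz]

/-- Gluing: a subharmonic function may be increased inside a ball to a function with the same
boundary values which is dominated in the ball. -/
theorem isSubharmonic_glue {q v : ℂ → EReal} (hq : IsSubharmonic q) {c : ℂ} {R : ℝ}
    (hout : ∀ z, z ∉ ball c R → v z = q z) (hle : ∀ z, q z ≤ v z) (htop : ∀ z, v z < ⊤)
    (husc : ∀ z ∈ closedBall c R, UpperSemicontinuousWithinAt v (closedBall c R) z)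
    (hdom : ∀ z ∈ ball c R, DominatedAt v z) : IsSubharmonic v := by
  refine isSubharmonic_of_dominatedAt htop (fun z => ?_) fun z => ?_
  · refine upperSemicontinuousWithinAt_univ_iff.1 ?_
    have hu : (univ : Set ℂ) = closedBall c R ∪ (ball c R)ᶜ := by
      refine (eq_univ_of_forall fun w => ?_).symm
      by_cases hw : w ∈ ball c R
      · exact Or.inl (ball_subset_closedBall hw)
      · exact Or.inr hw
    have h2 : z ∉ ball c R → UpperSemicontinuousWithinAt v (ball c R)ᶜ z := by
      intro hz y hy
      rw [hout z hz] at hy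
      filter_upwards [(hq.upperSemicontinuous z y hy).filter_mono nhdsWithin_le_nhds,
        self_mem_nhdsWithin] with w hw hwb
      rwa [hout w hwb]
    intro y hy
    rw [hu, nhdsWithin_union, eventually_sup]
    by_cases hzb : z ∈ ball c R
    · refine ⟨husc z (ball_subset_closedBall hzb) y hy, ?_⟩
      have : 𝓝[(ball c R)ᶜ] z = ⊥ := by
        rw [← notMem_closure_iff_nhdsWithin_eq_bot, isOpen_ball.isClosed_compl.closure_eq]
        simpa using hzb
      rw [this]; exact eventually_bot
    · refine ⟨?_, h2 hzb y hy⟩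
      by_cases hzc : z ∈ closedBall c R
      · exact husc z hzc y hy
      · have : 𝓝[closedBall c R] z = ⊥ := by
          rw [← notMem_closure_iff_nhdsWithin_eq_bot, isClosed_closedBall.closure_eq]
          exact hzc
        rw [this]; exact eventually_bot
  · by_cases hz : z ∈ ball c R
    · exact hdom z hz
    -- Where `v` agrees with `q`, increasing `q` elsewhere only strengthens the hypothesis on the
    -- circle.
    · obtain ⟨r₀, hr₀, H⟩ := hq.dominatedAt z
      refine ⟨r₀, hr₀, fun r hr hrr h hc hh hw => ?_⟩
      rw [hout z hz]
      exact H r hr hrr h hc hh fun w hws => (hle w).trans (hw w hws)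


/-! ### Logarithmic singularities and the largest competitor. -/

theorem IsSubharmonic.exists_bound {q : ℂ → EReal} (hq : IsSubharmonic q) {K : Set ℂ}
    (hK : IsCompact K) : ∃ M : ℝ, ∀ z ∈ K, q z ≤ (M : EReal) := by
  rcases K.eq_empty_or_nonempty with rfl | hne
  · exact ⟨0, by simp⟩
  obtain ⟨z₀, _, hmax⟩ := (hq.upperSemicontinuous.upperSemicontinuousOn K).exists_isMaxOn hne hK
  obtain ⟨M, hM, _⟩ := EReal.lt_iff_exists_real_btwn.1 (hq.lt_top z₀)
  exact ⟨M, fun z hz => (hmax hz : q z ≤ q z₀).trans hM.le⟩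

theorem harmonicAt_log_norm_sub {w₀ z : ℂ} (hz : z ≠ w₀) :
    HarmonicAt (fun w => Real.log ‖w - w₀‖) z :=
  AnalyticAt.harmonicAt_log_norm (f := fun w => w - w₀) (by fun_prop) (sub_ne_zero.2 hz)

/-- The unspecified `O(1)` at the singularity is replaced by explicit boundary data. On an annulus,
`q` is compared with the same expression with `τ - δ` in place of `τ`. The gain `δ log s` beats the
constant `C` on a small inner circle, and then `δ` tends to `0`. -/
theorem SH.le_log_add {q : ℂ → EReal} {τ : ℝ} {w₀ : ℂ} (hq : q ∈ SH τ w₀) {ρ : ℝ}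
    {p : ℂ → ℝ} (hpc : ContinuousOn p (closedBall w₀ ρ)) (hp : HarmonicOnNhd p (ball w₀ ρ))
    (hle : ∀ z ∈ sphere w₀ ρ, q z ≤ (p z : EReal)) {z : ℂ} (hz : z ∈ ball w₀ ρ) (hzw : z ≠ w₀) :
    q z ≤ ((τ * (Real.log ‖z - w₀‖ - Real.log ρ) + p z : ℝ) : EReal) := by
  obtain ⟨hsub, C, hC⟩ := hq
  have hzn : 0 < ‖z - w₀‖ := norm_pos_iff.2 (sub_ne_zero.2 hzw)
  have hzρ : ‖z - w₀‖ < ρ := by simpa [dist_eq_norm] using hz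
  obtain ⟨m, hm⟩ := (isCompact_closedBall w₀ ρ).bddBelow_image hpc
  have key : ∀ δ : ℝ, 0 < δ →
      q z ≤ (((τ - δ) * (Real.log ‖z - w₀‖ - Real.log ρ) + p z : ℝ) : EReal) := by
    intro δ hδ
    obtain ⟨d, hd, hCd⟩ := Metric.mem_nhdsWithin_iff.1 hC
    have hev : ∀ᶠ s : ℝ in 𝓝[>] 0,
        Real.log s ≤ (m - C - (τ - δ) * Real.log ρ) / δ :=
      (Real.tendsto_log_nhdsGT_zero.eventually_le_atBot _)
    have hev2 : ∀ᶠ s : ℝ in 𝓝[>] 0, s ∈ Ioo 0 (min d ‖z - w₀‖) :=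
      Ioo_mem_nhdsGT (lt_min hd hzn)
    obtain ⟨s, hs1, hs0, hs2⟩ := (hev.and hev2).exists
    have hsd : s < d := hs2.trans_le (min_le_left _ _)
    have hsz : s < ‖z - w₀‖ := hs2.trans_le (min_le_right _ _)
    set G : Set ℂ := ball w₀ ρ \ closedBall w₀ s with hG
    have hclG : closure G ⊆ closedBall w₀ ρ \ ball w₀ s := by
      refine closure_minimal ?_ (isClosed_closedBall.sdiff isOpen_ball)
      exact sdiff_subset_sdiff ball_subset_closedBall ball_subset_closedBall
    have hne : ∀ w ∈ closure G, w ≠ w₀ := by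
      rintro w hw rfl
      exact (hclG hw).2 (mem_ball_self hs0)
    have hGo : IsOpen G := isOpen_ball.sdiff isClosed_closedBall
    have hlog : HarmonicOnNhd (fun w => (τ - δ) * (Real.log ‖w - w₀‖ - Real.log ρ)) (closure G) :=
      HarmonicOnNhd.const_smul (c := τ - δ) (HarmonicOnNhd.sub
        (fun w hw => harmonicAt_log_norm_sub (hne w hw)) (harmonicOnNhd_const (Real.log ρ)))
    refine le_of_dominatedAt (h := fun w => (τ - δ) * (Real.log ‖w - w₀‖ - Real.log ρ) + p w)
      hGo (isBounded_ball.subset sdiff_subset)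
      (hsub.upperSemicontinuous.upperSemicontinuousOn _) (fun z _ => hsub.lt_top z)
      (fun z _ => hsub.dominatedAt z)
      (hlog.continuousOn.add (hpc.mono (hclG.trans sdiff_subset)))
      ((hlog.mono subset_closure).add (hp.mono sdiff_subset)) (fun w hw => ?_) z
      ⟨hz, by simpa [dist_eq_norm] using hsz⟩
    have hwc := hclG hw.1
    have hw1 : ‖w - w₀‖ ≤ ρ := by simpa [dist_eq_norm] using hwc.1
    have hw2 : s ≤ ‖w - w₀‖ := by simpa [dist_eq_norm] using hwc.2
    have hwG : w ∉ G := by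
      have := hw.2
      rwa [hGo.interior_eq] at this
    rcases hw1.eq_or_lt with h1 | h1
    · have := hle w (by simpa [dist_eq_norm] using h1)
      simpa [h1] using this
    · have h2 : ‖w - w₀‖ = s := by
        by_contra hcon
        refine hwG ⟨by simpa [dist_eq_norm] using h1, ?_⟩
        simpa [dist_eq_norm] using lt_of_le_of_ne hw2 (Ne.symm hcon)
      have h3 : q w ≤ ((τ * Real.log ‖w - w₀‖ + C : ℝ) : EReal) :=
        hCd ⟨by simpa [dist_eq_norm, h2] using hsd, hne w hw.1⟩
      refine h3.trans (EReal.coe_le_coe_iff.2 ?_)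
      have h4 : m ≤ p w := hm (mem_image_of_mem p hwc.1)
      rw [le_div_iff₀ hδ] at hs1
      simp only [h2]
      linarith
  have hlim : Tendsto (fun δ : ℝ =>
      (((τ - δ) * (Real.log ‖z - w₀‖ - Real.log ρ) + p z : ℝ) : EReal)) (𝓝[>] 0)
      (𝓝 ((τ * (Real.log ‖z - w₀‖ - Real.log ρ) + p z : ℝ) : EReal)) := by
    have : Continuous fun δ : ℝ =>
        (((τ - δ) * (Real.log ‖z - w₀‖ - Real.log ρ) + p z : ℝ) : EReal) :=
      continuous_coe_real_ereal.comp (by fun_prop)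
    simpa using (this.tendsto 0).mono_left nhdsWithin_le_nhds
  refine ge_of_tendsto hlim ?_
  filter_upwards [self_mem_nhdsWithin] with δ hδ using key δ hδ

section Regularization

variable {v : ℂ → EReal}

theorem le_limsup_nhds (z : ℂ) : v z ≤ limsup v (𝓝 z) := by
  refine le_of_forall_gt fun y hy => ?_
  exact (eventually_lt_of_limsup_lt hy).self_of_nhds

theorem upperSemicontinuous_limsup_nhds : UpperSemicontinuous fun z => limsup v (𝓝 z) := by
  intro z y hy
  obtain ⟨y', hy1, hy2⟩ := exists_between hy
  have := (eventually_lt_of_limsup_lt hy1).eventually_nhds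
  filter_upwards [this] with w hw
  exact (limsup_le_of_le (h := hw.mono fun _ h => h.le)).trans_lt hy2

theorem limsup_nhds_le {h : ℂ → ℝ} {z : ℂ} (hc : ContinuousAt h z)
    (hle : ∀ᶠ w in 𝓝 z, v w ≤ (h w : EReal)) : limsup v (𝓝 z) ≤ (h z : EReal) := by
  have : Tendsto (fun w => (h w : EReal)) (𝓝 z) (𝓝 (h z : EReal)) :=
    (continuous_coe_real_ereal.tendsto _).comp hc
  rw [← this.limsup_eq]
  exact limsup_le_limsup hle

end Regularization

section Obstacle

variable {Q : ℂ → ℝ} {τ : ℝ} {w₀ : ℂ}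

theorem obstacle_le (z : ℂ) : obstacle Q τ w₀ z ≤ (Q z : EReal) :=
  iSup₂_le fun _ hq => hq.2 z

theorem le_obstacle {q : ℂ → EReal} (hq : q ∈ SH τ w₀) (hle : ∀ w, q w ≤ (Q w : EReal)) (z : ℂ) :
    q z ≤ obstacle Q τ w₀ z :=
  le_iSup₂_of_le (f := fun q (_ : q ∈ {q | q ∈ SH τ w₀ ∧ ∀ w, q w ≤ (Q w : EReal)}) => q z)
    q ⟨hq, hle⟩ le_rfl

theorem obstacle_anti {τ' : ℝ} (h : τ' ≤ τ) (z : ℂ) :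
    obstacle Q τ w₀ z ≤ obstacle Q τ' w₀ z := by
  refine iSup₂_le fun q hq => le_obstacle ⟨hq.1.1, ?_⟩ hq.2 z
  obtain ⟨C, hC⟩ := hq.1.2
  refine ⟨C, ?_⟩
  have : ∀ᶠ w in 𝓝[≠] w₀, w ∈ ball w₀ 1 := nhdsWithin_le_nhds (ball_mem_nhds w₀ one_pos)
  filter_upwards [hC, this] with w hw hw1
  refine hw.trans (EReal.coe_le_coe_iff.2 ?_)
  have : Real.log ‖w - w₀‖ ≤ 0 :=
    Real.log_nonpos (norm_nonneg _) (by rw [mem_ball, dist_eq_norm] at hw1; exact hw1.le)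
  nlinarith

/-- Each defining bound holds uniformly over the competitors and has a continuous right-hand side,
so it survives the supremum and the regularization. For the singularity, the uniform constant is the
maximum of `Q` on the unit circle about `w₀`. -/
theorem limsup_obstacle_mem (hQ : Continuous Q) :
    (fun z => limsup (obstacle Q τ w₀) (𝓝 z)) ∈ SH τ w₀ := by
  refine ⟨⟨fun z => ?_, upperSemicontinuous_limsup_nhds, fun c r hr h hc hh hle z hz => ?_⟩, ?_⟩
  · exact (limsup_nhds_le hQ.continuousAt (Eventually.of_forall obstacle_le)).trans_lt
      (EReal.coe_lt_top _)
  · refine limsup_nhds_le (hc.continuousAt (closedBall_mem_nhds_of_mem hz)) ?_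
    filter_upwards [isOpen_ball.mem_nhds hz] with w hw
    refine iSup₂_le fun q hq => hq.1.1.le_harmonic c r hr h hc hh (fun ξ hξ => ?_) w hw
    exact ((le_obstacle hq.1 hq.2 ξ).trans (le_limsup_nhds ξ)).trans (hle ξ hξ)
  · obtain ⟨M, hM⟩ := (isCompact_sphere w₀ 1).bddAbove_image hQ.continuousOn
    refine ⟨M, ?_⟩
    have : ∀ᶠ w in 𝓝[≠] w₀, w ∈ ball w₀ 1 := nhdsWithin_le_nhds (ball_mem_nhds w₀ one_pos)
    filter_upwards [this, self_mem_nhdsWithin] with z hz hzw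
    refine limsup_nhds_le (h := fun z => τ * Real.log ‖z - w₀‖ + M) ?_ ?_
    · exact ((harmonicAt_log_norm_sub hzw).1.continuousAt.const_mul τ).add continuousAt_const
    · filter_upwards [isOpen_ball.mem_nhds hz, isOpen_ne.mem_nhds hzw] with w hw hww
      refine iSup₂_le fun q hq => ?_
      have := SH.le_log_add hq.1 (p := fun _ => M) continuousOn_const
        (harmonicOnNhd_const M) (fun ξ hξ => (hq.2 ξ).trans
          (EReal.coe_le_coe_iff.2 (hM (mem_image_of_mem Q hξ)))) hw hww
      simpa using this

/-- The regularization still lies below the continuous function `Q`, so it is a competitor and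
cannot exceed the supremum. -/
theorem limsup_obstacle_eq (hQ : Continuous Q) :
    (fun z => limsup (obstacle Q τ w₀) (𝓝 z)) = obstacle Q τ w₀ := by
  funext z
  refine le_antisymm (le_obstacle (limsup_obstacle_mem hQ) (fun w => ?_) z) (le_limsup_nhds z)
  exact limsup_nhds_le hQ.continuousAt (Eventually.of_forall obstacle_le)

theorem obstacle_mem (hQ : Continuous Q) : obstacle Q τ w₀ ∈ SH τ w₀ :=
  limsup_obstacle_eq (τ := τ) (w₀ := w₀) hQ ▸ limsup_obstacle_mem hQ

theorem isOpen_compl_droplet (hQ : Continuous Q) : IsOpen (droplet Q τ w₀)ᶜ := by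
  rw [isOpen_iff_mem_nhds]
  intro z hz
  have hlt : obstacle Q τ w₀ z < Q z := lt_of_le_of_ne (obstacle_le z) hz
  obtain ⟨y, hy1, hy2⟩ := exists_between hlt
  have h1 := (obstacle_mem (τ := τ) (w₀ := w₀) hQ).1.upperSemicontinuous z y hy1
  have h2 : ∀ᶠ w in 𝓝 z, y < (Q w : EReal) :=
    ((continuous_coe_real_ereal.comp hQ).tendsto z).eventually_const_lt hy2
  filter_upwards [h1, h2] with w hw1 hw2
  exact (hw1.trans hw2).ne

theorem obstacle_lt {z : ℂ} (hz : z ∈ (droplet Q τ w₀)ᶜ) : obstacle Q τ w₀ z < Q z :=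
  lt_of_le_of_ne (obstacle_le z) hz

theorem isOpen_offSpectral (hQ : Continuous Q) : IsOpen (offSpectral Q w₀ τ) :=
  (isOpen_compl_droplet hQ).connectedComponentIn

theorem offSpectral_subset : offSpectral Q w₀ τ ⊆ (droplet Q τ w₀)ᶜ :=
  connectedComponentIn_subset _ _

/-- A frontier point lying in `F` would have an open component of its own, which meets the given one
and hence coincides with it. -/
theorem frontier_connectedComponentIn_subset {F : Set ℂ} (hF : IsOpen F) (w : ℂ) :
    frontier (connectedComponentIn F w) ⊆ Fᶜ := by
  intro z hz hzF
  obtain ⟨x, hx1, hx2⟩ := mem_closure_iff.1 hz.1 _ (hF.connectedComponentIn (x := z))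
    (mem_connectedComponentIn hzF)
  refine hz.2 ?_
  rw [hF.connectedComponentIn.interior_eq, connectedComponentIn_eq hx2, ← connectedComponentIn_eq hx1]
  exact mem_connectedComponentIn hzF

theorem frontier_offSpectral_subset (hQ : Continuous Q) :
    frontier (offSpectral Q w₀ τ) ⊆ droplet Q τ w₀ := by
  rw [← compl_compl (droplet Q τ w₀)]
  exact frontier_connectedComponentIn_subset (isOpen_compl_droplet hQ) w₀

theorem offSpectral_mono {τ' : ℝ} (h : τ' ≤ τ) :
    offSpectral Q w₀ τ' ⊆ offSpectral Q w₀ τ := by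
  refine connectedComponentIn_mono _ (compl_subset_compl.2 fun z hz => ?_)
  exact le_antisymm (obstacle_le z)
    ((show obstacle Q τ w₀ z = Q z from hz) ▸ obstacle_anti h z)

end Obstacle

/-! ### Poisson modification of a subharmonic function. -/

/-- A subharmonic function which is `-∞` on a nonempty open set is `-∞` everywhere. -/
theorem IsSubharmonic.interior_eq_bot {q : ℂ → EReal} (hq : IsSubharmonic q) {z₀ : ℂ}
    (hz₀ : q z₀ ≠ ⊥) : interior {z | q z = ⊥} = ∅ := by
  by_contra hne
  set W := interior {z | q z = ⊥} with hW
  have hclosed : IsClosed W := by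
    refine isClosed_of_closure_subset fun z hz => ?_
    -- Any point `p` of `W` serves: the argument uses the circle about `z` through `p`.
    obtain ⟨p, hpb, hpW⟩ := mem_closure_iff_nhds.1 hz univ univ_mem
    by_cases hpz : p = z
    · rwa [← hpz]
    set R := ‖p - z‖
    have hR : 0 < R := norm_pos_iff.2 (sub_ne_zero.2 hpz)
    obtain ⟨d, hd, hball⟩ := Metric.isOpen_iff.1 isOpen_interior p hpW
    obtain ⟨M, hM⟩ := hq.exists_bound (isCompact_sphere z R)
    -- The bump lives where `q = ⊥`, so a majorant of `q` on the circle may be lowered by `t b` for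
    -- every `t`. Its Poisson integral at `w` drops by `t` times a positive number.
    set b : ℂ → ℝ := fun ξ => max 0 (d - ‖ξ - p‖) with hb
    have hbc : Continuous b := by unfold b; fun_prop
    have hps : p ∈ sphere z |R| := by
      rw [abs_of_pos hR]; simp [R]
    suffices ball z R ⊆ {z | q z = ⊥} from
      interior_maximal this isOpen_ball (mem_ball_self hR)
    intro w hw
    have hpos : 0 < poissonIntegral b z R w := by
      rw [← image_circleMap_Ioc] at hps
      obtain ⟨θ, hθ, hθp⟩ := hps
      rw [poissonIntegral, Real.circleAverage_def, smul_eq_mul]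
      refine mul_pos (by positivity) (intervalIntegral.integral_pos (by positivity) ?_ ?_ ?_)
      · refine ContinuousOn.mul ?_ (by fun_prop)
        refine (continuousOn_poissonKernel_sphere hw).comp (by fun_prop) fun θ _ => ?_
        exact circleMap_mem_sphere' z R θ
      · intro θ _
        exact mul_nonneg (poissonKernel_pos (circleMap_mem_sphere z hR.le θ) hw).le
          (le_max_left _ _)
      · refine ⟨θ, Ioc_subset_Icc_self hθ, ?_⟩
        refine mul_pos (poissonKernel_pos (circleMap_mem_sphere z hR.le θ) hw) ?_
        rw [hθp]
        simp [hb, hd]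
    have hle : ∀ t : ℝ, 0 < t → q w ≤ ((M - t * poissonIntegral b z R w : ℝ) : EReal) := by
      intro t ht
      have h1 := hq.le_poissonIntegral hR (f := fun ξ => M - t * b ξ)
        (by fun_prop) (fun ξ hξ => ?_) hw
      · refine h1.trans (le_of_eq ?_)
        congr 1
        have hcb := circleIntegrable_of_continuousOn hR (hbc.continuousOn (s := sphere z R))
        have hcM : CircleIntegrable (fun _ : ℂ => M) z R := circleIntegrable_const _ _ _
        have e : poissonKernel z w • (fun ξ => M - t * b ξ) =
            poissonKernel z w • (fun _ : ℂ => M) - t • (poissonKernel z w • b) := by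
          funext ξ; simp; ring
        rw [poissonIntegral, e, Real.circleAverage_sub
          (circleIntegrable_poissonKernel_smul hcM hw)
          (circleIntegrable_poissonKernel_smul hcb hw).const_smul, Real.circleAverage_smul]
        have := poissonIntegral_of_harmonic (harmonicOnNhd_const M) hw
        rw [poissonIntegral] at this
        rw [this, smul_eq_mul, poissonIntegral]
      · by_cases hξd : ‖ξ - p‖ < d
        · have : ξ ∈ {z | q z = ⊥} := interior_subset (hball (by simpa [dist_eq_norm] using hξd))
          rw [show q ξ = ⊥ from this]; exact bot_le
        · have : b ξ = 0 := max_eq_left (by linarith [not_lt.1 hξd])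
          simpa [this] using hM ξ hξ
    rw [mem_ofPred_eq, EReal.eq_bot_iff_forall_lt]
    intro y
    set β := poissonIntegral b z R w
    refine (hle ((|M - y| + 1) / β) (by positivity)).trans_lt (EReal.coe_lt_coe_iff.2 ?_)
    rw [div_mul_cancel₀ _ hpos.ne']
    linarith [le_abs_self (M - y)]
  have := IsClopen.eq_univ ⟨hclosed, isOpen_interior⟩ (nonempty_iff_ne_empty.2 hne)
  have hmem : z₀ ∈ {z | q z = ⊥} := interior_subset (show z₀ ∈ W from this ▸ mem_univ z₀)
  exact hz₀ hmem


/-- A bounded above semicontinuous function on a compact set is the pointwise limit of a decreasing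
sequence of continuous functions. -/
theorem exists_antitone_continuous {q : ℂ → EReal} {K : Set ℂ} (hne : K.Nonempty)
    (husc : UpperSemicontinuous q) {m : ℝ} (hm : ∀ z ∈ K, q z ≤ (m : EReal)) :
    ∃ f : ℕ → ℂ → ℝ, (∀ n, Continuous (f n)) ∧ (∀ x, Antitone fun n => f n x) ∧
      (∀ n, ∀ z ∈ K, q z ≤ (f n z : EReal)) ∧ (∀ n x, f n x ≤ m) ∧
      ∀ z ∈ K, ∀ B : ℝ, q z < (B : EReal) → ∃ n, f n z < B := by
  have : Nonempty K := hne.to_subtype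
  -- Cutting off below makes the values real. The summand `|m|` keeps the floor below the upper
  -- bound `m`, and the floor descends with `n`, so the value `-∞` is still approached.
  set a : ℕ → ℂ → EReal := fun n w => max (q w) ((-(n + |m|) : ℝ) : EReal) with ha
  have ha_le : ∀ n, ∀ w ∈ K, a n w ≤ (m : EReal) := fun n w hw =>
    max_le (hm w hw) (EReal.coe_le_coe_iff.2 (by
      have := neg_abs_le m
      have : (0 : ℝ) ≤ n := n.cast_nonneg
      linarith))
  have ha_coe : ∀ n, ∀ w ∈ K, ((a n w).toReal : EReal) = a n w := fun n w hw =>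
    EReal.coe_toReal ((ha_le n w hw).trans_lt (EReal.coe_lt_top m)).ne
      ((EReal.bot_lt_coe _).trans_le (le_max_right _ _)).ne'
  have ha_le' : ∀ n, ∀ w ∈ K, (a n w).toReal ≤ m := fun n w hw => by
    rw [← EReal.coe_le_coe_iff, ha_coe n w hw]; exact ha_le n w hw
  -- The sup-convolution with `n ‖·‖` is `n`-Lipschitz, and it decreases to the upper semicontinuous
  -- function.
  set f : ℕ → ℂ → ℝ := fun n x => ⨆ w : K, ((a n w).toReal - n * ‖x - w‖) with hf
  have hterm : ∀ (n : ℕ) (x : ℂ) (w : K), (a n w).toReal - n * ‖x - w‖ ≤ m := fun n x w => by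
    have := ha_le' n w w.2
    have : 0 ≤ (n : ℝ) * ‖x - w‖ := by positivity
    linarith
  have hbdd : ∀ (n : ℕ) (x : ℂ), BddAbove (range fun w : K => (a n w).toReal - n * ‖x - w‖) := fun n x =>
    ⟨m, by rintro _ ⟨w, rfl⟩; exact hterm n x w⟩
  refine ⟨f, fun n => ?_, fun x => ?_, fun n z hz => ?_, fun n x => ciSup_le (hterm n x), ?_⟩
  · refine (LipschitzWith.of_le_add_mul (n : NNReal) fun x y => ciSup_le fun w => ?_).continuous
    have h1 := le_ciSup (hbdd n y) w
    have h2 : ‖y - w‖ ≤ ‖x - w‖ + dist x y := by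
      rw [dist_comm, dist_eq_norm]
      calc ‖y - w‖ = ‖(x - w) + (y - x)‖ := by congr 1; ring
        _ ≤ _ := norm_add_le _ _
    have h3 : (n : ℝ) * ‖y - w‖ ≤ n * ‖x - w‖ + n * dist x y := by
      rw [← mul_add]; gcongr
    simp only [NNReal.coe_natCast]
    linarith
  · intro n k hnk
    refine ciSup_le fun w => ?_
    refine le_trans ?_ (le_ciSup (hbdd n x) w)
    have hnk' : (n : ℝ) ≤ k := by exact_mod_cast hnk
    have h1 : (a k w).toReal ≤ (a n w).toReal := by
      rw [← EReal.coe_le_coe_iff, ha_coe k w w.2, ha_coe n w w.2]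
      exact max_le_max le_rfl (EReal.coe_le_coe_iff.2 (by linarith))
    have h2 : (n : ℝ) * ‖x - w‖ ≤ k * ‖x - w‖ := by gcongr
    linarith
  · have h1 := le_ciSup (hbdd n z) ⟨z, hz⟩
    simp only [sub_self, norm_zero, mul_zero, sub_zero] at h1
    exact ((le_max_left _ _).trans (ha_coe n z hz).ge).trans (EReal.coe_le_coe_iff.2 h1)
  · intro z hz B hB
    obtain ⟨B', hB1, hB2⟩ := EReal.lt_iff_exists_real_btwn.1 hB
    rw [EReal.coe_lt_coe_iff] at hB2
    obtain ⟨d, hd, hball⟩ := Metric.eventually_nhds_iff_ball.1 (husc z B' hB1)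
    obtain ⟨n, hn⟩ := exists_nat_ge (max (-B') ((m - B') / d))
    refine ⟨n, (ciSup_le fun w => ?_).trans_lt hB2⟩
    have hn1 := (le_max_left _ _).trans hn
    have hn2 := (le_max_right _ _).trans hn
    rw [div_le_iff₀ hd] at hn2
    by_cases hw : ‖z - w‖ < d
    · have : a n w ≤ (B' : EReal) := by
        refine max_le (hball w ?_).le (EReal.coe_le_coe_iff.2 ?_)
        · rwa [mem_ball, dist_eq_norm, norm_sub_rev]
        · linarith [abs_nonneg m]
      rw [← ha_coe n w w.2, EReal.coe_le_coe_iff] at this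
      have : 0 ≤ (n : ℝ) * ‖z - w‖ := by positivity
      linarith
    · have h1 := ha_le' n w w.2
      have h2 : (n : ℝ) * d ≤ n * ‖z - w‖ := by gcongr; exact not_lt.1 hw
      linarith

theorem exists_bound_poissonKernel {c w : ℂ} {R : ℝ} (hw : w ∈ ball c R) :
    ∃ B : ℝ, ∀ z ∈ sphere c R, |poissonKernel c w z| ≤ B := by
  have hR : |R| = R := abs_of_pos (pos_of_mem_ball hw)
  have := continuousOn_poissonKernel_sphere hw
  rw [hR] at this
  exact (isCompact_sphere c R).exists_bound_of_continuousOn this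

/-- Monotone convergence for Poisson integrals. -/
theorem exists_poissonIntegral_limit {c w₁ : ℂ} {R m A : ℝ} {f : ℕ → ℂ → ℝ}
    (hc : ∀ n, Continuous (f n)) (hanti : ∀ x, Antitone fun n => f n x)
    (hm : ∀ n x, f n x ≤ m) (hw₁ : w₁ ∈ ball c R) (hA : ∀ n, A ≤ poissonIntegral (f n) c R w₁) :
    ∃ g : ℂ → ℝ, CircleIntegrable g c R ∧
      ∀ w ∈ ball c R, Tendsto (fun n => poissonIntegral (f n) c R w) atTop
        (𝓝 (poissonIntegral g c R w)) := by
  have hR : 0 < R := pos_of_mem_ball hw₁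
  have hci : ∀ n, CircleIntegrable (f n) c R := fun n =>
    circleIntegrable_of_continuousOn hR (hc n).continuousOn
  set μ : Measure ℝ := volume.restrict (Ioc 0 (2 * Real.pi)) with hμ
  set F : ℕ → ℝ → ℝ := fun n θ => f n (circleMap c R θ) with hF
  have hFc : ∀ n, Continuous (F n) := fun n => (hc n).comp (continuous_circleMap c R)
  have hFi : ∀ n, Integrable (F n) μ := fun n =>
    ((hFc n).intervalIntegrable 0 (2 * Real.pi)).1
  -- a uniform bound for the integrals of `m - F n`
  obtain ⟨B, hB⟩ : ∃ B : ℝ, ∀ n, ∫ θ, (m - F n θ) ∂μ ≤ B := by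
    set k := (R - ‖w₁ - c‖) / (R + ‖w₁ - c‖) with hk
    have hwR : ‖w₁ - c‖ < R := by simpa [dist_eq_norm] using hw₁
    have hk0 : 0 < k := div_pos (by linarith) (by linarith [norm_nonneg (w₁ - c)])
    refine ⟨2 * Real.pi * ((m - A) / k), fun n => ?_⟩
    have hcm : CircleIntegrable (fun _ : ℂ => m) c R := circleIntegrable_const _ _ _
    have h1 : Real.circleAverage (k • (fun z => m - f n z)) c R ≤ m - poissonIntegral (f n) c R w₁ := by
      have e : m - poissonIntegral (f n) c R w₁ =
          Real.circleAverage (poissonKernel c w₁ • fun z => m - f n z) c R := by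
        have e1 : poissonKernel c w₁ • (fun z => m - f n z) =
            poissonKernel c w₁ • (fun _ : ℂ => m) - poissonKernel c w₁ • f n := by
          funext z; simp; ring
        have e2 := poissonIntegral_of_harmonic (harmonicOnNhd_const m) hw₁
        rw [poissonIntegral] at e2
        rw [e1, Real.circleAverage_sub (circleIntegrable_poissonKernel_smul hcm hw₁)
          (circleIntegrable_poissonKernel_smul (hci n) hw₁), e2, poissonIntegral]
      rw [e]
      refine Real.circleAverage_mono (hcm.sub (hci n)).const_smul
        (circleIntegrable_poissonKernel_smul (hcm.sub (hci n)) hw₁) fun z hz => ?_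
      rw [abs_of_pos hR] at hz
      exact mul_le_mul_of_nonneg_right (poissonKernel_lower hz hw₁) (by linarith [hm n z])
    rw [Real.circleAverage_smul, Real.circleAverage_def, smul_eq_mul, smul_eq_mul,
      intervalIntegral.integral_of_le (by positivity)] at h1
    have h2 := h1.trans (sub_le_sub_left (hA n) m)
    rw [← mul_assoc, mul_comm k, mul_assoc, inv_mul_le_iff₀ (by positivity)] at h2
    rw [mul_div_assoc', le_div_iff₀ hk0, mul_comm]
    exact h2
  set K : ℝ → ENNReal := fun θ => ⨆ n, ENNReal.ofReal (m - F n θ) with hK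
  have hKm : Measurable K := Measurable.iSup fun n =>
    ENNReal.measurable_ofReal.comp (measurable_const.sub (hFc n).measurable)
  have hKint : ∫⁻ θ, K θ ∂μ ≤ ENNReal.ofReal B := by
    have hmono : Monotone fun n θ => ENNReal.ofReal (m - F n θ) := fun n k hnk θ =>
      ENNReal.ofReal_le_ofReal (sub_le_sub_left (hanti _ hnk) m)
    have hmeas : ∀ n, Measurable fun θ => ENNReal.ofReal (m - F n θ) := fun n =>
      ENNReal.measurable_ofReal.comp (measurable_const.sub (hFc n).measurable)
    simp only [hK]
    rw [lintegral_iSup hmeas hmono]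
    · refine iSup_le fun n => ?_
      have hi : Integrable (fun θ => m - F n θ) μ := (integrable_const m).sub (hFi n)
      rw [← ofReal_integral_eq_lintegral_ofReal hi
        (Eventually.of_forall fun θ => by simpa using hm n _)]
      exact ENNReal.ofReal_le_ofReal (hB n)
  have hKfin : ∀ᵐ θ ∂μ, K θ < ⊤ :=
    ae_lt_top hKm (hKint.trans_lt ENNReal.ofReal_lt_top).ne
  have hKi : Integrable (fun θ => (K θ).toReal) μ :=
    integrable_toReal_of_lintegral_ne_top hKm.aemeasurable
      (hKint.trans_lt ENNReal.ofReal_lt_top).ne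
  have hlow : ∀ θ, K θ < ⊤ → ∀ n, m - (K θ).toReal ≤ F n θ := fun θ hθ n => by
    have h1 : ENNReal.ofReal (m - F n θ) ≤ K θ := le_iSup (fun n => ENNReal.ofReal (m - F n θ)) n
    have h2 := (ENNReal.ofReal_le_iff_le_toReal hθ.ne).1 h1
    linarith
  -- On the null set where `K = ⊤` the real infimum may be a default value, which has no effect on
  -- the integrals.
  set g : ℂ → ℝ := fun z => ⨅ n, f n z with hg
  have hlim : ∀ θ, K θ < ⊤ → Tendsto (fun n => F n θ) atTop (𝓝 (g (circleMap c R θ))) :=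
    fun θ hθ => tendsto_atTop_ciInf (hanti _)
      ⟨m - (K θ).toReal, by rintro _ ⟨n, rfl⟩; exact hlow θ hθ n⟩
  have hbound : ∀ θ, K θ < ⊤ → ∀ n, ‖F n θ‖ ≤ |m| + (K θ).toReal := fun θ hθ n => by
    rw [Real.norm_eq_abs, abs_le]
    have := hlow θ hθ n
    have := hm n (circleMap c R θ)
    have : 0 ≤ (K θ).toReal := ENNReal.toReal_nonneg
    constructor <;> linarith [neg_abs_le m, le_abs_self m]
  have hgm : Measurable fun θ => g (circleMap c R θ) := Measurable.iInf fun n => (hFc n).measurable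
  have hgi : CircleIntegrable g c R := by
    rw [CircleIntegrable, intervalIntegrable_iff_integrableOn_Ioc_of_le (by positivity)]
    refine Integrable.mono' ((integrable_const |m|).add hKi) hgm.aestronglyMeasurable ?_
    filter_upwards [hKfin] with θ hθ
    exact le_of_tendsto (hlim θ hθ).norm (Eventually.of_forall (hbound θ hθ))
  refine ⟨g, hgi, fun w hw => ?_⟩
  obtain ⟨C, hC⟩ := exists_bound_poissonKernel hw
  simp only [poissonIntegral, Real.circleAverage_def]
  refine Tendsto.const_smul ?_ _
  simp only [intervalIntegral.integral_of_le Real.two_pi_pos.le]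
  refine tendsto_integral_of_dominated_convergence (fun θ => C * (|m| + (K θ).toReal))
    (fun n => ?_) (((integrable_const |m|).add hKi).const_mul C) (fun n => ?_) ?_
  · exact (circleIntegrable_poissonKernel_smul (hci n) hw).1.aestronglyMeasurable
  · filter_upwards [hKfin] with θ hθ
    simp only [Pi.smul_apply', norm_smul]
    gcongr
    · exact (abs_nonneg _).trans (hC _ (circleMap_mem_sphere c hR.le θ))
    · exact hC _ (circleMap_mem_sphere c hR.le θ)
    · exact hbound θ hθ n
  · filter_upwards [hKfin] with θ hθ
    simpa using (hlim θ hθ).const_mul (poissonKernel c w (circleMap c R θ))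

open Classical in
/-- The Poisson modification of a subharmonic function in a disk. -/
theorem IsSubharmonic.exists_modification {q : ℂ → EReal} (hq : IsSubharmonic q) {c w₁ : ℂ}
    {R m : ℝ} (hm : ∀ z ∈ closedBall c R, q z ≤ (m : EReal)) (hw₁ : w₁ ∈ ball c R)
    (hqw₁ : q w₁ ≠ ⊥) :
    ∃ p : ℂ → ℝ, HarmonicOnNhd p (ball c R) ∧ (∀ z ∈ ball c R, p z ≤ m) ∧
      (∀ z ∈ ball c R, q z ≤ (p z : EReal)) ∧
      IsSubharmonic (fun z => if z ∈ ball c R then (p z : EReal) else q z) := by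
  have hR : 0 < R := pos_of_mem_ball hw₁
  have hm' : ∀ z ∈ sphere c R, q z ≤ (m : EReal) := fun z hz => hm z (sphere_subset_closedBall hz)
  obtain ⟨f, hfc, hanti, hqf, hfm, hfB⟩ := exists_antitone_continuous
    (NormedSpace.sphere_nonempty.2 hR.le) hq.upperSemicontinuous hm'
  have hqw : ∀ n, ∀ w ∈ ball c R, q w ≤ (poissonIntegral (f n) c R w : EReal) := fun n w hw =>
    hq.le_poissonIntegral hR (hfc n).continuousOn (hqf n) hw
  have hci : ∀ n, CircleIntegrable (f n) c R := fun n =>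
    circleIntegrable_of_continuousOn hR (hfc n).continuousOn
  -- Finiteness of `q` at `w₁` is what keeps the decreasing Poisson integrals from tending to `-∞`.
  obtain ⟨g, hgi, hlim⟩ := exists_poissonIntegral_limit (A := (q w₁).toReal) hfc hanti hfm hw₁
    fun n => by
      rw [← EReal.coe_le_coe_iff, EReal.coe_toReal (hq.lt_top w₁).ne hqw₁]
      exact hqw n w₁ hw₁
  have hmono : ∀ w ∈ ball c R, Antitone fun n => poissonIntegral (f n) c R w :=
    fun w hw n k hnk => poissonIntegral_mono (hci k) (hci n) hw fun z _ => hanti z hnk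
  have hple : ∀ n, ∀ w ∈ ball c R, poissonIntegral g c R w ≤ poissonIntegral (f n) c R w :=
    fun n w hw => (hmono w hw).le_of_tendsto (hlim w hw) n
  have hph := harmonicOnNhd_poissonIntegral hgi
  have hqp : ∀ z ∈ ball c R, q z ≤ (poissonIntegral g c R z : EReal) := fun z hz =>
    ge_of_tendsto' ((continuous_coe_real_ereal.tendsto _).comp (hlim z hz)) fun n => hqw n z hz
  refine ⟨poissonIntegral g c R, hph, fun z hz => ?_, hqp, ?_⟩
  · refine (hple 0 z hz).trans ?_
    have := poissonIntegral_of_harmonic (harmonicOnNhd_const m) hz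
    exact (poissonIntegral_mono (hci 0) (circleIntegrable_const m c R) hz
      fun z _ => hfm 0 z).trans_eq this
  · refine isSubharmonic_glue hq (c := c) (R := R) (fun z hz => if_neg hz) (fun z => ?_)
      (fun z => ?_) (fun z hz => ?_) fun z hz => ?_
    · split_ifs with hz
      · exact hqp z hz
      · exact le_rfl
    · split_ifs with hz
      · exact EReal.coe_lt_top _
      · exact hq.lt_top z
    · by_cases hzb : z ∈ ball c R
      · refine UpperSemicontinuousAt.upperSemicontinuousWithinAt _ ?_
        refine ContinuousAt.upperSemicontinuousAt ?_
        refine ContinuousAt.congr (continuous_coe_real_ereal.continuousAt.comp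
          (hph z hzb).1.continuousAt) ?_
        filter_upwards [isOpen_ball.mem_nhds hzb] with w hw
        rw [if_pos hw]; rfl
      · have hzs : z ∈ sphere c R := by
          rw [← closedBall_sdiff_ball]; exact ⟨hz, hzb⟩
        intro y hy
        simp only [if_neg hzb] at hy
        obtain ⟨B, hB1, hB2⟩ := EReal.lt_iff_exists_real_btwn.1 hy
        -- At a point of the circle, the modification is bounded by the Poisson integral of a single
        -- `f n`, which is continuous up to the boundary with a value below `B` there.
        obtain ⟨n, hn⟩ := hfB z hzs B hB1
        rw [← ball_union_sphere, nhdsWithin_union, eventually_sup]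
        constructor
        · filter_upwards [(tendsto_poissonIntegral hzs hR
            (hfc n).continuousOn).eventually_lt_const hn, self_mem_nhdsWithin] with w hw hwb
          rw [if_pos hwb]
          exact (EReal.coe_lt_coe_iff.2 ((hple n w hwb).trans_lt hw)).trans hB2
        · filter_upwards [(hq.upperSemicontinuous z y hy).filter_mono nhdsWithin_le_nhds,
            self_mem_nhdsWithin] with w hw hws
          rw [if_neg (by rw [mem_sphere] at hws; simp [hws])]
          exact hw
    · refine (dominatedAt_of_harmonicAt (hph z hz)).congr ?_
      filter_upwards [isOpen_ball.mem_nhds hz] with w hw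
      rw [if_pos hw]


/-! ### Harmonicity and exact singularity of the obstacle function. -/

section ObstacleStructure

variable {Q : ℂ → ℝ} {τ : ℝ} {w₀ : ℂ}

/-- A constant fits between the obstacle function and `Q` on a small disk. Modifications in the disk
remain below this constant, and hence remain competitors. -/
theorem exists_closedBall_between (hQ : Continuous Q) {z : ℂ} (hz : z ∈ offSpectral Q w₀ τ)
    {s : Set ℂ} (hs : s ∈ 𝓝 z) :
    ∃ r > 0, closedBall z r ⊆ s ∧ closedBall z r ⊆ offSpectral Q w₀ τ ∧ ∃ m : ℝ,
      ∀ w ∈ closedBall z r, obstacle Q τ w₀ w ≤ (m : EReal) ∧ m < Q w := by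
  obtain ⟨m, hm1, hm2⟩ := EReal.lt_iff_exists_real_btwn.1 (obstacle_lt (offSpectral_subset hz))
  rw [EReal.coe_lt_coe_iff] at hm2
  have h1 := (obstacle_mem (τ := τ) (w₀ := w₀) hQ).1.upperSemicontinuous z m hm1
  have h2 : ∀ᶠ w in 𝓝 z, m < Q w := (hQ.tendsto z).eventually_const_lt hm2
  have h3 := (isOpen_offSpectral hQ).mem_nhds hz
  obtain ⟨r, hr, hball⟩ := Metric.nhds_basis_closedBall.mem_iff.1
    (inter_mem (inter_mem hs h3) (h1.and h2))
  exact ⟨r, hr, fun w hw => (hball hw).1.1, fun w hw => (hball hw).1.2, m,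
    fun w hw => ⟨(hball hw).2.1.le, (hball hw).2.2⟩⟩

/-- The Poisson modification in a disk that avoids `w₀` is a competitor lying above the obstacle
function, so the two agree by maximality. -/
theorem exists_harmonic_eq_obstacle (hQ : Continuous Q) {z₀ : ℂ} (hz₀ : obstacle Q τ w₀ z₀ ≠ ⊥)
    {z : ℂ} (hz : z ∈ offSpectral Q w₀ τ) (hzw : z ≠ w₀) :
    ∃ p : ℂ → ℝ, HarmonicAt p z ∧ ∀ᶠ w in 𝓝 z, obstacle Q τ w₀ w = (p w : EReal) := by
  classical
  have hSH := obstacle_mem (τ := τ) (w₀ := w₀) hQ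
  obtain ⟨r, hr, hsub, -, m, hm⟩ := exists_closedBall_between hQ hz (isOpen_ne.mem_nhds hzw)
  obtain ⟨w₁, hw₁, hqw₁⟩ : ∃ w₁ ∈ ball z r, obstacle Q τ w₀ w₁ ≠ ⊥ := by
    by_contra hcon
    push Not at hcon
    have h1 : ball z r ⊆ interior {w | obstacle Q τ w₀ w = ⊥} :=
      interior_maximal hcon isOpen_ball
    rw [hSH.1.interior_eq_bot hz₀] at h1
    exact h1 (mem_ball_self hr)
  obtain ⟨p, hp, hpm, hqp, hsubh⟩ := hSH.1.exists_modification (fun w hw => (hm w hw).1) hw₁ hqw₁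
  refine ⟨p, hp z (mem_ball_self hr), ?_⟩
  filter_upwards [ball_mem_nhds z hr] with w hw
  refine le_antisymm (hqp w hw) ?_
  have := le_obstacle (Q := Q) (τ := τ) (w₀ := w₀) ⟨hsubh, ?_⟩ (fun ξ => ?_) w
  · simpa only [if_pos hw] using this
  · obtain ⟨C, hC⟩ := hSH.2
    refine ⟨C, ?_⟩
    have : (closedBall z r)ᶜ ∈ 𝓝 w₀ :=
      isClosed_closedBall.isOpen_compl.mem_nhds fun h => hsub h rfl
    filter_upwards [hC, nhdsWithin_le_nhds this] with ξ hξ hξb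
    rwa [if_neg fun h => hξb (ball_subset_closedBall h)]
  · split_ifs with hξ
    · exact EReal.coe_le_coe_iff.2 ((hpm ξ hξ).trans (hm ξ (ball_subset_closedBall hξ)).2.le)
    · exact obstacle_le ξ

theorem obstacle_toReal (hQ : Continuous Q) {z₀ : ℂ} (hz₀ : obstacle Q τ w₀ z₀ ≠ ⊥)
    {z : ℂ} (hz : z ∈ offSpectral Q w₀ τ) (hzw : z ≠ w₀) :
    obstacle Q τ w₀ z = ((obstacle Q τ w₀ z).toReal : EReal) ∧
      HarmonicAt (fun w => (obstacle Q τ w₀ w).toReal) z := by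
  obtain ⟨p, hp, hev⟩ := exists_harmonic_eq_obstacle hQ hz₀ hz hzw
  refine ⟨by rw [hev.self_of_nhds, EReal.toReal_coe], (harmonicAt_congr_nhds ?_).2 hp⟩
  filter_upwards [hev] with w hw
  rw [hw, EReal.toReal_coe]

/-- Near the root point, the solution of the obstacle problem has the maximal logarithmic
singularity. -/
theorem exists_harmonic_eq_obstacle_root (hQ : Continuous Q) (hτ : 0 ≤ τ) {z₀ : ℂ}
    (hz₀ : obstacle Q τ w₀ z₀ ≠ ⊥) (hw₀ : w₀ ∈ offSpectral Q w₀ τ) :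
    ∃ r > 0, closedBall w₀ r ⊆ offSpectral Q w₀ τ ∧ ∃ p : ℂ → ℝ,
      ContinuousOn p (closedBall w₀ r) ∧ HarmonicOnNhd p (ball w₀ r) ∧
      (∀ z ∈ closedBall w₀ r, p z < Q z) ∧
      ∀ z ∈ closedBall w₀ r, z ≠ w₀ →
        obstacle Q τ w₀ z = ((τ * (Real.log ‖z - w₀‖ - Real.log r) + p z : ℝ) : EReal) := by
  classical
  have hSH := obstacle_mem (τ := τ) (w₀ := w₀) hQ
  set q := obstacle Q τ w₀ with hq
  obtain ⟨r, hr, -, hsub, m, hm⟩ := exists_closedBall_between hQ hw₀ univ_mem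
  have hneS : ∀ z ∈ sphere w₀ r, z ≠ w₀ := by
    rintro z hz rfl
    simp at hz
    exact hr.ne hz
  set g : ℂ → ℝ := fun z => (q z).toReal with hg
  have hgq : ∀ z ∈ sphere w₀ r, q z = (g z : EReal) := fun z hz =>
    (obstacle_toReal hQ hz₀ (hsub (sphere_subset_closedBall hz)) (hneS z hz)).1
  have hgc : ContinuousOn g (sphere w₀ r) := fun z hz =>
    ((obstacle_toReal hQ hz₀ (hsub (sphere_subset_closedBall hz))
      (hneS z hz)).2.1.continuousAt).continuousWithinAt
  have hgi := circleIntegrable_of_continuousOn hr hgc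
  set p := dirichletSolution g w₀ r with hp
  have hpc : ContinuousOn p (closedBall w₀ r) := continuousOn_dirichletSolution hr hgc
  have hph : HarmonicOnNhd p (ball w₀ r) := harmonicOnNhd_dirichletSolution hgi
  have hps : ∀ z ∈ sphere w₀ r, p z = g z := fun z hz =>
    dirichletSolution_of_notMem (by rw [mem_sphere] at hz; simp [hz])
  have hpm : ∀ z ∈ closedBall w₀ r, p z ≤ m := by
    intro z hz
    rw [← ball_union_sphere] at hz
    have hgm : ∀ ξ ∈ sphere w₀ r, g ξ ≤ m := fun ξ hξ => by
      rw [← EReal.coe_le_coe_iff, ← hgq ξ hξ]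
      exact (hm ξ (sphere_subset_closedBall hξ)).1
    rcases hz with hz | hz
    · rw [hp, dirichletSolution_of_mem hz]
      exact (poissonIntegral_mono hgi (circleIntegrable_const m _ _) hz hgm).trans_eq
        (poissonIntegral_of_harmonic (harmonicOnNhd_const m) hz)
    · rw [hps z hz]; exact hgm z hz
  have hqp : ∀ z ∈ sphere w₀ r, q z ≤ (p z : EReal) := fun z hz => by rw [hgq z hz, hps z hz]
  -- This has the boundary values of `q` and the strongest admissible singularity. `SH.le_log_add`
  -- gives `q ≤ f`, and the converse follows since replacing `q` by `f` in the disk yields a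
  -- competitor.
  set f : ℂ → ℝ := fun z => τ * (Real.log ‖z - w₀‖ - Real.log r) + p z with hf
  -- For `τ = 0` there is no singularity and the centre is included. For `τ > 0` it is excluded
  -- because `Real.log 0 = 0` would give `f` a spurious value there, and `v` keeps the value of `q`.
  set S : Set ℂ := {z | z ∈ ball w₀ r ∧ (z ≠ w₀ ∨ τ = 0)} with hS
  set v : ℂ → EReal := fun z => if z ∈ S then (f z : EReal) else q z with hv
  have hlogle : ∀ z ∈ ball w₀ r, z ≠ w₀ → τ * (Real.log ‖z - w₀‖ - Real.log r) ≤ 0 := by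
    intro z hz hne
    refine mul_nonpos_of_nonneg_of_nonpos hτ (sub_nonpos.2 (Real.log_le_log
      (norm_pos_iff.2 (sub_ne_zero.2 hne)) ?_))
    rw [mem_ball, dist_eq_norm] at hz; exact hz.le
  have hfp : ∀ z ∈ S, f z ≤ p z := by
    rintro z ⟨hz, hne⟩
    by_cases h0 : τ = 0
    · simp [hf, h0]
    · have := hlogle z hz (hne.resolve_right h0)
      simp only [hf]; linarith
  have hfs : ∀ z ∈ sphere w₀ r, f z = g z := fun z hz => by
    have : ‖z - w₀‖ = r := by simpa [dist_eq_norm] using hz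
    simp [hf, this, hps z hz]
  have hfh : ∀ z ∈ S, HarmonicAt f z := by
    rintro z ⟨hz, hne⟩
    by_cases h0 : τ = 0
    · simpa [hf, h0] using hph z hz
    · exact (HarmonicAt.const_smul (c := τ) ((harmonicAt_log_norm_sub
        (hne.resolve_right h0)).sub (harmonicOnNhd_const (s := univ) (Real.log r) z
          (mem_univ z)))).add (hph z hz)
  have hqv : ∀ z, q z ≤ v z := by
    intro z
    by_cases hz : z ∈ S
    · simp only [hv, if_pos hz]
      obtain ⟨hzb, hne⟩ := hz
      rcases hne with hne | h0
      · exact SH.le_log_add hSH hpc hph hqp hzb hne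
      · simpa [hf, h0] using hSH.1.le_harmonic w₀ r hr p hpc hph hqp z hzb
    · simp only [hv, if_neg hz]; exact le_rfl
  have hSo : IsOpen S := by
    by_cases h0 : τ = 0
    · have : S = ball w₀ r := by ext z; simp [hS, h0]
      rw [this]; exact isOpen_ball
    · have : S = ball w₀ r ∩ {w₀}ᶜ := by ext z; simp [hS, h0]
      rw [this]; exact isOpen_ball.inter isOpen_compl_singleton
  have hSn : ∀ z, z ∉ ball w₀ r → z ∉ S := fun z hz h => hz h.1
  have hvsub : IsSubharmonic v := by
    refine isSubharmonic_glue hSH.1 (c := w₀) (R := r) (fun z hz => if_neg (hSn z hz)) hqv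
      (fun z => ?_) (fun z hz => ?_) fun z hz => ?_
    · simp only [hv]
      split_ifs
      · exact EReal.coe_lt_top _
      · exact hSH.1.lt_top z
    · by_cases hzw : z = w₀ ∧ τ ≠ 0
      · -- the function tends to `-∞` at the root
        obtain ⟨rfl, h0⟩ := hzw
        have hτ' : 0 < τ := lt_of_le_of_ne hτ (Ne.symm h0)
        have hzS : z ∉ S := fun h => h.2.elim (fun h => h rfl) h0
        intro y hy
        simp only [hv, if_neg hzS] at hy
        refine eventually_nhdsWithin_of_eventually_nhds ?_
        have hq' := hSH.1.upperSemicontinuous z y hy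
        obtain ⟨B, hB⟩ : ∃ B : ℝ, (B : EReal) < y := by
          obtain ⟨B, -, hB⟩ := EReal.lt_iff_exists_real_btwn.1 ((bot_le).trans_lt hy)
          exact ⟨B, hB⟩
        have hlim : Tendsto (fun w => τ * (Real.log ‖w - z‖ - Real.log r) + m) (𝓝[≠] z) atBot := by
          have h1 : Tendsto (fun w => ‖w - z‖) (𝓝[≠] z) (𝓝[>] 0) := by
            refine tendsto_nhdsWithin_iff.2 ⟨?_, ?_⟩
            · have : Continuous fun w : ℂ => ‖w - z‖ := by fun_prop
              simpa using (this.tendsto z).mono_left nhdsWithin_le_nhds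
            · filter_upwards [self_mem_nhdsWithin] with w hw
              exact norm_pos_iff.2 (sub_ne_zero.2 hw)
          have h2 := Real.tendsto_log_nhdsGT_zero.comp h1
          have h3 := tendsto_atBot_add_const_right _ (-Real.log r) h2
          exact tendsto_atBot_add_const_right _ m (h3.const_mul_atBot hτ')
        have h4 := eventually_nhdsWithin_iff.1 (hlim.eventually_le_atBot B)
        filter_upwards [hq', h4] with w hw1 hw2
        simp only [hv]
        split_ifs with hwS
        · refine lt_of_le_of_lt (EReal.coe_le_coe_iff.2 ?_) hB
          have := hw2 (hwS.2.resolve_right h0)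
          have := hpm w (ball_subset_closedBall hwS.1)
          simp only [hf]; linarith
        · exact hw1
      · -- elsewhere, the function is continuous on the closed ball
        have hz' : z ∈ S ∪ sphere w₀ r := by
          rw [← ball_union_sphere] at hz
          rcases hz with hz | hz
          · left; exact ⟨hz, by by_contra hcon; push Not at hcon; exact hzw hcon⟩
          · exact Or.inr hz
        have hSs : S ∪ sphere w₀ r ∈ 𝓝[closedBall w₀ r] z := by
          by_cases h0 : τ = 0
          · have : closedBall w₀ r ⊆ S ∪ sphere w₀ r := by
              rw [← ball_union_sphere]
              refine union_subset_union_left _ fun w hw => ⟨hw, Or.inr h0⟩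
            exact mem_of_superset self_mem_nhdsWithin this
          · have hzne : z ≠ w₀ := fun h => hzw ⟨h, h0⟩
            filter_upwards [self_mem_nhdsWithin,
              nhdsWithin_le_nhds (isOpen_ne.mem_nhds hzne)] with w hw hw2
            rw [← ball_union_sphere] at hw
            exact hw.imp (fun h => ⟨h, Or.inl hw2⟩) id
        have hveq : ∀ w ∈ S ∪ sphere w₀ r, v w = (f w : EReal) := by
          rintro w (hw | hw)
          · simp only [hv, if_pos hw]
          · have : w ∉ S := hSn w (by rw [mem_sphere] at hw; simp [hw])
            simp only [hv, if_neg this]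
            rw [hgq w hw, hfs w hw]
        have hfc : ContinuousWithinAt f (closedBall w₀ r) z := by
          rcases hz' with h | h
          · exact (hfh z h).1.continuousAt.continuousWithinAt
          · exact (((harmonicAt_log_norm_sub (hneS z h)).1.continuousAt.sub
              continuousAt_const).const_mul τ).continuousWithinAt.add (hpc z hz)
        have : ContinuousWithinAt v (closedBall w₀ r) z := by
          refine ContinuousWithinAt.congr_of_eventuallyEq
            (continuous_coe_real_ereal.continuousAt.comp_continuousWithinAt hfc) ?_ (hveq z hz')
          filter_upwards [hSs] with w hw using hveq w hw
        exact this.upperSemicontinuousWithinAt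
    · by_cases hzS : z ∈ S
      · refine (dominatedAt_of_harmonicAt (hfh z hzS)).congr ?_
        filter_upwards [hSo.mem_nhds hzS] with w hw
        simp only [hv, if_pos hw]
      · obtain ⟨r₀, hr₀, H⟩ := hSH.1.dominatedAt z
        refine ⟨r₀, hr₀, fun s hs hsr h hc hh hw => ?_⟩
        simp only [hv, if_neg hzS]
        exact H s hs hsr h hc hh fun w hws => (hqv w).trans (hw w hws)
  have hvSH : v ∈ SH τ w₀ := by
    refine ⟨hvsub, m - τ * Real.log r, ?_⟩
    filter_upwards [self_mem_nhdsWithin, nhdsWithin_le_nhds (ball_mem_nhds w₀ hr)] with w hw hwb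
    have hwS : w ∈ S := ⟨hwb, Or.inl hw⟩
    simp only [hv, if_pos hwS]
    refine EReal.coe_le_coe_iff.2 ?_
    have := hpm w (ball_subset_closedBall hwb)
    simp only [hf]; linarith
  have hvQ : ∀ z, v z ≤ (Q z : EReal) := by
    intro z
    simp only [hv]
    split_ifs with hz
    · refine EReal.coe_le_coe_iff.2 (((hfp z hz).trans (hpm z ?_)).trans (hm z ?_).2.le) <;>
      exact ball_subset_closedBall hz.1
    · exact obstacle_le z
  refine ⟨r, hr, hsub, p, hpc, hph, fun z hz => (hpm z hz).trans_lt (hm z hz).2,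
    fun z hz hzw => ?_⟩
  rw [← ball_union_sphere] at hz
  rcases hz with hz | hz
  · have hzS : z ∈ S := ⟨hz, Or.inl hzw⟩
    have h1 := hqv z
    have h2 := le_obstacle hvSH hvQ z
    simp only [hv, if_pos hzS] at h1 h2
    exact le_antisymm h1 h2
  · rw [hgq z hz, ← hfs z hz]

/-- In the off-spectral component, the solution of the obstacle problem is the sum of a logarithm
and a harmonic function. -/
theorem exists_harmonic_part (hQ : Continuous Q) (hτ : 0 ≤ τ) {z₀ : ℂ}
    (hz₀ : obstacle Q τ w₀ z₀ ≠ ⊥) (hw₀ : w₀ ∈ offSpectral Q w₀ τ) :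
    ∃ H : ℂ → ℝ, HarmonicOnNhd H (offSpectral Q w₀ τ) ∧
      (∀ z ∈ offSpectral Q w₀ τ, z ≠ w₀ →
        obstacle Q τ w₀ z = ((τ * Real.log ‖z - w₀‖ + H z : ℝ) : EReal)) ∧
      ∃ r > 0, closedBall w₀ r ⊆ offSpectral Q w₀ τ ∧
        ∀ z ∈ closedBall w₀ r, τ * Real.log r + H z < Q z := by
  classical
  obtain ⟨r, hr, hsub, p, hpc, hph, hpQ, heq⟩ := exists_harmonic_eq_obstacle_root hQ hτ hz₀ hw₀
  -- The value at `w₀` is the one that removes the singularity.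
  set H : ℂ → ℝ := fun z => if z = w₀ then p z - τ * Real.log r else
    (obstacle Q τ w₀ z).toReal - τ * Real.log ‖z - w₀‖ with hH
  have hHp : ∀ z ∈ closedBall w₀ r, H z = p z - τ * Real.log r := by
    intro z hz
    by_cases hzw : z = w₀
    · simp only [hH, if_pos hzw]
    · simp only [hH, if_neg hzw]
      rw [heq z hz hzw, EReal.toReal_coe]; ring
  refine ⟨H, fun z hz => ?_, fun z hz hzw => ?_, r, hr, hsub, fun z hz => ?_⟩
  · by_cases hzw : z = w₀
    · have hzb : z ∈ ball w₀ r := by rw [hzw]; exact mem_ball_self hr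
      refine (harmonicAt_congr_nhds ?_).2 ((hph z hzb).sub
        (harmonicOnNhd_const (s := univ) (τ * Real.log r) z (mem_univ z)))
      filter_upwards [isOpen_ball.mem_nhds hzb] with w hw
      exact hHp w (ball_subset_closedBall hw)
    · refine (harmonicAt_congr_nhds ?_).2 ((obstacle_toReal hQ hz₀ hz hzw).2.sub
        ((harmonicAt_log_norm_sub hzw).const_smul (c := τ)))
      filter_upwards [isOpen_ne.mem_nhds hzw] with w hw
      simp only [hH, if_neg (show w ≠ w₀ from hw)]
      rfl
  · rw [(obstacle_toReal hQ hz₀ hz hzw).1]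
    simp only [hH, if_neg hzw]
    congr 1; ring
  · rw [hHp z hz]
    have := hpQ z hz
    linarith

end ObstacleStructure


/-! ### Quadratic growth of the gap and its gradient. -/

theorem harmonicAt_clm (l : ℂ →L[ℝ] ℝ) (z : ℂ) : HarmonicAt (fun w => l w) z :=
  (analyticAt_id (𝕜 := ℂ) (z := z)).harmonicAt.comp_CLM l

/-- The first order Taylor polynomial of `Q` at `z`, shifted by a constant. -/
noncomputable def affineTaylor (Q : ℂ → ℝ) (z : ℂ) (a : ℝ) (w : ℂ) : ℝ :=
  fderiv ℝ Q z w + (Q z - fderiv ℝ Q z z + a)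

theorem harmonicOnNhd_affineTaylor (Q : ℂ → ℝ) (z : ℂ) (a : ℝ) (s : Set ℂ) :
    HarmonicOnNhd (affineTaylor Q z a) s := fun w hw =>
  HarmonicAt.add (harmonicAt_clm _ w) (harmonicOnNhd_const (s := s) _ w hw)

theorem affineTaylor_self (Q : ℂ → ℝ) (z : ℂ) (a : ℝ) : affineTaylor Q z a z = Q z + a := by
  simp only [affineTaylor]; ring

/-- The quadratic error sits in the shift argument of `affineTaylor`. As soon as `‖w - z‖` is
bounded by a constant, the majorant becomes affine, hence harmonic. -/
theorem exists_taylor_bound {Q : ℂ → ℝ} (hQ : ContDiff ℝ 2 Q) (R : ℝ) :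
    ∃ C > 0, ∀ z ∈ closedBall (0 : ℂ) R, ∀ w ∈ closedBall (0 : ℂ) R,
      Q w ≤ affineTaylor Q z (C * ‖w - z‖ ^ 2) w := by
  have h1 : ContDiff ℝ 1 (fderiv ℝ Q) := hQ.fderiv_right (by norm_num)
  have h2 : Continuous fun x => ‖fderiv ℝ (fderiv ℝ Q) x‖ :=
    continuous_norm.comp (h1.continuous_fderiv (by norm_num))
  obtain ⟨C, hC⟩ := (isCompact_closedBall (0 : ℂ) R).bddAbove_image h2.continuousOn
  replace hC : ∀ x ∈ closedBall (0 : ℂ) R, ‖fderiv ℝ (fderiv ℝ Q) x‖ ≤ C := fun x hx =>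
    hC (mem_image_of_mem _ hx)
  have hlip : ∀ z ∈ closedBall (0 : ℂ) R, ∀ w ∈ closedBall (0 : ℂ) R,
      ‖fderiv ℝ Q w - fderiv ℝ Q z‖ ≤ C * ‖w - z‖ := fun z hz w hw =>
    (convex_closedBall (0 : ℂ) R).norm_image_sub_le_of_norm_fderiv_le
      (fun x _ => h1.differentiable (by norm_num) x) (fun x hx => hC x hx) hz hw
  refine ⟨|C| + 1, by positivity, fun z hz w hw => ?_⟩
  have hseg : segment ℝ z w ⊆ closedBall (0 : ℂ) R :=
    (convex_closedBall (0 : ℂ) R).segment_subset hz hw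
  have h3 : ‖Q w - Q z - fderiv ℝ Q z (w - z)‖ ≤ (|C| * ‖w - z‖) * ‖w - z‖ := by
    refine (convex_segment z w).norm_image_sub_le_of_norm_hasFDerivWithin_le'
      (fun x _ => (hQ.differentiable (by norm_num) x).hasFDerivAt.hasFDerivWithinAt)
      (fun x hx => ?_) (left_mem_segment ℝ z w) (right_mem_segment ℝ z w)
    refine (hlip z hz x (hseg hx)).trans ?_
    have h4 : ‖x - z‖ ≤ ‖w - z‖ := norm_sub_le_of_mem_segment hx
    calc C * ‖x - z‖ ≤ |C| * ‖x - z‖ := by gcongr; exact le_abs_self C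
      _ ≤ _ := by gcongr
  have h5 := (le_abs_self _).trans h3
  rw [map_sub] at h5
  simp only [affineTaylor]
  nlinarith [sq_nonneg ‖w - z‖]

/-- Quadratic growth of the gap between a function and a subharmonic minorant away from a contact
point. -/
theorem gap_le_quadratic {q : ℂ → EReal} (hq : IsSubharmonic q) {Q : ℂ → ℝ}
    (hqQ : ∀ z, q z ≤ (Q z : EReal)) {z₁ z : ℂ} (hz₁ : q z₁ = Q z₁) (hne : z ≠ z₁)
    {k : ℂ → ℝ} (hk : HarmonicOnNhd k (ball z ‖z - z₁‖))
    (hqk : ∀ w ∈ ball z ‖z - z₁‖, q w = (k w : EReal)) {C : ℝ} (hC0 : 0 < C)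
    (hC : ∀ w ∈ closedBall z₁ (2 * ‖z - z₁‖), Q w ≤ affineTaylor Q z₁ (C * ‖w - z₁‖ ^ 2) w) :
    Q z - k z ≤ 480 * C * ‖z - z₁‖ ^ 2 := by
  set r := ‖z - z₁‖ with hr
  have hr0 : 0 < r := norm_pos_iff.2 (sub_ne_zero.2 hne)
  -- The shift is `C (2r)²`, which makes `A` a harmonic majorant of `Q` on the disk of radius `2r`
  -- about the contact point.
  set A := affineTaylor Q z₁ (4 * C * r ^ 2) with hA
  have hQA : ∀ w ∈ closedBall z₁ (2 * r), Q w ≤ A w := by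
    intro w hw
    refine (hC w hw).trans ?_
    have h1 : ‖w - z₁‖ ≤ 2 * r := by simpa [dist_eq_norm] using hw
    have h2 : ‖w - z₁‖ ^ 2 ≤ (2 * r) ^ 2 := by gcongr
    simp only [hA, affineTaylor]
    nlinarith
  have hsub : ball z r ⊆ closedBall z₁ (2 * r) := by
    intro w hw
    rw [mem_ball, dist_eq_norm] at hw
    rw [mem_closedBall, dist_eq_norm]
    calc ‖w - z₁‖ = ‖(w - z) + (z - z₁)‖ := by congr 1; ring
      _ ≤ ‖w - z‖ + ‖z - z₁‖ := norm_add_le _ _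
      _ ≤ 2 * r := by linarith
  set p : ℂ → ℝ := fun w => A w - k w with hp
  have hph : HarmonicOnNhd p (ball z r) :=
    (harmonicOnNhd_affineTaylor Q z₁ _ _).sub hk
  have hkQ : ∀ w ∈ ball z r, k w ≤ Q w := fun w hw => by
    rw [← EReal.coe_le_coe_iff, ← hqk w hw]; exact hqQ w
  have hp0 : ∀ w ∈ ball z r, 0 ≤ p w := fun w hw => by
    have := hkQ w hw
    have := hQA w (hsub hw)
    simp only [hp]; linarith
  have hpz : 0 ≤ p z := hp0 z (mem_ball_self hr0)
  set s : ℂ := (z - z₁) / 2 with hs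
  have hsn : ‖s‖ = r / 2 := by simp [hs, hr]
  -- The peak is directed from `z₁` towards `z`. On the arc of radius `r/2` facing `z` one has `‖ξ -
  -- z‖ ≤ 7r/8`, so Harnack gives `p ξ ≥ p z / 15 = 8 p z / 120`, which pays for the peak. On the
  -- rest of the circle the peak is nonpositive. At `z₁`, where `q = Q`, the comparison reads `p z /
  -- 120 ≤ 4 C r²`, whence the constant `480`.
  have key := hq.le_harmonic z₁ (r / 2) (by positivity)
    (fun w => A w - p z / 120 * cubicPeak z₁ s w)
    ((harmonicOnNhd_affineTaylor Q z₁ _ _).continuousOn.sub (continuousOn_const.mul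
      (harmonicOnNhd_cubicPeak z₁ s _).continuousOn))
    ((harmonicOnNhd_affineTaylor Q z₁ _ _).sub
      ((harmonicOnNhd_cubicPeak z₁ s _).const_smul (c := p z / 120)))
    (fun ξ hξ => ?_) z₁ (mem_ball_self (by positivity))
  · rw [hz₁, cubicPeak_self, EReal.coe_le_coe_iff, hA, affineTaylor_self] at key
    have := hQA z (hsub (mem_ball_self hr0))
    simp only [hp] at key
    linarith
  · have hξn : ‖ξ - z₁‖ = r / 2 := by simpa [dist_eq_norm] using hξ
    set u : ℂ := (ξ - z₁) / s with hu
    have hs0 : s ≠ 0 := by rw [← norm_pos_iff, hsn]; positivity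
    have hun : ‖u‖ = 1 := by rw [hu, norm_div, hξn, hsn, div_self (by positivity)]
    obtain ⟨h8, h0⟩ := re_one_add_pow_three hun
    have hcp : cubicPeak z₁ s ξ = ((1 + u) ^ 3).re := rfl
    by_cases hre : u.re ≤ 1 / 2
    · refine (hqQ ξ).trans (EReal.coe_le_coe_iff.2 ?_)
      have h1 : Q ξ ≤ A ξ := hQA ξ (by rw [mem_closedBall, dist_eq_norm, hξn]; linarith)
      have := h0 hre
      rw [hcp]
      nlinarith
    · push Not at hre
      have e1 : ξ - z = s * (u - 2) := by
        rw [mul_sub, hu, mul_div_cancel₀ _ hs0, hs]; ring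
      have e2 : ‖u - 2‖ ^ 2 ≤ 3 := by
        have hn : u.re ^ 2 + u.im ^ 2 = 1 := by
          have := Complex.sq_norm u
          rw [hun, Complex.normSq_apply] at this
          linarith
        rw [Complex.sq_norm, Complex.normSq_apply]
        simp
        nlinarith
      have e3 : ‖ξ - z‖ ≤ 7 / 8 * r := by
        have : ‖u - 2‖ ≤ 7 / 4 := by nlinarith [norm_nonneg (u - 2)]
        rw [e1, norm_mul, hsn]
        nlinarith
      have hξb : ξ ∈ ball z r := by
        rw [mem_ball, dist_eq_norm]; linarith
      have h1 := harnack_lower hph hp0 hξb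
      have h2 : 1 / 15 ≤ (r - ‖ξ - z‖) / (r + ‖ξ - z‖) := by
        rw [div_le_div_iff₀ (by norm_num) (by positivity)]
        linarith
      have h3 : 1 / 15 * p z ≤ p ξ := (mul_le_mul_of_nonneg_right h2 hpz).trans h1
      rw [hqk ξ hξb, EReal.coe_le_coe_iff, hcp]
      have h4 : p ξ = A ξ - k ξ := rfl
      nlinarith

/-- Gradient estimate for positive harmonic functions. -/
theorem norm_fderiv_le_of_nonneg {p : ℂ → ℝ} {z : ℂ} {r : ℝ} (hr : 0 < r)
    (hp : HarmonicOnNhd p (ball z r)) (hp0 : ∀ w ∈ ball z r, 0 ≤ p w) :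
    ‖fderiv ℝ p z‖ ≤ 2 * p z / r := by
  have hpz := hp0 z (mem_ball_self hr)
  have hd : DifferentiableAt ℝ p z := (hp z (mem_ball_self hr)).1.differentiableAt (by norm_num)
  -- Harnack bounds how fast `p` can decrease along a ray; the opposite direction bounds the
  -- increase.
  have key : ∀ v : ℂ, ‖v‖ = 1 → -(2 * p z / r) ≤ fderiv ℝ p z v := by
    intro v hv
    have hder : HasDerivAt (fun t : ℝ => p (z + t • v)) (fderiv ℝ p z v) 0 := by
      have h1 : HasDerivAt (fun t : ℝ => z + t • v) v 0 := by
        simpa using ((hasDerivAt_id (0 : ℝ)).smul_const v).const_add z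
      have h2 : HasFDerivAt p (fderiv ℝ p z) (z + (0 : ℝ) • v) := by simpa using hd.hasFDerivAt
      exact h2.comp_hasDerivAt 0 h1
    have hslope := hder.tendsto_slope_zero_right
    refine ge_of_tendsto hslope ?_
    filter_upwards [Ioo_mem_nhdsGT hr] with t ht
    have hn : ‖z + t • v - z‖ = t := by
      rw [add_sub_cancel_left, norm_smul, hv, mul_one, Real.norm_eq_abs, abs_of_pos ht.1]
    have hb : z + t • v ∈ ball z r := by rw [mem_ball, dist_eq_norm, hn]; exact ht.2
    have h1 := harnack_lower hp hp0 hb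
    rw [hn] at h1
    have h2 : (r - t) / (r + t) * p z - p z = -(2 * p z / (r + t)) * t := by
      have : r + t ≠ 0 := by linarith [ht.1]
      field_simp; ring
    have h3 : 2 * p z / (r + t) ≤ 2 * p z / r := by
      gcongr; linarith [ht.1]
    have ht0 := ht.1
    simp only [zero_add, zero_smul, add_zero, smul_eq_mul]
    rw [inv_mul_eq_div, le_div_iff₀ ht0]
    nlinarith
  refine ContinuousLinearMap.opNorm_le_of_unit_norm (by positivity) fun v hv => ?_
  rw [Real.norm_eq_abs, abs_le]
  refine ⟨key v hv, ?_⟩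
  have := key (-v) (by simpa using hv)
  rw [map_neg] at this
  linarith

/-- The gradient of the gap between a function and a harmonic minorant. -/
theorem norm_fderiv_gap_le {Q k : ℂ → ℝ} (hQ : Differentiable ℝ Q) {z : ℂ} {r C : ℝ} (hr : 0 < r)
    (hk : HarmonicOnNhd k (ball z r)) (hkQ : ∀ w ∈ ball z r, k w ≤ Q w) (hC0 : 0 < C)
    (hC : ∀ w ∈ ball z r, Q w ≤ affineTaylor Q z (C * ‖w - z‖ ^ 2) w) :
    ‖fderiv ℝ (fun w => Q w - k w) z‖ ≤ 2 * (Q z - k z + C * r ^ 2) / r := by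
  set A := affineTaylor Q z (C * r ^ 2) with hA
  have hp := norm_fderiv_le_of_nonneg hr
    ((harmonicOnNhd_affineTaylor Q z (C * r ^ 2) _).sub hk) fun w hw => by
      have h1 : ‖w - z‖ < r := by simpa [dist_eq_norm] using hw
      have h2 : ‖w - z‖ ^ 2 ≤ r ^ 2 := by gcongr
      have h3 := hC w hw
      have h4 := hkQ w hw
      simp only [affineTaylor, Pi.sub_apply] at h3 ⊢
      nlinarith
  have hkd : DifferentiableAt ℝ k z := (hk z (mem_ball_self hr)).1.differentiableAt (by norm_num)
  have hAd : HasFDerivAt (affineTaylor Q z (C * r ^ 2)) (fderiv ℝ Q z) z :=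
    (fderiv ℝ Q z).hasFDerivAt.add_const _
  have e1 : fderiv ℝ (affineTaylor Q z (C * r ^ 2) - k) z = fderiv ℝ Q z - fderiv ℝ k z :=
    (hAd.sub hkd.hasFDerivAt).fderiv
  have e2 : fderiv ℝ (fun w => Q w - k w) z = fderiv ℝ Q z - fderiv ℝ k z :=
    ((hQ z).hasFDerivAt.sub hkd.hasFDerivAt).fderiv
  rw [e1, Pi.sub_apply, affineTaylor_self] at hp
  rw [e2]
  refine hp.trans (le_of_eq ?_)
  ring


/-- Off its frontier the plane splits into two open pieces, the domain and the complement of its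
closure. This elementary separation does the work of the Jordan curve theorem in all that follows.
-/
theorem subset_of_isPreconnected_of_disjoint_frontier {Ω t : Set ℂ} (hΩ : IsOpen Ω)
    (ht : IsPreconnected t) (hd : Disjoint t (frontier Ω)) (hne : (t ∩ Ω).Nonempty) : t ⊆ Ω := by
  refine ht.subset_left_of_subset_union hΩ isClosed_closure.isOpen_compl
    (disjoint_compl_right_iff_subset.2 subset_closure) (fun x hx => ?_) hne
  by_cases hc : x ∈ closure Ω
  · left
    by_contra hxΩ
    refine Set.disjoint_left.1 hd hx ?_
    rw [frontier, hΩ.interior_eq]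
    exact ⟨hc, hxΩ⟩
  · exact Or.inr hc

theorem ball_infDist_frontier_subset {Ω : Set ℂ} (hΩ : IsOpen Ω) {z : ℂ} (hz : z ∈ Ω)
    (hpos : 0 < infDist z (frontier Ω)) : ball z (infDist z (frontier Ω)) ⊆ Ω :=
  subset_of_isPreconnected_of_disjoint_frontier hΩ (convex_ball _ _).isPreconnected
    disjoint_ball_infDist ⟨z, mem_ball_self hpos, hz⟩

/-- Properties of a desingularized gap function in the off-spectral component: it is positive,
its superlevel sets are compact, and the square of its gradient is dominated by its values. -/
theorem exists_gap {Q : ℂ → ℝ} {τ : ℝ} {w₀ : ℂ} (hQ : ContDiff ℝ 2 Q) (hτ : 0 ≤ τ)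
    (hw₀ : w₀ ∈ offSpectral Q w₀ τ) (hbdd : Bornology.IsBounded (offSpectral Q w₀ τ))
    (hne : (frontier (offSpectral Q w₀ τ)).Nonempty) :
    ∃ H : ℂ → ℝ, HarmonicOnNhd H (offSpectral Q w₀ τ) ∧ ∃ ρ > 0,
      closedBall w₀ ρ ⊆ offSpectral Q w₀ τ ∧
      ∀ L : ℂ → ℝ, ContDiff ℝ 2 L → (∀ z, ρ ≤ ‖z - w₀‖ → L z = Real.log ‖z - w₀‖) →
        (∀ z, ‖z - w₀‖ ≤ ρ → L z ≤ Real.log ρ) →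
        (∀ z ∈ offSpectral Q w₀ τ, 0 < Q z - τ * L z - H z) ∧
        (∃ C, ∀ z ∈ offSpectral Q w₀ τ,
          ‖fderiv ℝ (fun w => Q w - τ * L w - H w) z‖ ^ 2 ≤ C * (Q z - τ * L z - H z)) ∧
        ∀ δ > 0, IsCompact {z | z ∈ offSpectral Q w₀ τ ∧ δ ≤ Q z - τ * L z - H z} := by
  set Ω := offSpectral Q w₀ τ with hΩ
  have hΩo : IsOpen Ω := isOpen_offSpectral hQ.continuous
  obtain ⟨z₀, hz₀⟩ := hne
  have hcontact : ∀ z ∈ frontier Ω, obstacle Q τ w₀ z = Q z := fun z hz =>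
    frontier_offSpectral_subset hQ.continuous hz
  obtain ⟨H, hH, hHeq, r, hr, hrsub, hrQ⟩ := exists_harmonic_part hQ.continuous hτ
    (z₀ := z₀) (by rw [hcontact z₀ hz₀]; exact EReal.coe_ne_bot _) hw₀
  have hSH := obstacle_mem (τ := τ) (w₀ := w₀) hQ.continuous
  -- The frontier stays at distance more than `r` from `w₀`. Hence a disk about `z` reaching the
  -- frontier, of radius less than `r/3`, stays outside the disk of radius `r/3` about `w₀`, where
  -- `L` is the logarithm and `u` is the true gap.
  refine ⟨H, hH, r / 3, by positivity, (closedBall_subset_closedBall (by linarith)).trans hrsub,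
    fun L hL hLlog hLle => ?_⟩
  set u : ℂ → ℝ := fun z => Q z - τ * L z - H z with hu
  have hpos : ∀ z ∈ Ω, 0 < u z := by
    intro z hz
    by_cases hzr : ‖z - w₀‖ ≤ r / 3
    · have h1 := hrQ z (by rw [mem_closedBall, dist_eq_norm]; linarith)
      have h2 := hLle z hzr
      have h3 : Real.log (r / 3) ≤ Real.log r := Real.log_le_log (by positivity) (by linarith)
      simp only [hu]
      nlinarith
    · push Not at hzr
      have hzw : z ≠ w₀ := by
        rintro rfl
        simp at hzr
        linarith
      have h1 := obstacle_lt (offSpectral_subset hz)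
      rw [hHeq z hz hzw, EReal.coe_lt_coe_iff, ← hLlog z hzr.le] at h1
      simp only [hu]
      linarith
  have hLc : ∀ z ∈ Ω, ContDiffAt ℝ 2 u z := fun z hz =>
    (hQ.contDiffAt.sub (contDiffAt_const.mul hL.contDiffAt)).sub (hH z hz).1
  obtain ⟨R, hR⟩ := hbdd.subset_closedBall 0
  have hRcl : closure Ω ⊆ closedBall 0 R := closure_minimal hR isClosed_closedBall
  obtain ⟨C, hC0, hC⟩ := exists_taylor_bound hQ (R + 2 * r)
  set d : ℂ → ℝ := fun z => infDist z (frontier Ω) with hd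
  have hdpos : ∀ z ∈ Ω, 0 < d z := fun z hz =>
    (isClosed_frontier.notMem_iff_infDist_pos ⟨z₀, hz₀⟩).1 fun h => by
      rw [frontier, hΩo.interior_eq] at h; exact h.2 hz
  -- the harmonic function `k` near the boundary
  set k : ℂ → ℝ := fun z => τ * Real.log ‖z - w₀‖ + H z with hk
  have hfar : ∀ z ∈ frontier Ω, r < ‖z - w₀‖ := fun z hz => by
    by_contra hcon
    push Not at hcon
    have : z ∈ Ω := hrsub (by rwa [mem_closedBall, dist_eq_norm])
    rw [frontier, hΩo.interior_eq] at hz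
    exact hz.2 this
  have hnear : ∀ z ∈ Ω, d z < r / 3 → ∃ z₁ ∈ frontier Ω, d z = ‖z - z₁‖ ∧
      (∀ w ∈ ball z (d z), w ∈ Ω ∧ r / 3 < ‖w - w₀‖) ∧ HarmonicOnNhd k (ball z (d z)) ∧
      (∀ w ∈ ball z (d z), obstacle Q τ w₀ w = (k w : EReal)) := by
    intro z hz hdz
    obtain ⟨z₁, hz₁, hdist⟩ := isClosed_frontier.exists_infDist_eq_dist ⟨z₀, hz₀⟩ z
    have hdist' : d z = ‖z - z₁‖ := by rw [← dist_eq_norm]; exact hdist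
    have h1 : ∀ w ∈ ball z (d z), w ∈ Ω ∧ r / 3 < ‖w - w₀‖ := by
      intro w hw
      refine ⟨ball_infDist_frontier_subset hΩo hz (hdpos z hz) hw, ?_⟩
      have h2 := hfar z₁ hz₁
      rw [mem_ball, dist_eq_norm] at hw
      have h3 : ‖z₁ - w₀‖ ≤ ‖w - w₀‖ + ‖w - z‖ + ‖z - z₁‖ := by
        calc ‖z₁ - w₀‖ = ‖(w - w₀) - (w - z) - (z - z₁)‖ := by congr 1; ring
          _ ≤ ‖(w - w₀) - (w - z)‖ + ‖z - z₁‖ := norm_sub_le _ _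
          _ ≤ _ := by gcongr; exact norm_sub_le _ _
      linarith
    have hne : ∀ w ∈ ball z (d z), w ≠ w₀ := by
      rintro w hw rfl
      have := (h1 w hw).2
      simp at this
      linarith
    refine ⟨z₁, hz₁, hdist', h1, fun w hw => ?_, fun w hw => hHeq w (h1 w hw).1 (hne w hw)⟩
    exact ((harmonicAt_log_norm_sub (hne w hw)).const_smul (c := τ)).add (hH w (h1 w hw).1)
  have huk : ∀ z, r / 3 < ‖z - w₀‖ → u z = Q z - k z := fun z hz => by
    simp only [hu, hk, hLlog z hz.le]; ring
  have hquad : ∀ z ∈ Ω, d z < r / 3 → u z ≤ 480 * C * d z ^ 2 := by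
    intro z hz hdz
    obtain ⟨z₁, hz₁, hdist, hball, hkh, hkq⟩ := hnear z hz hdz
    have hdp := hdpos z hz
    rw [huk z (hball z (mem_ball_self hdp)).2]
    rw [hdist] at hkh hkq hdp hdz ⊢
    refine gap_le_quadratic hSH.1 obstacle_le (hcontact z₁ hz₁) (sub_ne_zero.1 (norm_pos_iff.1 hdp))
      hkh hkq hC0 fun w hw => ?_
    have h1 : ‖z₁‖ ≤ R := by simpa using hRcl (frontier_subset_closure hz₁)
    rw [mem_closedBall, dist_eq_norm] at hw
    refine hC z₁ (by simp; linarith) w ?_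
    rw [mem_closedBall_zero_iff]
    calc ‖w‖ = ‖(w - z₁) + z₁‖ := by congr 1; ring
      _ ≤ ‖w - z₁‖ + ‖z₁‖ := norm_add_le _ _
      _ ≤ _ := by linarith
  -- the part of the domain away from the boundary
  have hinner : ∀ η > 0, IsCompact {z | z ∈ Ω ∧ η ≤ d z} := by
    intro η hη
    have : {z | z ∈ Ω ∧ η ≤ d z} = closure Ω ∩ {z | η ≤ d z} := by
      ext z
      refine ⟨fun h => ⟨subset_closure h.1, h.2⟩, fun h => ⟨?_, h.2⟩⟩
      by_contra hzΩ
      have : z ∈ frontier Ω := by rw [frontier, hΩo.interior_eq]; exact ⟨h.1, hzΩ⟩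
      have h2 : d z = 0 := infDist_zero_of_mem this
      have h3 : η ≤ d z := h.2
      linarith
    rw [this]
    exact hbdd.isCompact_closure.inter_right
      (isClosed_le continuous_const (continuous_infDist_pt _))
  refine ⟨hpos, ?_, fun δ hδ => ?_⟩
  · -- gradient bound
    have hK := hinner (r / 3) (by positivity)
    set K := {z | z ∈ Ω ∧ r / 3 ≤ d z} with hKdef
    obtain ⟨C₁, hC₁⟩ : ∃ C₁, 0 ≤ C₁ ∧ ∀ z ∈ K, ‖fderiv ℝ u z‖ ^ 2 ≤ C₁ * u z := by
      have hcont : ContinuousOn (fun z => ‖fderiv ℝ u z‖ ^ 2 / u z) K := fun z hz => by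
        have h1 : ContinuousAt (fderiv ℝ u) z :=
          ((hLc z hz.1).fderiv_right (m := 1) (by norm_num)).continuousAt
        exact ((continuousAt_id.comp h1.norm).pow 2).div (hLc z hz.1).continuousAt
          (hpos z hz.1).ne' |>.continuousWithinAt
      obtain ⟨C₁, hC₁⟩ := hK.bddAbove_image hcont
      refine ⟨|C₁|, abs_nonneg _, fun z hz => ?_⟩
      rw [← div_le_iff₀ (hpos z hz.1)]
      exact (hC₁ (mem_image_of_mem _ hz)).trans (le_abs_self _)
    set D : ℝ := 480 * C with hD
    have hD0 : 0 < D := by positivity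
    refine ⟨C₁ + 4 * D * (1 + C / D) ^ 2, fun z hz => ?_⟩
    have hup := hpos z hz
    by_cases hdz : r / 3 ≤ d z
    · have := hC₁.2 z ⟨hz, hdz⟩
      have h2 : 0 ≤ 4 * D * (1 + C / D) ^ 2 * u z := by positivity
      change ‖fderiv ℝ u z‖ ^ 2 ≤ _ * u z
      linarith
    · push Not at hdz
      obtain ⟨z₁, hz₁, hdist, hball, hkh, hkq⟩ := hnear z hz hdz
      have hdp := hdpos z hz
      have hq := hquad z hz hdz
      -- The gradient estimate on a disk of radius `s` gives `2 (u + C s²) / s`, and this choice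
      -- makes both terms of order `√u`. The quadratic bound `u ≤ D d²` ensures that the disk lies
      -- in the domain.
      set s := Real.sqrt (u z / D) with hs
      have hs2 : s ^ 2 = u z / D := Real.sq_sqrt (by positivity)
      have hs0 : 0 < s := Real.sqrt_pos.2 (by positivity)
      have huD : u z = D * s ^ 2 := by rw [hs2]; field_simp
      have hsd : s ≤ d z := by
        have : s ^ 2 ≤ d z ^ 2 := by rw [hs2, div_le_iff₀ hD0]; linarith
        exact le_of_sq_le_sq this hdp.le
      have hsub : ball z s ⊆ ball z (d z) := ball_subset_ball hsd
      have hzR : ‖z‖ ≤ R := by simpa using hR hz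
      have key := norm_fderiv_gap_le (hQ.differentiable (by norm_num)) hs0 (hkh.mono hsub)
        (fun w hw => by
          rw [← EReal.coe_le_coe_iff, ← hkq w (hsub hw)]; exact obstacle_le w) hC0
        (fun w hw => hC z (by simp; linarith) w (by
          have : ‖w‖ ≤ R := by simpa using hR (hball w (hsub hw)).1
          simp; linarith))
      have hev : (fun w => Q w - k w) =ᶠ[𝓝 z] u := by
        filter_upwards [isOpen_ball.mem_nhds (mem_ball_self hdp)] with w hw
        exact (huk w (hball w hw).2).symm
      rw [hev.fderiv_eq, ← huk z (hball z (mem_ball_self hdp)).2, huD] at key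
      have e : 2 * (D * s ^ 2 + C * s ^ 2) / s = 2 * D * (1 + C / D) * s := by
        field_simp
      rw [e] at key
      have h1 : ‖fderiv ℝ u z‖ ^ 2 ≤ (2 * D * (1 + C / D) * s) ^ 2 := by gcongr
      have h2 : (2 * D * (1 + C / D) * s) ^ 2 = 4 * D * (1 + C / D) ^ 2 * u z := by
        rw [huD]; ring
      have h3 : 0 ≤ C₁ * u z := mul_nonneg hC₁.1 hup.le
      change ‖fderiv ℝ u z‖ ^ 2 ≤ _ * u z
      linarith
  · -- compactness of the superlevel sets
    -- By the quadratic bound, `u < δ` at points this close to the frontier, so the superlevel set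
    -- lies in the compact inner part.
    set η := min (r / 3) (Real.sqrt (δ / (480 * C))) / 2 with hη
    have hsq : 0 < Real.sqrt (δ / (480 * C)) := Real.sqrt_pos.2 (by positivity)
    have hη0 : 0 < η := by positivity
    have hsub : {z | z ∈ Ω ∧ δ ≤ u z} = {z | z ∈ Ω ∧ η ≤ d z} ∩ u ⁻¹' Ici δ := by
      ext z
      refine ⟨fun h => ⟨⟨h.1, ?_⟩, h.2⟩, fun h => ⟨h.1.1, h.2⟩⟩
      by_contra hcon
      push Not at hcon
      have h1 : d z < r / 3 := by
        have := min_le_left (r / 3) (Real.sqrt (δ / (480 * C)))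
        rw [hη] at hcon; linarith
      have h2 : d z < Real.sqrt (δ / (480 * C)) := by
        have := min_le_right (r / 3) (Real.sqrt (δ / (480 * C)))
        rw [hη] at hcon; linarith
      have h3 := hquad z h.1 h1
      have h4 : d z ^ 2 < δ / (480 * C) := (Real.lt_sqrt (hdpos z h.1).le).1 h2
      rw [lt_div_iff₀ (by positivity)] at h4
      have h5 : δ ≤ u z := h.2
      linarith
    change IsCompact {z | z ∈ Ω ∧ δ ≤ u z}
    rw [hsub]
    refine UpperSemicontinuousOn.isCompact_inter_preimage_Ici
      (ContinuousOn.upperSemicontinuousOn ?_) (hinner η hη0) δ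
    exact fun z hz => (hLc z hz.1).continuousAt.continuousWithinAt


/-! ### Green's identity and truncation of the gap. -/

section Laplacian

theorem fderiv_fderiv_apply {f : ℂ → ℝ} {z : ℂ} (hf : ContDiffAt ℝ 2 f z) (v : ℂ) :
    fderiv ℝ (fun w => fderiv ℝ f w v) z = (fderiv ℝ (fderiv ℝ f) z).flip v := by
  have h1 : DifferentiableAt ℝ (fderiv ℝ f) z :=
    (hf.fderiv_right (m := 1) (by norm_num)).differentiableAt (by norm_num)
  have h2 := h1.hasFDerivAt.clm_apply (hasFDerivAt_const v z)
  rw [h2.fderiv]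
  ext w
  simp

theorem laplacian_eq_fderiv {f : ℂ → ℝ} {z : ℂ} (hf : ContDiffAt ℝ 2 f z) :
    Laplacian.laplacian f z = fderiv ℝ (fun w => fderiv ℝ f w 1) z 1 +
      fderiv ℝ (fun w => fderiv ℝ f w Complex.I) z Complex.I := by
  rw [laplacian_eq_iteratedFDeriv_complexPlane, fderiv_fderiv_apply hf, fderiv_fderiv_apply hf]
  simp [iteratedFDeriv_two_apply]

theorem ContDiffAt.fderiv_apply_const {f : ℂ → ℝ} {z : ℂ} (hf : ContDiffAt ℝ 2 f z) (v : ℂ) :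
    ContDiffAt ℝ 1 (fun w => fderiv ℝ f w v) z :=
  (hf.fderiv_right (m := 1) (by norm_num)).clm_apply contDiffAt_const

theorem ContDiffAt.continuousAt_laplacian {f : ℂ → ℝ} {z : ℂ} (hf : ContDiffAt ℝ 2 f z) :
    ContinuousAt (Laplacian.laplacian f) z := by
  have h : ∀ v : ℂ, ContinuousAt (fun w => fderiv ℝ (fun w => fderiv ℝ f w v) w v) z := fun v =>
    (((ContDiffAt.fderiv_apply_const hf v).fderiv_right (m := 0) (by norm_num)).clm_apply
      contDiffAt_const).continuousAt
  refine ((h 1).add (h Complex.I)).congr ?_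
  filter_upwards [hf.eventually (by norm_num)] with w hw using (laplacian_eq_fderiv hw).symm

/-- The Laplacian of a composition. -/
theorem laplacian_comp {φ : ℝ → ℝ} {u : ℂ → ℝ} {z : ℂ} (hφ : ContDiff ℝ 2 φ)
    (hu : ContDiffAt ℝ 2 u z) :
    Laplacian.laplacian (fun w => φ (u w)) z = deriv φ (u z) * Laplacian.laplacian u z +
      deriv (deriv φ) (u z) * ((fderiv ℝ u z 1) ^ 2 + (fderiv ℝ u z Complex.I) ^ 2) := by
  have hφ1 : ContDiff ℝ 1 (deriv φ) := hφ.deriv' (n := 1)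
  have h1 : ∀ v : ℂ, (fun w => fderiv ℝ (fun w => φ (u w)) w v) =ᶠ[𝓝 z]
      fun w => deriv φ (u w) * fderiv ℝ u w v := by
    intro v
    filter_upwards [hu.eventually (by norm_num)] with w hw
    have hd : HasFDerivAt u (fderiv ℝ u w) w := (hw.differentiableAt (by norm_num)).hasFDerivAt
    have hφd : HasDerivAt φ (deriv φ (u w)) (u w) :=
      (hφ.differentiable (by norm_num) _).hasDerivAt
    have e : HasFDerivAt (fun w => φ (u w)) _ w := hφd.comp_hasFDerivAt w hd
    rw [e.fderiv]
    simp
  have h2 : ∀ v : ℂ, fderiv ℝ (fun w => fderiv ℝ (fun w => φ (u w)) w v) z v =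
      deriv φ (u z) * fderiv ℝ (fun w => fderiv ℝ u w v) z v +
        deriv (deriv φ) (u z) * (fderiv ℝ u z v) ^ 2 := by
    intro v
    rw [(h1 v).fderiv_eq]
    have hd : HasFDerivAt u (fderiv ℝ u z) z := (hu.differentiableAt (by norm_num)).hasFDerivAt
    have hφd : HasDerivAt (deriv φ) (deriv (deriv φ) (u z)) (u z) :=
      (hφ1.differentiable (by norm_num) _).hasDerivAt
    have hd2 : HasFDerivAt (fun w => fderiv ℝ u w v) _ z :=
      ((ContDiffAt.fderiv_apply_const hu v).differentiableAt (by norm_num)).hasFDerivAt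
    have h3 := (hφd.comp_hasFDerivAt z hd).mul hd2
    have e : (fun w => deriv φ (u w) * fderiv ℝ u w v) =
      (deriv φ ∘ u) * fun w => fderiv ℝ u w v := rfl
    rw [e, h3.fderiv]
    simp
    ring
  rw [laplacian_eq_fderiv (show ContDiffAt ℝ 2 (fun w => φ (u w)) z from hφ.contDiffAt.comp z hu), laplacian_eq_fderiv hu, h2, h2]
  ring

theorem integrable_mul_of_tsupport {f k : ℂ → ℝ} {Ω : Set ℂ}
    (hf : ∀ z ∈ Ω, ContinuousAt f z) (hk : Continuous k) (hkc : HasCompactSupport k)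
    (hks : tsupport k ⊆ Ω) : Integrable (fun z => f z * k z) := by
  have hcs : HasCompactSupport (fun z => f z * k z) := hkc.mul_left
  refine Continuous.integrable_of_hasCompactSupport ?_ hcs
  refine continuous_of_tsupport fun z hz => ?_
  exact (hf z (hks (tsupport_mul_subset_right hz))).mul hk.continuousAt

/-- Harmonic functions are orthogonal to Laplacians of test functions. -/
theorem integral_mul_laplacian_eq_zero {h g : ℂ → ℝ} {Ω : Set ℂ} (hh : HarmonicOnNhd h Ω)
    (hg : ContDiff ℝ 2 g) (hgc : HasCompactSupport g) (hgs : tsupport g ⊆ Ω) :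
    ∫ z, h z * Laplacian.laplacian g z = 0 := by
  have hsub : ∀ v : ℂ, tsupport (fun w => fderiv ℝ g w v) ⊆ tsupport g := fun v =>
    closure_minimal (fun w hw => by
      by_contra hcon
      exact hw (by
        simp only
        rw [Function.notMem_support.1 fun h => hcon (support_fderiv_subset ℝ h)]; rfl))
      (isClosed_tsupport g)
  have hg1 : ∀ v : ℂ, ContDiff ℝ 1 (fun w => fderiv ℝ g w v) := fun v =>
    contDiff_iff_contDiffAt.2 fun z => ContDiffAt.fderiv_apply_const hg.contDiffAt v
  have hg1c : ∀ v : ℂ, HasCompactSupport (fun w => fderiv ℝ g w v) := fun v =>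
    hgc.mono' (subset_closure.trans (hsub v))
  have hg2 : ∀ v : ℂ, Continuous (fun w => fderiv ℝ (fun w => fderiv ℝ g w v) w v) := fun v =>
    ((hg1 v).continuous_fderiv (by norm_num)).clm_apply continuous_const
  have hsub2 : ∀ v : ℂ, tsupport (fun w => fderiv ℝ (fun w => fderiv ℝ g w v) w v) ⊆
      tsupport g := fun v => closure_minimal (fun w hw => by
        by_contra hcon
        refine hw ?_
        simp only
        rw [Function.notMem_support.1 fun h => hcon (hsub v (support_fderiv_subset ℝ h))]; rfl)
      (isClosed_tsupport g)
  have hg2c : ∀ v : ℂ, HasCompactSupport (fun w => fderiv ℝ (fun w => fderiv ℝ g w v) w v) :=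
    fun v => hgc.mono' (subset_closure.trans (hsub2 v))
  have hcd : ∀ z ∈ Ω, ContDiffAt ℝ 2 h z := fun z hz => (hh z hz).1
  have key : ∀ v : ℂ, ∫ z, h z * fderiv ℝ (fun w => fderiv ℝ g w v) z v =
      ∫ z, fderiv ℝ (fun w => fderiv ℝ h w v) z v * g z := by
    intro v
    have hc1 : ∀ z ∈ Ω, ContinuousAt (fun w => fderiv ℝ h w v) z := fun z hz =>
      (ContDiffAt.fderiv_apply_const (hcd z hz) v).continuousAt
    have hc2 : ∀ z ∈ Ω, ContinuousAt (fun w => fderiv ℝ (fun w => fderiv ℝ h w v) w v) z :=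
      fun z hz => (((ContDiffAt.fderiv_apply_const (hcd z hz) v).fderiv_right (m := 0)
        (by norm_num)).clm_apply contDiffAt_const).continuousAt
    rw [integral_mul_fderiv_eq_neg_fderiv_mul_of_integrable
      (integrable_mul_of_tsupport hc1 (hg1 v).continuous (hg1c v) ((hsub v).trans hgs))
      (integrable_mul_of_tsupport (fun z hz => (hcd z hz).continuousAt) (hg2 v) (hg2c v)
        ((hsub2 v).trans hgs))
      (integrable_mul_of_tsupport (fun z hz => (hcd z hz).continuousAt) (hg1 v).continuous
        (hg1c v) ((hsub v).trans hgs))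
      (fun z hz => (hcd z (hgs (hsub v hz))).differentiableAt (by norm_num))
      (fun z _ => (hg1 v).differentiable (by norm_num) z),
      integral_mul_fderiv_eq_neg_fderiv_mul_of_integrable
      (integrable_mul_of_tsupport hc2 hg.continuous hgc hgs)
      (integrable_mul_of_tsupport hc1 (hg1 v).continuous (hg1c v) ((hsub v).trans hgs))
      (integrable_mul_of_tsupport hc1 hg.continuous hgc hgs)
      (fun z hz => (ContDiffAt.fderiv_apply_const (hcd z (hgs hz)) v).differentiableAt
        (by norm_num))
      (fun z _ => hg.differentiable (by norm_num) z), neg_neg]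
  have e1 : ∀ z, h z * Laplacian.laplacian g z =
      h z * fderiv ℝ (fun w => fderiv ℝ g w 1) z 1 +
        h z * fderiv ℝ (fun w => fderiv ℝ g w Complex.I) z Complex.I := fun z => by
    rw [laplacian_eq_fderiv hg.contDiffAt]; ring
  have hi : ∀ v : ℂ, Integrable fun z => h z * fderiv ℝ (fun w => fderiv ℝ g w v) z v := fun v =>
    integrable_mul_of_tsupport (fun z hz => (hcd z hz).continuousAt) (hg2 v) (hg2c v)
      ((hsub2 v).trans hgs)
  have hi2 : ∀ v : ℂ, Integrable fun z => fderiv ℝ (fun w => fderiv ℝ h w v) z v * g z := fun v =>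
    integrable_mul_of_tsupport (fun z hz => (((ContDiffAt.fderiv_apply_const (hcd z hz)
      v).fderiv_right (m := 0) (by norm_num)).clm_apply contDiffAt_const).continuousAt)
      hg.continuous hgc hgs
  simp_rw [e1]
  rw [integral_add (hi _) (hi _), key, key, ← integral_add (hi2 _) (hi2 _)]
  refine integral_eq_zero_of_ae (Eventually.of_forall fun z => ?_)
  simp only [Pi.zero_apply]
  by_cases hz : z ∈ tsupport g
  · rw [← add_mul, ← laplacian_eq_fderiv (hcd z (hgs hz)), (hh z (hgs hz)).2.self_of_nhds]
    simp
  · rw [image_eq_zero_of_notMem_tsupport hz]; simp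

end Laplacian

/-- A smooth approximation of the identity on `[0, ∞)` which vanishes near `0`. -/
theorem exists_smooth_truncation : ∃ Φ : ℝ → ℝ, ContDiff ℝ 2 Φ ∧ (∀ s ≤ 1, Φ s = 0) ∧
    (∀ s > 2, deriv Φ s = 1 ∧ deriv (deriv Φ) s = 0) ∧
    ∃ C, 0 ≤ C ∧ ∀ s ≥ 0, |deriv Φ s| ≤ C ∧ |deriv (deriv Φ) s| * s ≤ C := by
  set Φ : ℝ → ℝ := fun s => s * Real.smoothTransition (s - 1) with hΦ
  have hc : ContDiff ℝ 2 Φ := contDiff_id.mul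
    ((Real.smoothTransition.contDiff (n := 2)).comp (contDiff_id.sub contDiff_const))
  have hc1 : ContDiff ℝ 1 (deriv Φ) := hc.deriv' (n := 1)
  have hc2 : Continuous (deriv (deriv Φ)) := hc1.continuous_deriv (by norm_num)
  have h2 : ∀ s > 2, deriv Φ s = 1 := by
    intro s hs
    have : Φ =ᶠ[𝓝 s] id := by
      filter_upwards [isOpen_Ioi.mem_nhds hs] with t ht
      have ht' : (2 : ℝ) < t := ht
      simp only [hΦ, id]
      rw [Real.smoothTransition.one_of_one_le (by linarith), mul_one]
    rw [this.deriv_eq]; simp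
  have h3 : ∀ s > 2, deriv (deriv Φ) s = 0 := by
    intro s hs
    have : deriv Φ =ᶠ[𝓝 s] fun _ => 1 := by
      filter_upwards [isOpen_Ioi.mem_nhds hs] with t ht using h2 t ht
    rw [this.deriv_eq]; simp
  obtain ⟨C₁, hC₁⟩ := isCompact_Icc.exists_bound_of_continuousOn
    (hc1.continuous.continuousOn (s := Icc 0 2))
  obtain ⟨C₂, hC₂⟩ := isCompact_Icc.exists_bound_of_continuousOn (hc2.continuousOn (s := Icc 0 2))
  have hC₁0 : 0 ≤ C₁ := (norm_nonneg _).trans (hC₁ 0 (by simp))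
  have hC₂0 : 0 ≤ C₂ := (norm_nonneg _).trans (hC₂ 0 (by simp))
  refine ⟨Φ, hc, fun s hs => ?_, fun s hs => ⟨h2 s hs, h3 s hs⟩, C₁ + 2 * C₂ + 1, by positivity,
    fun s hs => ?_⟩
  · simp only [hΦ]
    rw [Real.smoothTransition.zero_of_nonpos (by linarith), mul_zero]
  · by_cases hs2 : s ≤ 2
    · have e1 := hC₁ s ⟨hs, hs2⟩
      have e2 := hC₂ s ⟨hs, hs2⟩
      rw [Real.norm_eq_abs] at e1 e2
      refine ⟨by linarith, ?_⟩
      calc |deriv (deriv Φ) s| * s ≤ C₂ * 2 := by gcongr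
        _ ≤ _ := by linarith
    · push Not at hs2
      rw [h2 s hs2, h3 s hs2]
      simp
      constructor <;> positivity

open Classical in
/-- If a positive function on a bounded domain has compact superlevel sets and the square of its
gradient is dominated by its values, then its Laplacian is orthogonal to bounded harmonic
functions. -/
theorem setIntegral_mul_laplacian_eq_zero {Ω : Set ℂ} (hΩ : IsOpen Ω)
    (hΩb : Bornology.IsBounded Ω) {u h : ℂ → ℝ} (hu : ∀ z ∈ Ω, ContDiffAt ℝ 2 u z)
    (hpos : ∀ z ∈ Ω, 0 < u z) {C B M : ℝ} (hgrad : ∀ z ∈ Ω, ‖fderiv ℝ u z‖ ^ 2 ≤ C * u z)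
    (hcomp : ∀ δ > 0, IsCompact {z | z ∈ Ω ∧ δ ≤ u z})
    (hlap : ∀ z ∈ Ω, |Laplacian.laplacian u z| ≤ B) (hh : HarmonicOnNhd h Ω)
    (hM : ∀ z ∈ Ω, |h z| ≤ M) :
    ∫ z in Ω, h z * Laplacian.laplacian u z = 0 := by
  obtain ⟨Φ, hΦ, hΦ0, hΦ1, C₁, hC₁0, hC₁⟩ := exists_smooth_truncation
  have hfin : volume Ω < ⊤ := hΩb.measure_lt_top
  have hgsq : ∀ z ∈ Ω, (fderiv ℝ u z 1) ^ 2 + (fderiv ℝ u z Complex.I) ^ 2 ≤ 2 * (C * u z) := by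
    intro z hz
    have h1 : ∀ v : ℂ, ‖v‖ = 1 → (fderiv ℝ u z v) ^ 2 ≤ ‖fderiv ℝ u z‖ ^ 2 := fun v hv => by
      have := (fderiv ℝ u z).le_opNorm v
      rw [hv, mul_one, Real.norm_eq_abs] at this
      rw [← sq_abs]; gcongr
    linarith [h1 1 (by simp), h1 Complex.I (by simp), hgrad z hz]
  -- the truncated functions
  set φ : ℕ → ℝ → ℝ := fun n s => Φ ((n + 1 : ℝ) * s) with hφ
  have hφc : ∀ n, ContDiff ℝ 2 (φ n) := fun n => hΦ.comp (contDiff_const.mul contDiff_id)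
  have hφ' : ∀ n s, deriv (φ n) s = (n + 1 : ℝ) * deriv Φ ((n + 1 : ℝ) * s) := fun n s => by
    simp only [hφ]
    rw [deriv_comp_mul_left, smul_eq_mul]
  have hφ'' : ∀ n s, deriv (deriv (φ n)) s =
      (n + 1 : ℝ) ^ 2 * deriv (deriv Φ) ((n + 1 : ℝ) * s) := fun n s => by
    have : deriv (φ n) = fun s => (n + 1 : ℝ) * deriv Φ ((n + 1 : ℝ) * s) := funext (hφ' n)
    rw [this, deriv_const_mul_field, deriv_comp_mul_left, smul_eq_mul]
    ring
  set T : ℕ → ℂ → ℝ := fun n z => h z * (deriv Φ ((n + 1 : ℝ) * u z) * Laplacian.laplacian u z +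
    (n + 1 : ℝ) * deriv (deriv Φ) ((n + 1 : ℝ) * u z) *
      ((fderiv ℝ u z 1) ^ 2 + (fderiv ℝ u z Complex.I) ^ 2)) with hT
  have hzero : ∀ n, ∫ z in Ω, T n z = 0 := by
    intro n
    have hn : (0 : ℝ) < n + 1 := by positivity
    set g : ℂ → ℝ := fun z => if z ∈ Ω then φ n (u z) else 0 with hg
    set K := {z | z ∈ Ω ∧ 1 / (n + 1 : ℝ) ≤ u z} with hK
    have hKc : IsCompact K := hcomp _ (by positivity)
    have hg0 : ∀ z, z ∉ K → g z = 0 := by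
      intro z hz
      simp only [hg]
      split_ifs with hzΩ
      · refine hΦ0 _ ?_
        by_contra hcon
        push Not at hcon
        refine hz ⟨hzΩ, ?_⟩
        rw [div_le_iff₀ hn]
        linarith
      · rfl
    have hsupp : tsupport g ⊆ K := closure_minimal (fun z hz => by
      by_contra hcon
      exact hz (hg0 z hcon)) hKc.isClosed
    have hgΩ : ∀ z ∈ Ω, g =ᶠ[𝓝 z] fun w => φ n (u w) := fun z hz => by
      filter_upwards [hΩ.mem_nhds hz] with w hw
      simp only [hg, if_pos hw]
    have hgcd : ContDiff ℝ 2 g := by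
      rw [contDiff_iff_contDiffAt]
      intro z
      by_cases hz : z ∈ Ω
      · exact ((hφc n).contDiffAt.comp z (hu z hz)).congr_of_eventuallyEq (hgΩ z hz)
      · have : g =ᶠ[𝓝 z] fun _ => 0 := by
          filter_upwards [hKc.isClosed.isOpen_compl.mem_nhds fun h => hz h.1] with w hw
          exact hg0 w hw
        exact contDiffAt_const.congr_of_eventuallyEq this
    have hint := integral_mul_laplacian_eq_zero hh hgcd
      (hKc.of_isClosed_subset (isClosed_tsupport g) hsupp) (hsupp.trans fun z hz => hz.1)
    have hlapg : ∀ z ∈ Ω, h z * Laplacian.laplacian g z = (n + 1 : ℝ) * T n z := by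
      intro z hz
      rw [(laplacian_congr_nhds (hgΩ z hz)).self_of_nhds, laplacian_comp (hφc n) (hu z hz), hφ',
        hφ'']
      simp only [hT]
      ring
    have hlap0 : ∀ z, z ∉ Ω → h z * Laplacian.laplacian g z = 0 := by
      intro z hz
      have : g =ᶠ[𝓝 z] fun _ => (0 : ℝ) := by
        filter_upwards [hKc.isClosed.isOpen_compl.mem_nhds fun h => hz h.1] with w hw
        exact hg0 w hw
      rw [(laplacian_congr_nhds this).self_of_nhds, laplacian_const]
      simp
    rw [← setIntegral_eq_integral_of_forall_compl_eq_zero (s := Ω) (fun z hz => hlap0 z hz),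
      setIntegral_congr_fun hΩ.measurableSet hlapg, integral_const_mul] at hint
    exact (mul_eq_zero.1 hint).resolve_left hn.ne'
  have hcT : ∀ n, ContinuousOn (T n) Ω := by
    intro n z hz
    have h1 : ContinuousAt u z := (hu z hz).continuousAt
    have h2 : ContinuousAt (Laplacian.laplacian u) z := ContDiffAt.continuousAt_laplacian (hu z hz)
    have h3 : ∀ v : ℂ, ContinuousAt (fun w => fderiv ℝ u w v) z := fun v =>
      (ContDiffAt.fderiv_apply_const (hu z hz) v).continuousAt
    have h4 : Continuous (deriv Φ) := hΦ.continuous_deriv (by norm_num)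
    have h5 : Continuous (deriv (deriv Φ)) :=
      (hΦ.deriv' (n := 1)).continuous_deriv (by norm_num)
    have h6 : ContinuousAt h z := (hh z hz).1.continuousAt
    have h7 : ContinuousAt (fun z => (n + 1 : ℝ) * u z) z := continuousAt_const.mul h1
    exact (h6.mul (((h4.continuousAt.comp h7).mul h2).add ((continuousAt_const.mul
      (h5.continuousAt.comp h7)).mul (((h3 1).pow 2).add
        ((h3 Complex.I).pow 2))))).continuousWithinAt
  have hlim : Tendsto (fun n => ∫ z in Ω, T n z) atTop
      (𝓝 (∫ z in Ω, h z * Laplacian.laplacian u z)) := by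
    have hconst : IntegrableOn (fun _ : ℂ => M * (C₁ * B + C₁ * (2 * C))) Ω :=
      integrableOn_const hfin.ne
    refine tendsto_integral_of_dominated_convergence
      (fun _ => M * (C₁ * B + C₁ * (2 * C)))
      (fun n => (hcT n).aestronglyMeasurable hΩ.measurableSet) hconst (fun n => ?_) ?_
    · refine (ae_restrict_iff' hΩ.measurableSet).2 (Eventually.of_forall fun z hz => ?_)
      have hn : (0 : ℝ) < n + 1 := by positivity
      obtain ⟨e1, e2⟩ := hC₁ ((n + 1 : ℝ) * u z) (mul_nonneg hn.le (hpos z hz).le)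
      have hup := hpos z hz
      have hg := hgsq z hz
      simp only [hT, Real.norm_eq_abs]
      rw [abs_mul]
      have hB := hlap z hz
      have hMz := hM z hz
      have hG0 : 0 ≤ (fderiv ℝ u z 1) ^ 2 + (fderiv ℝ u z Complex.I) ^ 2 := by positivity
      have hC0 : 0 ≤ C := by
        have : 0 ≤ C * u z := (sq_nonneg _).trans (hgrad z hz)
        exact nonneg_of_mul_nonneg_left this hup
      -- Since `|∇u|²` is at most a multiple of `u`, the second-order error is bounded through
      -- `|Φ''(t)| t ≤ C₁` with `t = (n + 1) u`, uniformly in `n`. At a fixed point it vanishes once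
      -- `t > 2`.
      have a1 : |deriv Φ ((n + 1 : ℝ) * u z) * Laplacian.laplacian u z| ≤ C₁ * B := by
        rw [abs_mul]; gcongr
      have a2 : |(n + 1 : ℝ) * deriv (deriv Φ) ((n + 1 : ℝ) * u z) *
          ((fderiv ℝ u z 1) ^ 2 + (fderiv ℝ u z Complex.I) ^ 2)| ≤ C₁ * (2 * C) := by
        rw [abs_mul, abs_mul, abs_of_pos hn, abs_of_nonneg hG0]
        calc (n + 1 : ℝ) * |deriv (deriv Φ) ((n + 1 : ℝ) * u z)| *
              ((fderiv ℝ u z 1) ^ 2 + (fderiv ℝ u z Complex.I) ^ 2)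
            ≤ (n + 1 : ℝ) * |deriv (deriv Φ) ((n + 1 : ℝ) * u z)| * (2 * (C * u z)) := by gcongr
          _ = |deriv (deriv Φ) ((n + 1 : ℝ) * u z)| * ((n + 1 : ℝ) * u z) * (2 * C) := by ring
          _ ≤ C₁ * (2 * C) := by gcongr
      have hM0 : 0 ≤ M := (abs_nonneg _).trans hMz
      refine mul_le_mul hMz ((abs_add_le _ _).trans (add_le_add a1 a2)) (abs_nonneg _) hM0
    · refine (ae_restrict_iff' hΩ.measurableSet).2 (Eventually.of_forall fun z hz => ?_)
      refine tendsto_const_nhds.congr' ?_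
      have hup := hpos z hz
      have : ∀ᶠ n : ℕ in atTop, 2 / u z < (n : ℝ) :=
        tendsto_natCast_atTop_atTop.eventually_gt_atTop _
      filter_upwards [this] with n hn
      rw [div_lt_iff₀ hup] at hn
      obtain ⟨e1, e2⟩ := hΦ1 ((n + 1 : ℝ) * u z) (by nlinarith)
      simp only [hT, e1, e2]
      ring
  simp only [hzero] at hlim
  exact tendsto_nhds_unique hlim tendsto_const_nhds


/-! ### Polar coordinates and the mass of the modified logarithm. -/

section Polar

open Real in
theorem integrable_polar {f : ℂ → ℝ} (hf : Measurable f) {M R : ℝ} (hM : ∀ z, |f z| ≤ M) :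
    Integrable (fun p : ℝ × ℝ => p.1 * f (Complex.polarCoord.symm p))
      ((volume.restrict (Ioc 0 R)).prod (volume.restrict (Ioo (-π) π))) := by
  have hc : Continuous (fun p : ℝ × ℝ => Complex.polarCoord.symm p) := by
    simp only [Complex.polarCoord_symm_apply]
    fun_prop
  have : IsFiniteMeasure (volume.restrict (Ioc 0 R)) := ⟨by simp⟩
  have : IsFiniteMeasure (volume.restrict (Ioo (-π) π)) := ⟨by simp⟩
  refine Integrable.of_bound
    (measurable_fst.mul (hf.comp hc.measurable)).aestronglyMeasurable (|R| * M) ?_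
  rw [Measure.prod_restrict, ae_restrict_iff' (measurableSet_Ioc.prod measurableSet_Ioo)]
  refine Eventually.of_forall fun p hp => ?_
  have h1 : |p.1| ≤ |R| := by
    rw [abs_of_pos hp.1.1]
    exact hp.1.2.trans (le_abs_self R)
  rw [Real.norm_eq_abs, abs_mul]
  exact mul_le_mul h1 (hM _) (abs_nonneg _) (abs_nonneg _)

open Real in
theorem integral_eq_polar {f : ℂ → ℝ} {R : ℝ}
    (hR : ∀ z, R < ‖z‖ → f z = 0) :
    ∫ z, f z = ∫ p, p.1 * f (Complex.polarCoord.symm p)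
      ∂((volume.restrict (Ioc 0 R)).prod (volume.restrict (Ioo (-π) π))) := by
  rw [← Complex.integral_comp_polarCoord_symm, Measure.prod_restrict, ← Measure.volume_eq_prod]
  have hT : polarCoord.target = Ioi (0 : ℝ) ×ˢ Ioo (-π) π := rfl
  rw [hT]
  simp only [smul_eq_mul]
  refine setIntegral_eq_of_subset_of_forall_sdiff_eq_zero
    (measurableSet_Ioi.prod measurableSet_Ioo)
    (prod_mono Ioc_subset_Ioi_self le_rfl) fun p hp => ?_
  have hp1 : 0 < p.1 := hp.1.1
  have : R < p.1 := by
    by_contra hcon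
    exact hp.2 ⟨⟨hp1, not_lt.1 hcon⟩, hp.1.2⟩
  rw [hR, mul_zero]
  rw [Complex.norm_polarCoord_symm, abs_of_pos hp1]
  exact this

/-- Integration over a disk of a harmonic function against a radial weight. -/
theorem setIntegral_harmonic_mul_radial {h : ℂ → ℝ} {k : ℝ → ℝ} {c : ℂ} {ρ : ℝ} (hρ : 0 < ρ)
    (hh : HarmonicOnNhd h (closedBall c ρ)) (hk : Continuous k) :
    ∫ z in closedBall c ρ, h z * k (‖z - c‖ ^ 2) =
      2 * Real.pi * h c * ∫ r in (0 : ℝ)..ρ, r * k (r ^ 2) := by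
  classical
  set f : ℂ → ℝ := (closedBall (0 : ℂ) ρ).piecewise (fun z => h (c + z) * k (‖z‖ ^ 2))
    (fun _ => 0) with hf
  have hmaps : MapsTo (fun z => c + z) (closedBall (0 : ℂ) ρ) (closedBall c ρ) := fun z hz => by
    simpa [dist_eq_norm] using hz
  have hcont : ContinuousOn (fun z : ℂ => h (c + z) * k (‖z‖ ^ 2)) (closedBall 0 ρ) := by
    refine ContinuousOn.mul ?_ (by fun_prop)
    have hcl : ContinuousOn h (closedBall c ρ) := fun z hz =>
      (hh z hz).1.continuousAt.continuousWithinAt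
    exact hcl.comp (by fun_prop) hmaps
  obtain ⟨M, hM⟩ := (isCompact_closedBall (0 : ℂ) ρ).exists_bound_of_continuousOn hcont
  have hM0 : 0 ≤ M := (norm_nonneg _).trans (hM 0 (by simp [hρ.le]))
  have hfm : Measurable f := hcont.measurable_piecewise continuousOn_const measurableSet_closedBall
  have hfM : ∀ z, |f z| ≤ M := fun z => by
    by_cases hz : z ∈ closedBall (0 : ℂ) ρ
    · simp only [hf, piecewise_eq_of_mem _ _ _ hz]
      exact hM z hz
    · simp only [hf, piecewise_eq_of_notMem _ _ _ hz, abs_zero]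
      exact hM0
  have hfR : ∀ z, ρ < ‖z‖ → f z = 0 := fun z hz =>
    piecewise_eq_of_notMem _ _ _ (by simpa using hz)
  have e1 : ∫ z in closedBall c ρ, h z * k (‖z - c‖ ^ 2) = ∫ z, f z := by
    rw [← integral_indicator measurableSet_closedBall, ← integral_add_left_eq_self _ c]
    congr 1
    ext z
    by_cases hz : z ∈ closedBall (0 : ℂ) ρ
    · rw [indicator_of_mem (hmaps hz)]
      simp only [hf, piecewise_eq_of_mem _ _ _ hz, add_sub_cancel_left]
    · rw [indicator_of_notMem (by simpa [dist_eq_norm] using hz)]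
      simp only [hf, piecewise_eq_of_notMem _ _ _ hz]
  rw [e1, integral_eq_polar hfR, integral_prod _ (integrable_polar hfm hfM),
    intervalIntegral.integral_of_le hρ.le, ← integral_const_mul]
  refine setIntegral_congr_fun measurableSet_Ioc fun r hr => ?_
  have hav : ∫ t in (-Real.pi)..Real.pi, h (circleMap c r t) = 2 * Real.pi * h c := by
    have h1 : Real.circleAverage h c r = h c := by
      refine InnerProductSpace.HarmonicOnNhd.circleAverage_eq fun z hz => hh z ?_
      rw [abs_of_pos hr.1] at hz
      exact closedBall_subset_closedBall hr.2 hz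
    rw [Real.circleAverage_def, smul_eq_mul] at h1
    have hper : Function.Periodic (fun t => h (circleMap c r t)) (2 * Real.pi) := fun t => by
      simp only [periodic_circleMap c r t]
    have h2 := hper.intervalIntegral_add_eq (-Real.pi) 0
    rw [show -Real.pi + 2 * Real.pi = Real.pi by ring, zero_add] at h2
    rw [h2, ← h1]
    field_simp
  have e2 : ∀ t, r * f (Complex.polarCoord.symm (r, t)) =
      r * k (r ^ 2) * h (circleMap c r t) := fun t => by
    have hz : Complex.polarCoord.symm (r, t) ∈ closedBall (0 : ℂ) ρ := by
      rw [mem_closedBall_zero_iff, Complex.norm_polarCoord_symm, abs_of_pos hr.1]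
      exact hr.2
    simp only [hf, piecewise_eq_of_mem _ _ _ hz]
    rw [Complex.norm_polarCoord_symm, abs_of_pos hr.1]
    have : c + Complex.polarCoord.symm (r, t) = circleMap c r t := by
      rw [circleMap, Complex.polarCoord_symm_apply, Complex.exp_mul_I]
      push_cast
      ring
    rw [this]
    ring
  simp only [e2]
  rw [← integral_Ioc_eq_integral_Ioo, ← intervalIntegral.integral_of_le (by linarith [Real.pi_pos]),
    intervalIntegral.integral_const_mul, hav]
  ring

end Polar

/-- A smooth modification of `log √s` near the origin. -/
theorem exists_log_modification {ρ : ℝ} (hρ : 0 < ρ) : ∃ g : ℝ → ℝ, ContDiff ℝ 3 g ∧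
    (∀ s, ρ ^ 2 / 2 ≤ s → g s = Real.log s / 2) ∧ ∀ s ≤ ρ ^ 2, g s ≤ Real.log ρ := by
  -- The variable is `s = |z - c|²`, so `log s / 2` is the logarithm of the distance. The transition
  -- takes place for `ρ²/4 ≤ s ≤ ρ²/2`, and below it the function is the constant `log ρ`.
  set g : ℝ → ℝ := fun s => Real.log ρ +
    Real.smoothTransition (4 * s / ρ ^ 2 - 1) * (Real.log s - 2 * Real.log ρ) / 2 with hg
  have hρ2 : 0 < ρ ^ 2 := by positivity
  refine ⟨g, contDiff_iff_contDiffAt.2 fun s => ?_, fun s hs => ?_, fun s hs => ?_⟩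
  · by_cases h : s < ρ ^ 2 / 4
    · have : g =ᶠ[𝓝 s] fun _ => Real.log ρ := by
        filter_upwards [isOpen_Iio.mem_nhds h] with t ht
        have ht' : t < ρ ^ 2 / 4 := ht
        simp only [hg]
        rw [Real.smoothTransition.zero_of_nonpos]
        · simp
        · rw [sub_nonpos, div_le_one hρ2]; linarith
      exact contDiffAt_const.congr_of_eventuallyEq this
    · have hs : s ≠ 0 := by
        rintro rfl
        exact h (by positivity)
      have h1 : ContDiffAt ℝ 3 Real.log s := Real.contDiffAt_log.2 hs
      have h2 : ContDiff ℝ 3 fun s : ℝ => Real.smoothTransition (4 * s / ρ ^ 2 - 1) :=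
        (Real.smoothTransition.contDiff (n := 3)).comp (by fun_prop)
      exact contDiffAt_const.add ((h2.contDiffAt.mul (h1.sub contDiffAt_const)).div_const 2)
  · simp only [hg]
    rw [Real.smoothTransition.one_of_one_le]
    · ring
    · rw [le_sub_iff_add_le, le_div_iff₀ hρ2]; linarith
  · simp only [hg]
    have h0 := Real.smoothTransition.nonneg (4 * s / ρ ^ 2 - 1)
    by_cases hs0 : 0 < s
    · have : Real.log s ≤ 2 * Real.log ρ := by
        rw [show 2 * Real.log ρ = Real.log (ρ ^ 2) by rw [Real.log_pow]; push_cast; ring]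
        exact Real.log_le_log hs0 hs
      nlinarith
    · rw [Real.smoothTransition.zero_of_nonpos]
      · simp
      · have : 4 * s / ρ ^ 2 ≤ 0 := div_nonpos_of_nonpos_of_nonneg (by linarith) hρ2.le
        linarith

theorem laplacian_normSq_comp {g : ℝ → ℝ} (hg : ContDiff ℝ 2 g) (c z : ℂ) :
    Laplacian.laplacian (fun w => g (‖w - c‖ ^ 2)) z =
      4 * (deriv g (‖z - c‖ ^ 2) + ‖z - c‖ ^ 2 * deriv (deriv g) (‖z - c‖ ^ 2)) := by
  have hu : ContDiff ℝ 2 fun w : ℂ => ‖w - c‖ ^ 2 := (contDiff_id.sub contDiff_const).norm_sq ℝ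
  have h1 : ∀ w v : ℂ, fderiv ℝ (fun w : ℂ => ‖w - c‖ ^ 2) w v = 2 * inner ℝ (w - c) v := by
    intro w v
    have h2 : HasFDerivAt (fun w : ℂ => ‖w - c‖ ^ 2) _ w :=
      ((hasFDerivAt_id w).sub_const c).norm_sq
    rw [h2.fderiv]
    simp [two_smul, two_mul]
    ring
  have h3 : ∀ v : ℂ, fderiv ℝ (fun w : ℂ => 2 * inner ℝ (w - c) v) z v = 2 * inner ℝ v v := by
    intro v
    have h4 : HasFDerivAt (fun w : ℂ => 2 * inner ℝ (w - c) v) _ z :=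
      (((hasFDerivAt_id z).sub_const c).inner ℝ (hasFDerivAt_const v z)).const_mul (2 : ℝ)
    rw [h4.fderiv]
    simp
  rw [laplacian_comp hg hu.contDiffAt, laplacian_eq_fderiv hu.contDiffAt]
  simp only [h1, h3]
  have e : ‖z - c‖ ^ 2 = (z - c).re ^ 2 + (z - c).im ^ 2 := by
    rw [← Complex.normSq_eq_norm_sq, Complex.normSq_apply]; ring
  rw [e]
  simp only [Complex.inner]
  simp
  ring

/-- The modified logarithm `L` has mass `2π` at the origin. -/
theorem setIntegral_harmonic_mul_laplacian {h g : ℂ → ℝ} {k : ℝ → ℝ} {c : ℂ} {ρ : ℝ} (hρ : 0 < ρ)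
    (hh : HarmonicOnNhd h (closedBall c ρ)) (hk : ContDiff ℝ 3 k)
    (hk' : ∀ s, ρ ^ 2 / 2 ≤ s → k s = Real.log s / 2) (hg : g = fun w => k (‖w - c‖ ^ 2)) :
    ∫ z in closedBall c ρ, h z * Laplacian.laplacian g z = 2 * Real.pi * h c := by
  have hk1 : ContDiff ℝ 2 (deriv k) := hk.deriv' (n := 2)
  have hk2 : ContDiff ℝ 1 (deriv (deriv k)) := hk1.deriv' (n := 1)
  subst hg
  simp only [laplacian_normSq_comp (hk.of_le (by norm_num))]
  rw [setIntegral_harmonic_mul_radial (k := fun s => 4 * (deriv k s + s * deriv (deriv k) s)) hρ hh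
    (by have := hk1.continuous; have := hk2.continuous; fun_prop)]
  -- The radial density has the primitive `2 r² k'(r²)`. The integral therefore depends only on
  -- `k'(ρ²) = 1 / (2ρ²)` and equals `1`, whatever the modification near the centre.
  have hd : ∀ r : ℝ, HasDerivAt (fun r => 2 * (r ^ 2 * deriv k (r ^ 2)))
      (r * (4 * (deriv k (r ^ 2) + r ^ 2 * deriv (deriv k) (r ^ 2)))) r := by
    intro r
    have h1 : HasDerivAt (fun r : ℝ => r ^ 2) (2 * r) r := by simpa using hasDerivAt_pow 2 r
    have h2 : HasDerivAt (deriv k) (deriv (deriv k) (r ^ 2)) (r ^ 2) :=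
      (hk1.differentiable (by norm_num) _).hasDerivAt
    have h3 : HasDerivAt (fun r : ℝ => deriv k (r ^ 2)) _ r := HasDerivAt.comp (h := fun r : ℝ => r ^ 2) r h2 h1
    have h4 : HasDerivAt (fun r => 2 * (r ^ 2 * deriv k (r ^ 2))) _ r := (h1.mul h3).const_mul 2
    convert h4 using 1
    ring
  have hcont : Continuous fun r : ℝ =>
      r * (4 * (deriv k (r ^ 2) + r ^ 2 * deriv (deriv k) (r ^ 2))) := by
    have := hk1.continuous
    have := hk2.continuous
    fun_prop
  rw [intervalIntegral.integral_eq_sub_of_hasDerivAt (fun r _ => hd r)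
    (hcont.intervalIntegrable _ _)]
  have hρ2 : 0 < ρ ^ 2 := by positivity
  have hlog : deriv k (ρ ^ 2) = 1 / (2 * ρ ^ 2) := by
    have : k =ᶠ[𝓝 (ρ ^ 2)] fun s => Real.log s / 2 := by
      filter_upwards [isOpen_Ioi.mem_nhds (show ρ ^ 2 / 2 < ρ ^ 2 by linarith)] with s hs
        using hk' s (le_of_lt hs)
    rw [this.deriv_eq, ((Real.hasDerivAt_log hρ2.ne').div_const 2).deriv]
    field_simp
  rw [hlog]
  field_simp
  simp

/-! ### The weighted quadrature identity. -/

section MeanValue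

variable {Q : ℂ → ℝ} {w₀ : ℂ} {τ : ℝ}

theorem integral_smul_area (f : ℂ → ℝ) (s : Set ℂ) :
    ∫ z in s, f z ∂area = (1 / Real.pi) * ∫ z in s, f z := by
  rw [area, Measure.restrict_smul, integral_smul_measure,
    ENNReal.toReal_ofReal (by positivity), smul_eq_mul]

theorem integrableOn_area {f : ℂ → ℝ} {s : Set ℂ} (h : IntegrableOn f s) :
    IntegrableOn f s area := by
  rw [area, IntegrableOn, Measure.restrict_smul]
  exact Integrable.smul_measure h ENNReal.ofReal_ne_top

theorem integrableOn_harmonic_mul {Ω : Set ℂ} (hΩ : IsOpen Ω) (hb : Bornology.IsBounded Ω)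
    {h k : ℂ → ℝ} {M : ℝ} (hh : HarmonicOnNhd h Ω) (hM : ∀ z ∈ Ω, |h z| ≤ M)
    (hk : Continuous k) : IntegrableOn (fun z => h z * k z) Ω := by
  obtain ⟨B, hB⟩ := hb.isCompact_closure.exists_bound_of_continuousOn hk.continuousOn
  have : IsFiniteMeasure (volume.restrict Ω) := ⟨by simpa using hb.measure_lt_top⟩
  refine Integrable.of_bound (C := M * B) ?_ ?_
  · exact ContinuousOn.aestronglyMeasurable (fun z hz =>
      ((hh z hz).1.continuousAt.mul hk.continuousAt).continuousWithinAt) hΩ.measurableSet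
  · refine (ae_restrict_iff' hΩ.measurableSet).2 (Eventually.of_forall fun z hz => ?_)
    rw [norm_mul]
    exact mul_le_mul (hM z hz) (hB z (subset_closure hz)) (norm_nonneg _)
      ((abs_nonneg _).trans (hM z hz))

theorem continuous_laplacian {Q : ℂ → ℝ} (hQ : ContDiff ℝ 2 Q) :
    Continuous (Laplacian.laplacian Q) :=
  continuous_iff_continuousAt.2 fun _ => ContDiffAt.continuousAt_laplacian hQ.contDiffAt

/-- The weighted quadrature identity on an off-spectral component. -/
theorem setIntegral_harmonic_mul_ddbar (hQ : ContDiff ℝ 2 Q) (hτ : 0 ≤ τ)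
    (hw₀ : w₀ ∈ offSpectral Q w₀ τ) (hb : Bornology.IsBounded (offSpectral Q w₀ τ))
    (hne : (frontier (offSpectral Q w₀ τ)).Nonempty) {h : ℂ → ℝ} {M : ℝ}
    (hh : HarmonicOnNhd h (offSpectral Q w₀ τ)) (hM : ∀ z ∈ offSpectral Q w₀ τ, |h z| ≤ M) :
    ∫ z in offSpectral Q w₀ τ, h z * (2 * ddbar Q z) = Real.pi * (τ * h w₀) := by
  set Ω := offSpectral Q w₀ τ with hΩdef
  have hΩ : IsOpen Ω := isOpen_offSpectral hQ.continuous
  obtain ⟨H, hH, ρ, hρ, hρΩ, hL⟩ := exists_gap hQ hτ hw₀ hb hne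
  obtain ⟨k, hk, hk1, hk2⟩ := exists_log_modification hρ
  set L : ℂ → ℝ := fun w => k (‖w - w₀‖ ^ 2) with hLdef
  have hLc : ContDiff ℝ 2 L :=
    (hk.of_le (by norm_num)).comp ((contDiff_id.sub contDiff_const).norm_sq ℝ)
  have hLlog : ∀ z, ρ ^ 2 / 2 ≤ ‖z - w₀‖ ^ 2 → L z = Real.log ‖z - w₀‖ := fun z hz => by
    simp only [hLdef]
    rw [hk1 _ hz, Real.log_pow]
    push_cast
    ring
  have hρ2 : 0 < ρ ^ 2 := by positivity
  obtain ⟨hpos, ⟨C, hC⟩, hcomp⟩ := hL L hLc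
    (fun z hz => hLlog z (by
      have : ρ ^ 2 ≤ ‖z - w₀‖ ^ 2 := by gcongr
      linarith))
    (fun z hz => hk2 _ (by gcongr))
  set u : ℂ → ℝ := fun w => Q w - τ * L w - H w with hu
  have hlapL : ∀ z, z ∉ closedBall w₀ ρ → Laplacian.laplacian L z = 0 := by
    intro z hz
    have h1 : L =ᶠ[𝓝 z] fun w => Real.log ‖w - w₀‖ := by
      filter_upwards [isClosed_closedBall.isOpen_compl.mem_nhds hz] with w hw
      have hw' : ρ < ‖w - w₀‖ := by simpa [dist_eq_norm] using hw
      have : ρ ^ 2 ≤ ‖w - w₀‖ ^ 2 := by gcongr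
      exact hLlog w (by linarith)
    have hz0 : z ≠ w₀ := by
      rintro rfl
      exact hz (mem_closedBall_self hρ.le)
    rw [(laplacian_congr_nhds h1).self_of_nhds]
    exact (harmonicAt_log_norm_sub hz0).2.self_of_nhds
  have hucd : ∀ z ∈ Ω, ContDiffAt ℝ 2 u z := fun z hz =>
    (hQ.contDiffAt.sub (contDiffAt_const.mul hLc.contDiffAt)).sub (hH z hz).1
  have hulap : ∀ z ∈ Ω, Laplacian.laplacian u z =
      Laplacian.laplacian Q z - τ * Laplacian.laplacian L z := by
    intro z hz
    have e : u = Q - (τ • L) - H := by ext w; simp [hu]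
    have h1 : ContDiffAt ℝ 2 (τ • L) z := hLc.contDiffAt.const_smul τ
    have h2 : ContDiffAt ℝ 2 (Q - τ • L) z := hQ.contDiffAt.sub h1
    rw [e, ContDiffAt.laplacian_sub h2 (hH z hz).1,
      ContDiffAt.laplacian_sub hQ.contDiffAt h1, laplacian_smul τ hLc.contDiffAt,
      (hH z hz).2.self_of_nhds]
    simp
  obtain ⟨B, hB⟩ := hb.isCompact_closure.exists_bound_of_continuousOn
    ((continuous_laplacian hQ).sub (continuous_const.mul (continuous_laplacian hLc)) :
      Continuous fun z => Laplacian.laplacian Q z - τ * Laplacian.laplacian L z).continuousOn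
  -- In the domain `Δu = ΔQ - τ ΔL` because `H` is harmonic, so the orthogonality moves the whole
  -- integral onto `ΔL`.
  have key := setIntegral_mul_laplacian_eq_zero hΩ hb hucd hpos hC hcomp
    (fun z hz => by rw [hulap z hz]; exact hB z (subset_closure hz)) hh hM
  have hi1 := integrableOn_harmonic_mul hΩ hb hh hM (continuous_laplacian hQ)
  have hi2 := integrableOn_harmonic_mul hΩ hb hh hM (continuous_laplacian hLc)
  rw [setIntegral_congr_fun (g := fun z => h z * Laplacian.laplacian Q z -
    τ * (h z * Laplacian.laplacian L z)) hΩ.measurableSet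
    (fun z hz => by simp only [hulap z hz]; ring), integral_sub hi1 (hi2.const_mul τ),
    integral_const_mul] at key
  have hball : ∫ z in Ω, h z * Laplacian.laplacian L z = 2 * Real.pi * h w₀ := by
    rw [← setIntegral_harmonic_mul_laplacian hρ (fun z hz => hh z (hρΩ hz)) hk hk1 hLdef]
    exact setIntegral_eq_of_subset_of_forall_sdiff_eq_zero hΩ.measurableSet hρΩ
      fun z hz => by rw [hlapL z hz.2, mul_zero]
  have e3 : ∀ z, h z * (2 * ddbar Q z) = (1 / 2) * (h z * Laplacian.laplacian Q z) := fun z => by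
    rw [ddbar]; ring
  simp_rw [e3]
  rw [integral_const_mul, ← sub_add_cancel (∫ z in Ω, h z * Laplacian.laplacian Q z)
    (τ * ∫ z in Ω, h z * Laplacian.laplacian L z), key, hball]
  ring

theorem IsAdmissible.root_mem (hQ : IsAdmissible Q w₀ τ) : w₀ ∈ offSpectral Q w₀ τ :=
  mem_connectedComponentIn hQ.notMem_droplet

theorem IsAdmissible.frontier_nonempty (hQ : IsAdmissible Q w₀ τ) :
    (frontier (offSpectral Q w₀ τ)).Nonempty := by
  obtain ⟨γ, -, hγ⟩ := hQ.boundary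
  rw [← hγ.range_eq]
  exact range_nonempty γ

theorem IsAdmissible.setIntegral_eq (hQ : IsAdmissible Q w₀ τ) (hτ : 0 ≤ τ) {h : ℂ → ℝ} {M : ℝ}
    (hh : HarmonicOnNhd h (offSpectral Q w₀ τ)) (hM : ∀ z ∈ offSpectral Q w₀ τ, |h z| ≤ M) :
    ∫ z in offSpectral Q w₀ τ, h z * (2 * ddbar Q z) = Real.pi * (τ * h w₀) :=
  setIntegral_harmonic_mul_ddbar hQ.contDiff hτ hQ.root_mem hQ.isBounded hQ.frontier_nonempty hh hM

theorem continuous_ddbar {Q : ℂ → ℝ} (hQ : ContDiff ℝ 2 Q) : Continuous (ddbar Q) :=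
  continuous_const.mul (continuous_laplacian hQ)

/-- The domains increase with the parameter, so `h` is admissible in the quadrature identities of
both domains, and these are subtracted. -/
theorem weighted_laplacian_growth {τ' : ℝ} (hQ : IsAdmissible Q w₀ τ) (hQ' : IsAdmissible Q w₀ τ')
    (hτ' : 0 ≤ τ') (hlt : τ' < τ) {h : ℂ → ℝ} {M : ℝ}
    (hh : HarmonicOnNhd h (offSpectral Q w₀ τ)) (hM : ∀ z ∈ offSpectral Q w₀ τ, |h z| ≤ M) :
    IntegrableOn (fun z => h z * (2 * ddbar Q z))
      (offSpectral Q w₀ τ \ offSpectral Q w₀ τ') area ∧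
    ∫ z in offSpectral Q w₀ τ \ offSpectral Q w₀ τ', h z * (2 * ddbar Q z) ∂area =
      (τ - τ') * h w₀ := by
  have hsub : offSpectral Q w₀ τ' ⊆ offSpectral Q w₀ τ := offSpectral_mono hlt.le
  have hi : IntegrableOn (fun z => h z * (2 * ddbar Q z)) (offSpectral Q w₀ τ) :=
    integrableOn_harmonic_mul (isOpen_offSpectral hQ.contDiff.continuous) hQ.isBounded hh hM
      (continuous_const.mul (continuous_ddbar hQ.contDiff))
  refine ⟨integrableOn_area (hi.mono_set sdiff_subset), ?_⟩
  rw [integral_smul_area, setIntegral_sdiff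
    (isOpen_offSpectral hQ.contDiff.continuous).measurableSet hi hsub,
    hQ.setIntegral_eq (hτ'.trans hlt.le) hh hM,
    hQ'.setIntegral_eq hτ' (fun z hz => hh z (hsub hz)) (fun z hz => hM z (hsub hz))]
  have := Real.pi_ne_zero
  field_simp

end MeanValue


/-! ### Uniform geometry of a smooth flow of curves. -/

/-- A smooth flow `γ` of regular Jordan curves, with velocity `A = ∂γ/∂τ` and
tangent `D = ∂γ/∂θ`. -/
structure IsRegularFlow (γ A D : ℝ → ℝ → ℂ) (J : Set ℝ) : Prop where
  continuousOn : ContinuousOn (fun p : ℝ × ℝ => γ p.1 p.2) (J ×ˢ univ)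
  continuousOn_velocity : ContinuousOn (fun p : ℝ × ℝ => A p.1 p.2) (J ×ˢ univ)
  convex : Convex ℝ J
  isCompact : IsCompact J
  hasDerivAt : ∀ σ ∈ J, ∀ θ, HasDerivAt (γ σ) (D σ θ) θ
  hasDerivWithinAt : ∀ σ ∈ J, ∀ θ, HasDerivWithinAt (fun s => γ s θ) (A σ θ) J σ
  taylor : ∀ τ ∈ J, ∀ θ₀, ∃ C, ∃ r > 0, 0 ≤ C ∧ ∀ σ ∈ J, ∀ θ, |σ - τ| < r → |θ - θ₀| < r →
    ‖D σ θ - D τ θ₀‖ ≤ C * (|σ - τ| + |θ - θ₀|) ∧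
    ‖γ σ θ - γ τ θ₀ - ((σ - τ) • A τ θ₀ + (θ - θ₀) • D τ θ₀)‖ ≤
      C * (|σ - τ| + |θ - θ₀|) ^ 2
  periodic : ∀ σ ∈ J, Function.Periodic (γ σ) (2 * Real.pi)
  injOn : ∀ σ ∈ J, InjOn (γ σ) (Ico 0 (2 * Real.pi))
  ne_zero : ∀ σ ∈ J, ∀ θ, D σ θ ≠ 0
  velocity_periodic : ∀ σ ∈ J, Function.Periodic (A σ) (2 * Real.pi)

theorem norm_prod_le (x y : ℝ) : ‖((x, y) : ℝ × ℝ)‖ ≤ |x| + |y| := by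
  rw [Prod.norm_mk, Real.norm_eq_abs, Real.norm_eq_abs]
  exact max_le (by linarith [abs_nonneg y]) (by linarith [abs_nonneg x])

/-- Derivatives are taken within the closed strip, which is convex and has unique differentials, so
the end parameters are included. The local Lipschitz bound of the derivative gives the Taylor
estimate by the mean value inequality, and uniqueness of one-sided derivatives gives the periodicity
of the velocity. -/
theorem exists_isRegularFlow {γ : ℝ → ℝ → ℂ} {a b : ℝ} (hab : a < b)
    (hγ : ContDiffOn ℝ ∞ (fun p : ℝ × ℝ => γ p.1 p.2) (Icc a b ×ˢ univ)) {K : ℝ → Set ℂ}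
    (hK : ∀ τ ∈ Icc a b, IsRegularJordanParam (γ τ) (K τ)) :
    ∃ A D, IsRegularFlow γ A D (Icc a b) := by
  set S : Set (ℝ × ℝ) := Icc a b ×ˢ univ with hS
  set F : ℝ × ℝ → ℂ := fun p => γ p.1 p.2 with hF
  have hSc : Convex ℝ S := (convex_Icc a b).prod convex_univ
  have hSu : UniqueDiffOn ℝ S := (uniqueDiffOn_Icc hab).prod uniqueDiffOn_univ
  have hd : ∀ p ∈ S, HasFDerivWithinAt F (fderivWithin ℝ F S p) S p := fun p hp =>
    (hγ.differentiableOn (by simp) p hp).hasFDerivWithinAt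
  have hF' : ContDiffOn ℝ 1 (fderivWithin ℝ F S) S := hγ.fderivWithin hSu (by norm_cast)
  have hmem : ∀ σ ∈ Icc a b, ∀ θ : ℝ, (σ, θ) ∈ S := fun σ hσ θ => ⟨hσ, mem_univ θ⟩
  have hD : ∀ σ ∈ Icc a b, ∀ θ, HasDerivAt (γ σ) (fderivWithin ℝ F S (σ, θ) (0, 1)) θ := by
    intro σ hσ θ
    have h1 : HasDerivWithinAt (fun t : ℝ => (σ, t)) ((0, 1) : ℝ × ℝ) univ θ :=
      ((hasDerivAt_const θ σ).prodMk (hasDerivAt_id θ)).hasDerivWithinAt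
    have h2 := (hd (σ, θ) (hmem σ hσ θ)).comp_hasDerivWithinAt θ h1 fun t _ => hmem σ hσ t
    exact h2.hasDerivAt univ_mem
  have hA : ∀ σ ∈ Icc a b, ∀ θ,
      HasDerivWithinAt (fun s => γ s θ) (fderivWithin ℝ F S (σ, θ) (1, 0)) (Icc a b) σ := by
    intro σ hσ θ
    have h1 : HasDerivWithinAt (fun t : ℝ => (t, θ)) ((1, 0) : ℝ × ℝ) (Icc a b) σ :=
      ((hasDerivAt_id σ).prodMk (hasDerivAt_const σ θ)).hasDerivWithinAt
    exact (hd (σ, θ) (hmem σ hσ θ)).comp_hasDerivWithinAt σ h1 fun t ht => hmem t ht θ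
  refine ⟨fun σ θ => fderivWithin ℝ F S (σ, θ) (1, 0), fun σ θ => fderivWithin ℝ F S (σ, θ) (0, 1),
    hγ.continuousOn, hF'.continuousOn.clm_apply continuousOn_const,
    convex_Icc a b, isCompact_Icc, hD,
    hA, fun τ hτ θ₀ => ?_, fun σ hσ => (hK σ hσ).periodic,
    fun σ hσ => (hK σ hσ).injOn, fun σ hσ θ => ?_, fun σ hσ θ => ?_⟩
  · have hp := hmem τ hτ θ₀
    obtain ⟨C, t, ht, hC⟩ := (hF' _ hp).exists_lipschitzOnWith hSc
    obtain ⟨r, hr, hrt⟩ := mem_nhdsWithin_iff.1 ht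
    refine ⟨C, r, hr, C.2, fun σ hσ θ h1 h2 => ?_⟩
    set p : ℝ × ℝ := (τ, θ₀) with hp_def
    set q : ℝ × ℝ := (σ, θ) with hq_def
    have hqS : q ∈ S := hmem σ hσ θ
    have hqp : dist q p < r := by
      rw [Prod.dist_eq, max_lt_iff]
      exact ⟨h1, h2⟩
    have hle : dist q p ≤ |σ - τ| + |θ - θ₀| := by
      rw [dist_eq_norm]
      exact norm_prod_le _ _
    have hlip : ∀ x ∈ S, dist x p < r →
        ‖fderivWithin ℝ F S x - fderivWithin ℝ F S p‖ ≤ C * dist x p := fun x hx hxr => by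
      rw [← dist_eq_norm]
      exact hC.dist_le_mul x (hrt ⟨hxr, hx⟩) p (hrt ⟨mem_ball_self hr, hp⟩)
    constructor
    · have h3 := (fderivWithin ℝ F S q - fderivWithin ℝ F S p).le_opNorm (0, 1)
      simp only [sub_apply] at h3
      have h4 : ‖((0, 1) : ℝ × ℝ)‖ = 1 := by simp [Prod.norm_mk]
      rw [h4, mul_one] at h3
      calc _ ≤ _ := h3
        _ ≤ C * dist q p := hlip q hqS hqp
        _ ≤ _ := by gcongr
    · have hconv : Convex ℝ (S ∩ closedBall p (dist q p)) := hSc.inter (convex_closedBall _ _)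
      have h3 := Convex.norm_image_sub_le_of_norm_hasFDerivWithin_le'
        (f := F) (f' := fderivWithin ℝ F S) (φ := fderivWithin ℝ F S p) (C := C * dist q p)
        (fun x hx => (hd x hx.1).mono inter_subset_left)
        (fun x hx => (hlip x hx.1 (lt_of_le_of_lt hx.2 hqp)).trans (by
          have : dist x p ≤ dist q p := hx.2
          gcongr)) hconv (x := p) (y := q)
        ⟨hp, mem_closedBall_self dist_nonneg⟩ ⟨hqS, mem_closedBall.2 le_rfl⟩
      have h4 : q - p = (σ - τ) • ((1, 0) : ℝ × ℝ) + (θ - θ₀) • ((0, 1) : ℝ × ℝ) := by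
        simp [hp_def, hq_def]
      have h5 : fderivWithin ℝ F S p (q - p) = (σ - τ) • fderivWithin ℝ F S p (1, 0) +
          (θ - θ₀) • fderivWithin ℝ F S p (0, 1) := by
        rw [h4, map_add, map_smul, map_smul]
      rw [h5] at h3
      refine h3.trans ?_
      rw [← dist_eq_norm, mul_assoc, ← sq]
      gcongr
  · rw [← (hD σ hσ θ).deriv]
    exact (hK σ hσ).deriv_ne_zero θ
  · refine ((uniqueDiffOn_Icc hab) σ hσ).eq_deriv _ (hA σ hσ (θ + 2 * Real.pi))
      ((hA σ hσ θ).congr (fun s hs => ?_) ?_)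
    · exact (hK s hs).periodic θ
    · exact (hK σ hσ).periodic θ

namespace IsRegularFlow

variable {γ A D : ℝ → ℝ → ℂ} {J : Set ℝ} (hF : IsRegularFlow γ A D J) {τ : ℝ} (hτ : τ ∈ J)

include hF

theorem exists_int_add_mem {σ : ℝ} (hσ : σ ∈ J) (c θ : ℝ) :
    ∃ θ' ∈ Ico c (c + 2 * Real.pi), (∃ k : ℤ, θ' = θ - k • (2 * Real.pi)) ∧ γ σ θ' = γ σ θ := by
  obtain ⟨k, hk, -⟩ := existsUnique_sub_zsmul_mem_Ico Real.two_pi_pos θ c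
  exact ⟨_, hk, ⟨k, rfl⟩, (hF.periodic σ hσ).sub_zsmul_eq k⟩

theorem continuous_curve {σ : ℝ} (hσ : σ ∈ J) : Continuous (γ σ) :=
  continuous_iff_continuousAt.2 fun θ => (hF.hasDerivAt σ hσ θ).continuousAt

include hτ

theorem eventually_of_isOpen {V : Set ℂ} (hV : IsOpen V) (h : range (γ τ) ⊆ V) :
    ∀ᶠ σ in 𝓝[J] τ, range (γ σ) ⊆ V := by
  have key : ∀ᶠ σ in 𝓝 τ, ∀ θ ∈ Icc (0 : ℝ) (2 * Real.pi), σ ∈ J → γ σ θ ∈ V := by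
    refine isCompact_Icc.eventually_forall_of_forall_eventually fun θ _ => ?_
    have h1 := (hF.continuousOn (τ, θ) ⟨hτ, mem_univ _⟩).eventually
      (hV.mem_nhds (h (mem_range_self θ)))
    filter_upwards [eventually_nhdsWithin_iff.1 h1] with p hp hpJ using hp ⟨hpJ, mem_univ _⟩
  filter_upwards [nhdsWithin_le_nhds key, self_mem_nhdsWithin] with σ hσ hσJ
  rintro _ ⟨θ, rfl⟩
  obtain ⟨θ', hθ', -, he⟩ := hF.exists_int_add_mem hσJ 0 θ
  rw [zero_add] at hθ'
  rw [← he]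
  exact hσ θ' (Ico_subset_Icc_self hθ') hσJ

theorem eventually_disjoint {K : Set ℂ} (hK : IsCompact K) (h : Disjoint K (range (γ τ))) :
    ∀ᶠ σ in 𝓝[J] τ, Disjoint K (range (γ σ)) := by
  filter_upwards [hF.eventually_of_isOpen hτ hK.isClosed.isOpen_compl
    (subset_compl_iff_disjoint_left.2 h)] with σ hσ
  exact subset_compl_iff_disjoint_left.1 hσ

theorem ne_of_abs_le {θ₀ θ : ℝ} (h0 : θ ≠ θ₀) (hpi : |θ - θ₀| ≤ Real.pi) : γ τ θ ≠ γ τ θ₀ := by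
  intro he
  obtain ⟨x, hx, ⟨k, hk⟩, ex⟩ := hF.exists_int_add_mem hτ 0 θ
  obtain ⟨y, hy, ⟨l, hl⟩, ey⟩ := hF.exists_int_add_mem hτ 0 θ₀
  rw [zero_add] at hx hy
  have hxy : x = y := hF.injOn τ hτ hx hy (by rw [ex, ey, he])
  have h1 : θ - θ₀ = ((k - l : ℤ) : ℝ) * (2 * Real.pi) := by
    rw [hk, hl] at hxy
    push_cast
    simp only [zsmul_eq_mul] at hxy
    linarith
  have hkl : k - l ≠ 0 := by
    intro h
    rw [h] at h1
    apply h0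
    simp at h1
    linarith
  have h2 : (1 : ℝ) ≤ |((k - l : ℤ) : ℝ)| := by exact_mod_cast Int.one_le_abs hkl
  rw [h1, abs_mul, abs_of_pos Real.two_pi_pos] at hpi
  nlinarith [Real.pi_pos]

/-- A point of a nearby curve which is close to `γ τ θ₀` has a parameter close to `θ₀`. -/
theorem exists_near_parameter (θ₀ : ℝ) {ρ : ℝ} (hρ : 0 < ρ) :
    ∃ m > 0, ∀ σ ∈ J, |σ - τ| < m → ∀ θ, ‖γ σ θ - γ τ θ₀‖ < m →
      ∃ θ', |θ' - θ₀| < ρ ∧ γ σ θ' = γ σ θ := by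
  set K : Set ℝ := Icc (θ₀ - Real.pi) (θ₀ + Real.pi) \ ball θ₀ ρ with hK
  have hKc : IsCompact K := isCompact_Icc.diff isOpen_ball
  -- The second coordinate of `p` is a distance tolerance, so one compactness argument over the
  -- parameters away from `θ₀` yields a bound uniform in both.
  have key : ∀ᶠ p in 𝓝 ((τ, 0) : ℝ × ℝ), ∀ θ ∈ K, p.1 ∈ J → p.2 < ‖γ p.1 θ - γ τ θ₀‖ := by
    refine hKc.eventually_forall_of_forall_eventually fun θ hθ => ?_
    have hne : θ ≠ θ₀ := by
      rintro rfl
      exact hθ.2 (mem_ball_self hρ)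
    have hpi : |θ - θ₀| ≤ Real.pi := by
      rw [abs_le]
      constructor <;> linarith [hθ.1.1, hθ.1.2]
    have hpos : 0 < ‖γ τ θ - γ τ θ₀‖ := norm_pos_iff.2 (sub_ne_zero.2 (hF.ne_of_abs_le hτ hne hpi))
    have h1 : ContinuousWithinAt (fun p : ℝ × ℝ => ‖γ p.1 p.2 - γ τ θ₀‖) (J ×ˢ univ) (τ, θ) :=
      ((hF.continuousOn (τ, θ) ⟨hτ, mem_univ _⟩).sub continuousWithinAt_const).norm
    have h2 := eventually_nhdsWithin_iff.1 (h1.eventually (lt_mem_nhds (half_lt_self hpos)))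
    have h3 : Tendsto (fun z : (ℝ × ℝ) × ℝ => (z.1.1, z.2)) (𝓝 ((τ, 0), θ)) (𝓝 (τ, θ)) :=
      (Continuous.tendsto (by fun_prop) _)
    have h4 : ∀ᶠ z : (ℝ × ℝ) × ℝ in 𝓝 ((τ, 0), θ), z.1.2 < ‖γ τ θ - γ τ θ₀‖ / 2 :=
      (Continuous.tendsto (show Continuous fun z : (ℝ × ℝ) × ℝ => z.1.2 by fun_prop) _).eventually
        (gt_mem_nhds (by simpa using hpos))
    filter_upwards [h3.eventually h2, h4] with z hz1 hz2 hzJ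
    exact hz2.trans (hz1 ⟨hzJ, mem_univ _⟩)
  obtain ⟨m, hm, hmK⟩ := Metric.eventually_nhds_iff.1 key
  refine ⟨m / 2, by positivity, fun σ hσ hστ θ hθ => ?_⟩
  obtain ⟨θ', hθ', -, he⟩ := hF.exists_int_add_mem hσ (θ₀ - Real.pi) θ
  refine ⟨θ', ?_, he⟩
  by_contra hcon
  have hmem : θ' ∈ K := ⟨⟨hθ'.1, by linarith [hθ'.2]⟩, hcon⟩
  have := hmK (y := (σ, m / 2)) (by
    rw [Prod.dist_eq, max_lt_iff]
    constructor
    · exact lt_trans hστ (by simpa using hm)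
    · simp only [dist_zero_right, Real.norm_eq_abs, abs_of_pos (half_pos hm)]
      exact half_lt_self hm) θ' hmem hσ
  simp only at this
  rw [he] at this
  linarith

/-- All short chords of nearby curves are almost parallel to one fixed tangent. This is the mean
value inequality for `γ σ θ - θ • D τ θ₀`, whose derivative is small near `(τ, θ₀)`. -/
theorem exists_secant_bound (θ₀ : ℝ) {η : ℝ} (hη : 0 < η) :
    ∃ ρ > 0, ∀ σ ∈ J, |σ - τ| < ρ → ∀ θ₁ θ₂, |θ₁ - θ₀| < ρ → |θ₂ - θ₀| < ρ →
      ‖γ σ θ₁ - γ σ θ₂ - (θ₁ - θ₂) • D τ θ₀‖ ≤ η * |θ₁ - θ₂| := by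
  obtain ⟨C, r, hr, hC0, hC⟩ := hF.taylor τ hτ θ₀
  set ρ := min r (η / (2 * (C + 1))) with hρ
  have hρ0 : 0 < ρ := lt_min hr (by positivity)
  refine ⟨ρ, hρ0, fun σ hσ hστ θ₁ θ₂ h1 h2 => ?_⟩
  have key := Convex.norm_image_sub_le_of_norm_hasDerivWithin_le
    (f := fun θ => γ σ θ - θ • D τ θ₀) (f' := fun θ => D σ θ - D τ θ₀) (s := ball θ₀ ρ) (C := η)
    (fun θ _ => ((hF.hasDerivAt σ hσ θ).sub (by
      simpa using (hasDerivAt_id θ).smul_const (D τ θ₀))).hasDerivWithinAt)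
    (fun θ hθ => by
      have hθ' : |θ - θ₀| < ρ := hθ
      have h3 := (hC σ hσ θ (hστ.trans_le (min_le_left _ _)) (hθ'.trans_le (min_le_left _ _))).1
      refine h3.trans ?_
      have h4 : ρ ≤ η / (2 * (C + 1)) := min_le_right _ _
      calc C * (|σ - τ| + |θ - θ₀|) ≤ C * (ρ + ρ) := by gcongr
        _ ≤ (C + 1) * (η / (2 * (C + 1)) + η / (2 * (C + 1))) := by gcongr; linarith
        _ = η := by field_simp; ring)
    (convex_ball θ₀ ρ) (x := θ₂) (y := θ₁) h2 h1
  rw [Real.norm_eq_abs] at key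
  refine le_of_eq_of_le ?_ key
  congr 1
  rw [sub_smul]
  abel

/-- Nearby curves stay out of thin cones around the normal direction. -/
theorem exists_inner_le {θ₀ : ℝ} {n : ℂ} (hn : ‖n‖ = 1) (hnD : inner ℝ (D τ θ₀) n = 0) {δ : ℝ}
    (hδ : 0 < δ) :
    ∃ ρ > 0, ∀ σ ∈ J, |σ - τ| < ρ → ∀ θ, |θ - θ₀| < ρ → ∀ z ∈ range (γ σ), ‖z - γ σ θ‖ < ρ →
      |inner ℝ (z - γ σ θ) n| ≤ δ * ‖z - γ σ θ‖ := by
  have hD0 : 0 < ‖D τ θ₀‖ := norm_pos_iff.2 (hF.ne_zero τ hτ θ₀)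
  -- A chord over a parameter length `k` has normal part at most `η k` and length at least `(‖D τ
  -- θ₀‖ - η) k`; this `η` makes the ratio equal to `δ`.
  set η := ‖D τ θ₀‖ * δ / (1 + δ) with hη
  have hη0 : 0 < η := by positivity
  obtain ⟨ρ₁, hρ₁, h1⟩ := hF.exists_secant_bound hτ θ₀ hη0
  obtain ⟨m, hm, h2⟩ := hF.exists_near_parameter hτ θ₀ hρ₁
  have hcont := Metric.continuousWithinAt_iff.1 (hF.continuousOn (τ, θ₀) ⟨hτ, mem_univ _⟩) (m / 2)
    (by positivity)
  obtain ⟨ρ₂, hρ₂, h3⟩ := hcont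
  refine ⟨min (min ρ₁ ρ₂) (m / 2), by positivity, fun σ hσ hστ θ hθ z hz hzθ => ?_⟩
  simp only [lt_min_iff] at hστ hθ hzθ
  obtain ⟨θ₂, rfl⟩ := hz
  have h4 : ‖γ σ θ - γ τ θ₀‖ < m / 2 := by
    have := h3 (x := (σ, θ)) ⟨hσ, mem_univ _⟩ (by
      rw [Prod.dist_eq, max_lt_iff]
      exact ⟨hστ.1.2, hθ.1.2⟩)
    simpa [dist_eq_norm] using this
  obtain ⟨θ', hθ', he⟩ := h2 σ hσ (by linarith [hστ.2]) θ₂ (by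
    calc ‖γ σ θ₂ - γ τ θ₀‖ = ‖(γ σ θ₂ - γ σ θ) + (γ σ θ - γ τ θ₀)‖ := by congr 1; abel
      _ ≤ _ := norm_add_le _ _
      _ < m := by linarith [hzθ.2])
  rw [← he]
  have h5 := h1 σ hσ hστ.1.1 θ' θ hθ' hθ.1.1
  set v := γ σ θ' - γ σ θ with hv
  have h6 : |inner ℝ v n| ≤ η * |θ' - θ| := by
    have : inner ℝ v n = inner ℝ (v - (θ' - θ) • D τ θ₀) n := by
      rw [inner_sub_left v, real_inner_smul_left, hnD]; simp
    rw [this]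
    refine (abs_real_inner_le_norm _ _).trans ?_
    rw [hn, mul_one]
    exact h5
  have h7 : (‖D τ θ₀‖ - η) * |θ' - θ| ≤ ‖v‖ := by
    have := norm_sub_norm_le ((θ' - θ) • D τ θ₀) v
    rw [norm_smul, Real.norm_eq_abs, norm_sub_rev _ v] at this
    linarith
  have h8 : δ * (‖D τ θ₀‖ - η) = η := by
    rw [hη]; field_simp; ring
  calc |inner ℝ v n| ≤ η * |θ' - θ| := h6
    _ = δ * ((‖D τ θ₀‖ - η) * |θ' - θ|) := by rw [← mul_assoc, h8]
    _ ≤ δ * ‖v‖ := by gcongr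

end IsRegularFlow


/-! ### Cones, and the side of the curve on which a domain lies. -/

section Cone

/-- The truncated open cone with apex `ζ` and axis `n`. -/
def cone (ζ n : ℂ) (δ ρ : ℝ) : Set ℂ := {z | ‖z - ζ‖ < ρ ∧ δ * ‖z - ζ‖ < inner ℝ (z - ζ) n}

variable {ζ n : ℂ} {δ ρ : ℝ}

theorem cone_mono {ρ' : ℝ} (h : ρ' ≤ ρ) : cone ζ n δ ρ' ⊆ cone ζ n δ ρ :=
  fun _ hz => ⟨hz.1.trans_le h, hz.2⟩

theorem convex_cone (hδ : 0 ≤ δ) : Convex ℝ (cone ζ n δ ρ) := by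
  have h : cone ζ n δ ρ = ball ζ ρ ∩ {z | δ * ‖z - ζ‖ < inner ℝ (z - ζ) n} := by
    ext z
    simp [cone, dist_eq_norm]
  rw [h]
  refine (convex_ball ζ ρ).inter (convex_iff_forall_pos.2 fun x hx y hy s t hs ht hst => ?_)
  simp only [mem_ofPred_eq] at hx hy ⊢
  have e : s • x + t • y - ζ = s • (x - ζ) + t • (y - ζ) := by
    rw [smul_sub, smul_sub, sub_add_sub_comm, ← add_smul, hst, one_smul]
  have h1 := norm_add_le (s • (x - ζ)) (t • (y - ζ))
  rw [norm_smul, norm_smul, Real.norm_of_nonneg hs.le, Real.norm_of_nonneg ht.le] at h1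
  rw [e, inner_add_left, real_inner_smul_left, real_inner_smul_left]
  calc δ * ‖s • (x - ζ) + t • (y - ζ)‖ ≤ δ * (s * ‖x - ζ‖ + t * ‖y - ζ‖) := by gcongr
    _ = s * (δ * ‖x - ζ‖) + t * (δ * ‖y - ζ‖) := by ring
    _ < _ := by gcongr

theorem isOpen_cone : IsOpen (cone ζ n δ ρ) :=
  IsOpen.inter (s := {z : ℂ | ‖z - ζ‖ < ρ}) (t := {z : ℂ | δ * ‖z - ζ‖ < inner ℝ (z - ζ) n})
    (isOpen_lt (by fun_prop) continuous_const) (isOpen_lt (by fun_prop) (by fun_prop))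

/-- Cones with apices within `e` of `c` share the point `c + (ρ/2) n`, which carries membership in a
domain from one cone to the next. The condition `6e < ρ` is `(e + ρ/2)/2 < ρ/2 - e`. -/
theorem add_smul_mem_cone {c : ℂ} {e : ℝ} (hn : ‖n‖ = 1) (hδ : δ ≤ 1 / 2)
    (he : ‖c - ζ‖ ≤ e) (heρ : 6 * e < ρ) : c + (ρ / 2) • n ∈ cone ζ n δ ρ := by
  have he0 : 0 ≤ e := (norm_nonneg _).trans he
  have hρ : 0 < ρ := by linarith
  have h0 : c + (ρ / 2) • n - ζ = (c - ζ) + (ρ / 2) • n := by abel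
  have h1 : ‖c + (ρ / 2) • n - ζ‖ ≤ e + ρ / 2 := by
    rw [h0]
    refine (norm_add_le _ _).trans ?_
    rw [norm_smul, hn, mul_one, Real.norm_of_nonneg (by positivity)]
    linarith
  have h2 : ρ / 2 - e ≤ inner ℝ (c + (ρ / 2) • n - ζ) n := by
    rw [h0, inner_add_left, real_inner_smul_left, real_inner_self_eq_norm_sq, hn]
    have := (abs_le.1 (abs_real_inner_le_norm (c - ζ) n)).1
    rw [hn, mul_one] at this
    linarith
  refine ⟨by linarith, ?_⟩
  calc δ * ‖c + (ρ / 2) • n - ζ‖ ≤ 1 / 2 * (e + ρ / 2) := by gcongr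
    _ < ρ / 2 - e := by linarith
    _ ≤ _ := h2

theorem apex_mem_closure_cone (hn : ‖n‖ = 1) (hδ : δ ≤ 1 / 2) (hρ : 0 < ρ) :
    ζ ∈ closure (cone ζ n δ ρ) := by
  rw [Metric.mem_closure_iff]
  intro ε hε
  have hm : 0 < min ρ ε := lt_min hρ hε
  refine ⟨ζ + (min ρ ε / 2) • n, cone_mono (min_le_left ρ ε)
    (add_smul_mem_cone hn hδ (e := 0) (by simp) (by simpa using hm)), ?_⟩
  rw [dist_self_add_right, norm_smul, hn, mul_one, Real.norm_of_nonneg (by positivity)]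
  linarith [min_le_right ρ ε]

theorem eq_inner_smul_of_orthogonal {T v : ℂ} (hn : ‖n‖ = 1) (hT : T ≠ 0)
    (hTn : inner ℝ T n = 0) (hvT : inner ℝ v T = 0) : v = (inner ℝ v n : ℝ) • n := by
  have h1 : n.re * n.re + n.im * n.im = 1 := by
    have := Complex.normSq_eq_norm_sq n
    rw [hn, Complex.normSq_apply] at this
    linarith
  rw [Complex.inner] at hTn hvT ⊢
  simp only [Complex.mul_re, Complex.conj_re, Complex.conj_im] at hTn hvT ⊢
  have h2 : v.re * n.im - v.im * n.re = 0 := by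
    rcases not_and_or.1 (mt Complex.ext_iff.2 hT) with h | h
    · exact (mul_eq_zero.1 (show T.re * (v.re * n.im - v.im * n.re) = 0 by
        linear_combination n.im * hvT - v.im * hTn)).resolve_left h
    · exact (mul_eq_zero.1 (show T.im * (v.re * n.im - v.im * n.re) = 0 by
        linear_combination v.re * hTn - n.re * hvT)).resolve_left h
  apply Complex.ext
  · simp only [Complex.real_smul, Complex.mul_re, Complex.ofReal_re, Complex.ofReal_im]
    linear_combination n.im * h2 - v.re * h1
  · simp only [Complex.real_smul, Complex.mul_im, Complex.ofReal_re, Complex.ofReal_im]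
    linear_combination -n.re * h2 - v.im * h1

theorem exists_unit_normal {T : ℂ} (hT : T ≠ 0) : ∃ n : ℂ, ‖n‖ = 1 ∧ inner ℝ T n = 0 := by
  refine ⟨(‖T‖⁻¹ : ℝ) • (Complex.I * T), ?_, ?_⟩
  · rw [norm_smul, norm_mul, Complex.norm_I, one_mul, norm_inv, norm_norm,
      inv_mul_cancel₀ (norm_ne_zero_iff.2 hT)]
  · rw [real_inner_smul_right, Complex.inner]
    simp
    right
    ring

end Cone

/-- A path in `O` ties `K` to the root point `q`. A moving boundary that misses the enlarged compact
set then cannot separate `K` from the root. -/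
theorem exists_isCompact_isPreconnected {O K : Set ℂ} (hO : IsOpen O) (hOc : IsPreconnected O)
    {q x : ℂ} (hq : q ∈ O) (hK : IsCompact K) (hKc : IsPreconnected K) (hx : x ∈ K)
    (hKO : K ⊆ O) :
    ∃ K', IsCompact K' ∧ IsPreconnected K' ∧ K' ⊆ O ∧ K ⊆ K' ∧ q ∈ K' := by
  have hj : JoinedIn O x q :=
    (hO.isConnected_iff_isPathConnected.1 ⟨⟨q, hq⟩, hOc⟩).joinedIn x (hKO hx) q hq
  refine ⟨K ∪ range hj.somePath, hK.union (isCompact_range hj.somePath.continuous),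
    hKc.union x hx ⟨0, hj.somePath.source⟩ (isPreconnected_range hj.somePath.continuous),
    union_subset hKO (range_subset_iff.2 hj.somePath_mem), subset_union_left,
    Or.inr ⟨1, hj.somePath.target⟩⟩

namespace IsRegularFlow

variable {γ A D : ℝ → ℝ → ℂ} {J : Set ℝ} (hF : IsRegularFlow γ A D J) {τ : ℝ} (hτ : τ ∈ J)

include hF hτ

theorem exists_disjoint_cones {θ₀ : ℝ} {n : ℂ} (hn : ‖n‖ = 1) (hnD : inner ℝ (D τ θ₀) n = 0)
    {δ : ℝ} (hδ : 0 < δ) :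
    ∃ ρ > 0, ∀ σ ∈ J, |σ - τ| < ρ → ∀ θ, |θ - θ₀| < ρ →
      Disjoint (cone (γ σ θ) n δ ρ) (range (γ σ)) ∧
      Disjoint (cone (γ σ θ) (-n) δ ρ) (range (γ σ)) := by
  obtain ⟨ρ, hρ, h⟩ := hF.exists_inner_le hτ hn hnD hδ
  refine ⟨ρ, hρ, fun σ hσ hστ θ hθ => ⟨?_, ?_⟩⟩ <;> rw [Set.disjoint_left]
  · intro z hz hzr
    have h1 := h σ hσ hστ θ hθ z hzr hz.1
    linarith [hz.2, le_abs_self (inner ℝ (z - γ σ θ) n)]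
  · intro z hz hzr
    have h1 := h σ hσ hστ θ hθ z hzr hz.1
    have h2 := hz.2
    rw [inner_neg_right] at h2
    linarith [neg_le_abs (inner ℝ (z - γ σ θ) n)]

/-- A domain bounded by the curve contains one side of the curve near each boundary point. -/
theorem exists_side {O : Set ℂ} (hO : IsOpen O) (hOr : Disjoint O (range (γ τ)))
    (hfr : frontier O ⊆ range (γ τ)) {θ₀ : ℝ} (hζ : γ τ θ₀ ∈ closure O) {n : ℂ} (hn : ‖n‖ = 1)
    (hnD : inner ℝ (D τ θ₀) n = 0) :
    ∃ ρ > 0, (∀ θ, |θ - θ₀| < ρ → cone (γ τ θ) n (1 / 2) ρ ⊆ O) ∨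
      (∀ θ, |θ - θ₀| < ρ → cone (γ τ θ) (-n) (1 / 2) ρ ⊆ O) := by
  have hD0 : 0 < ‖D τ θ₀‖ := norm_pos_iff.2 (hF.ne_zero τ hτ θ₀)
  obtain ⟨ρ, hρ, hcone⟩ := hF.exists_disjoint_cones hτ hn hnD (δ := 1 / 2) (by norm_num)
  obtain ⟨ρ₁, hρ₁, hcont⟩ := Metric.continuousAt_iff.1
    ((hF.continuous_curve hτ).continuousAt (x := θ₀)) (ρ / 7) (by positivity)
  obtain ⟨ρ₂, hρ₂, hsec⟩ := hF.exists_secant_bound hτ θ₀ (half_pos hD0)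
  set h := min (min ρ ρ₁) ρ₂ / 2 with hh
  have hh0 : 0 < h := by positivity
  have hhρ : h < ρ ∧ h < ρ₁ ∧ h < ρ₂ := by
    have : 0 < min (min ρ ρ₁) ρ₂ := by positivity
    refine ⟨?_, ?_, ?_⟩ <;>
    linarith [min_le_left (min ρ ρ₁) ρ₂, min_le_right (min ρ ρ₁) ρ₂, min_le_left ρ ρ₁,
      min_le_right ρ ρ₁]
  set T := D τ θ₀ with hT
  have hT0 : T ≠ 0 := hF.ne_zero τ hτ θ₀
  -- points close to `γ τ θ₀` are on the normal line of some curve point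
  have hfoot : ∀ z, ‖z - γ τ θ₀‖ < h * ‖T‖ / 2 → ∃ θ, |θ - θ₀| ≤ h ∧ inner ℝ (z - γ τ θ) T = 0 := by
    intro z hz
    have hg : ContinuousOn (fun θ => inner ℝ (γ τ θ - z) T) (Icc (θ₀ - h) (θ₀ + h)) :=
      (((hF.continuous_curve hτ).sub continuous_const).inner continuous_const).continuousOn
    have hval : ∀ s, |s| ≤ h → |inner ℝ (γ τ (θ₀ + s) - γ τ θ₀) T - s * ‖T‖ ^ 2| ≤
        ‖T‖ / 2 * |s| * ‖T‖ := by
      intro s hs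
      have h1 := hsec τ hτ (by simpa using hρ₂) (θ₀ + s) θ₀ (by simpa using hs.trans_lt hhρ.2.2)
        (by simpa using hρ₂)
      rw [add_sub_cancel_left] at h1
      have h2 : inner ℝ (γ τ (θ₀ + s) - γ τ θ₀) T - s * ‖T‖ ^ 2 =
          inner ℝ (γ τ (θ₀ + s) - γ τ θ₀ - s • T) T := by
        rw [inner_sub_left _ (s • T), real_inner_smul_left, real_inner_self_eq_norm_sq]
      rw [h2]
      refine (abs_real_inner_le_norm _ _).trans ?_
      gcongr
    have hz' : |inner ℝ (z - γ τ θ₀) T| ≤ ‖z - γ τ θ₀‖ * ‖T‖ := abs_real_inner_le_norm _ _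
    have hz2 : ‖z - γ τ θ₀‖ * ‖T‖ ≤ h * ‖T‖ / 2 * ‖T‖ := by gcongr
    have hsplit : ∀ θ, inner ℝ (γ τ θ - z) T =
        inner ℝ (γ τ θ - γ τ θ₀) T - inner ℝ (z - γ τ θ₀) T := fun θ => by
      rw [← inner_sub_left]
      congr 1
      abel
    have hlo : inner ℝ (γ τ (θ₀ - h) - z) T ≤ 0 := by
      have h1 := hval (-h) (by rw [abs_neg, abs_of_pos hh0])
      rw [abs_neg, abs_of_pos hh0, ← sub_eq_add_neg] at h1
      rw [hsplit]
      linarith [(abs_le.1 h1).2, (abs_le.1 hz').1]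
    have hhi : 0 ≤ inner ℝ (γ τ (θ₀ + h) - z) T := by
      have h1 := hval h (by rw [abs_of_pos hh0])
      rw [abs_of_pos hh0] at h1
      rw [hsplit]
      linarith [(abs_le.1 h1).1, (abs_le.1 hz').2]
    obtain ⟨θ, hθ, hθ0⟩ := intermediate_value_Icc (by linarith) hg ⟨hlo, hhi⟩
    refine ⟨θ, by rw [abs_le]; constructor <;> linarith [hθ.1, hθ.2], ?_⟩
    rw [← neg_sub, inner_neg_left]
    exact neg_eq_zero.2 hθ0
  -- a cone which meets `O` is contained in `O`
  have hsub : ∀ θ, |θ - θ₀| < ρ → ∀ m, (m = n ∨ m = -n) → (cone (γ τ θ) m (1 / 2) ρ ∩ O).Nonempty →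
      cone (γ τ θ) m (1 / 2) ρ ⊆ O := by
    intro θ hθ m hm hne
    refine subset_of_isPreconnected_of_disjoint_frontier hO
      (convex_cone (by norm_num)).isPreconnected (Disjoint.mono_right hfr ?_) hne
    have := hcone τ hτ (by simpa using hρ) θ hθ
    rcases hm with rfl | rfl
    exacts [this.1, this.2]
  have hbase : ∀ m, ‖m‖ = 1 → ∀ θ, |θ - θ₀| < ρ₁ →
      γ τ θ₀ + (ρ / 2) • m ∈ cone (γ τ θ) m (1 / 2) ρ := by
    intro m hm θ hθ
    refine add_smul_mem_cone hm le_rfl (e := ρ / 7) ?_ (by linarith)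
    rw [norm_sub_rev, ← dist_eq_norm]
    exact (hcont (x := θ) hθ).le
  -- all the cones on one side are in `O` if one of them meets `O`
  have hall : ∀ m, (m = n ∨ m = -n) → ∀ θ, |θ - θ₀| ≤ h →
      (cone (γ τ θ) m (1 / 2) ρ ∩ O).Nonempty →
      ∀ θ', |θ' - θ₀| < h → cone (γ τ θ') m (1 / 2) h ⊆ O := by
    intro m hm θ hθ hne θ' hθ'
    have hm1 : ‖m‖ = 1 := by
      rcases hm with rfl | rfl
      · exact hn
      · rw [norm_neg, hn]
    have h1 : γ τ θ₀ + (ρ / 2) • m ∈ O :=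
      hsub θ (hθ.trans_lt hhρ.1) m hm hne (hbase m hm1 θ (hθ.trans_lt hhρ.2.1))
    exact (cone_mono hhρ.1.le).trans (hsub θ' (hθ'.trans hhρ.1) m hm
      ⟨_, hbase m hm1 θ' (hθ'.trans hhρ.2.1), h1⟩)
  have hr0 : 0 < min (h * ‖T‖ / 2) (ρ / 2) := by positivity
  -- Here `z` lies in `O` on the normal line through a curve point, at a signed height `x` that is
  -- nonzero because `O` misses the curve. The sign of `x` tells which cone meets `O`.
  obtain ⟨z, hzO, hzd⟩ := Metric.mem_closure_iff.1 hζ _ hr0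
  rw [dist_comm, dist_eq_norm, lt_min_iff] at hzd
  obtain ⟨θ, hθ, hθ0⟩ := hfoot z hzd.1
  have hdec := eq_inner_smul_of_orthogonal hn hT0 hnD hθ0
  set x := inner ℝ (z - γ τ θ) n with hx
  have hnorm : ‖z - γ τ θ‖ = |x| := by
    have := congrArg norm hdec
    rwa [norm_smul, hn, mul_one, Real.norm_eq_abs] at this
  have hx0 : x ≠ 0 := by
    intro h0
    rw [h0, zero_smul, sub_eq_zero] at hdec
    exact Set.disjoint_left.1 hOr hzO ⟨θ, hdec.symm⟩
  have hlt : ‖z - γ τ θ‖ < ρ := by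
    have h1 := hcont (x := θ) (hθ.trans_lt hhρ.2.1)
    rw [dist_comm, dist_eq_norm] at h1
    calc ‖z - γ τ θ‖ = ‖(z - γ τ θ₀) + (γ τ θ₀ - γ τ θ)‖ := by congr 1; abel
      _ ≤ _ := norm_add_le _ _
      _ < ρ := by linarith [hzd.2]
  refine ⟨h, hh0, ?_⟩
  rcases lt_or_gt_of_ne hx0 with hneg | hpos
  · right
    refine hall (-n) (Or.inr rfl) θ hθ ⟨z, ⟨hlt, ?_⟩, hzO⟩
    rw [inner_neg_right, hnorm, abs_of_neg hneg]
    linarith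
  · left
    refine hall n (Or.inl rfl) θ hθ ⟨z, ⟨hlt, ?_⟩, hzO⟩
    rw [hnorm, abs_of_pos hpos]
    linarith

end IsRegularFlow

/-! ### Stability of the interior and of the exterior. -/

/-- A smooth flow of domains which contain `w₀` and do not surround `p`. -/
structure IsDomainFlow (γ A D : ℝ → ℝ → ℂ) (J : Set ℝ) (Ω : ℝ → Set ℂ) (w₀ p : ℂ) : Prop
    extends IsRegularFlow γ A D J where
  isOpen : ∀ σ ∈ J, IsOpen (Ω σ)
  isPreconnected : ∀ σ ∈ J, IsPreconnected (Ω σ)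
  range_eq : ∀ σ ∈ J, range (γ σ) = frontier (Ω σ)
  root_mem : ∀ σ ∈ J, w₀ ∈ Ω σ
  notMem_closure : ∀ σ ∈ J, p ∉ closure (Ω σ)

namespace IsDomainFlow

variable {γ A D : ℝ → ℝ → ℂ} {J : Set ℝ} {Ω : ℝ → Set ℂ} {w₀ p : ℂ}
  (hF : IsDomainFlow γ A D J Ω w₀ p) {τ : ℝ} (hτ : τ ∈ J)

include hF hτ

/-- After `K` is joined to `w₀`, nearby boundaries still miss the enlarged set, which contains `w₀`
and therefore lies in the nearby domains. -/
theorem eventually_subset {K : Set ℂ} (hK : IsCompact K) (hKc : IsPreconnected K)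
    (hKΩ : K ⊆ Ω τ) : ∀ᶠ σ in 𝓝[J] τ, K ⊆ Ω σ := by
  rcases K.eq_empty_or_nonempty with rfl | ⟨x, hx⟩
  · simp
  obtain ⟨K', h1, h2, h3, h4, h5⟩ := exists_isCompact_isPreconnected (hF.isOpen τ hτ)
    (hF.isPreconnected τ hτ) (hF.root_mem τ hτ) hK hKc hx hKΩ
  have hd : Disjoint K' (range (γ τ)) := by
    rw [hF.range_eq τ hτ]
    exact (disjoint_frontier_iff_isOpen.2 (hF.isOpen τ hτ)).symm.mono_left h3
  filter_upwards [hF.eventually_disjoint hτ h1 hd, self_mem_nhdsWithin] with σ hσ hσJ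
  rw [hF.range_eq σ hσJ] at hσ
  exact h4.trans (subset_of_isPreconnected_of_disjoint_frontier (hF.isOpen σ hσJ) h2 hσ
    ⟨w₀, h5, hF.root_mem σ hσJ⟩)

/-- Once `K` is joined to `p` in the exterior, a nearby domain that met the enlarged set would
contain it, and `p` with it. -/
theorem eventually_disjoint_closure {K : Set ℂ} (hK : IsCompact K) (hKc : IsPreconnected K)
    (hKX : K ⊆ connectedComponentIn (closure (Ω τ))ᶜ p) :
    ∀ᶠ σ in 𝓝[J] τ, Disjoint K (closure (Ω σ)) := by
  rcases K.eq_empty_or_nonempty with rfl | ⟨x, hx⟩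
  · simp
  obtain ⟨K', h1, h2, h3, h4, h5⟩ := exists_isCompact_isPreconnected
    isClosed_closure.isOpen_compl.connectedComponentIn isPreconnected_connectedComponentIn
    (mem_connectedComponentIn (hF.notMem_closure τ hτ)) hK hKc hx hKX
  have hd : Disjoint K' (range (γ τ)) := by
    rw [hF.range_eq τ hτ]
    exact (disjoint_compl_left.mono_right frontier_subset_closure).mono_left
      (h3.trans (connectedComponentIn_subset _ _))
  filter_upwards [hF.eventually_disjoint hτ h1 hd, self_mem_nhdsWithin] with σ hσ hσJ
  rw [hF.range_eq σ hσJ] at hσ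
  refine Disjoint.mono_left h4 ?_
  rw [closure_eq_self_union_frontier, disjoint_union_right]
  refine ⟨?_, hσ⟩
  by_contra hcon
  exact hF.notMem_closure σ hσJ (subset_closure
    (subset_of_isPreconnected_of_disjoint_frontier (hF.isOpen σ hσJ) h2 hσ
      (not_disjoint_iff_nonempty_inter.1 hcon) h5))

theorem frontier_exterior_subset :
    frontier (connectedComponentIn (closure (Ω τ))ᶜ p) ⊆ range (γ τ) := by
  intro z hz
  have h1 := frontier_connectedComponentIn_subset isClosed_closure.isOpen_compl p hz
  rw [compl_compl] at h1
  rw [hF.range_eq τ hτ]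
  refine ⟨h1, fun hzi => ?_⟩
  rw [(hF.isOpen τ hτ).interior_eq] at hzi
  obtain ⟨x, hx1, hx2⟩ := mem_closure_iff.1 hz.1 _ (hF.isOpen τ hτ) hzi
  exact connectedComponentIn_subset _ _ hx2 (subset_closure hx1)

/-- Each boundary point is accessible from the exterior. -/
theorem mem_closure_exterior (θ : ℝ) :
    γ τ θ ∈ closure (connectedComponentIn (closure (Ω τ))ᶜ p) := by
  set X := connectedComponentIn (closure (Ω τ))ᶜ p with hX
  have hXo : IsOpen X := isClosed_closure.isOpen_compl.connectedComponentIn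
  have hXr : Disjoint X (range (γ τ)) := by
    rw [hF.range_eq τ hτ]
    exact (disjoint_compl_left.mono_right frontier_subset_closure).mono_left
      (connectedComponentIn_subset _ _)
  -- The accessible parameters form a closed set. It is open because the exterior contains all cones
  -- on one side near an accessible point, and nonempty because the exterior contains `p` but not
  -- `w₀`; and the line is connected.
  have hclopen : IsClopen {θ | γ τ θ ∈ closure X} := by
    refine ⟨isClosed_closure.preimage (hF.continuous_curve hτ), ?_⟩
    rw [Metric.isOpen_iff]
    intro θ₀ hθ₀
    obtain ⟨n, hn, hnD⟩ := exists_unit_normal (hF.ne_zero τ hτ θ₀)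
    obtain ⟨ρ, hρ, h⟩ := hF.exists_side hτ hXo hXr (hF.frontier_exterior_subset hτ) hθ₀ hn hnD
    refine ⟨ρ, hρ, fun θ hθ => ?_⟩
    rcases h with h | h
    · exact closure_mono (h θ hθ) (apex_mem_closure_cone hn le_rfl hρ)
    · exact closure_mono (h θ hθ) (apex_mem_closure_cone (by rw [norm_neg, hn])
        le_rfl hρ)
  have hne : {θ | γ τ θ ∈ closure X}.Nonempty := by
    have h1 : (frontier X).Nonempty := by
      rw [nonempty_frontier_iff]
      refine ⟨⟨p, mem_connectedComponentIn (hF.notMem_closure τ hτ)⟩, fun hu => ?_⟩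
      have : w₀ ∈ X := hu ▸ mem_univ w₀
      exact connectedComponentIn_subset _ _ this (subset_closure (hF.root_mem τ hτ))
    obtain ⟨z, hz⟩ := h1
    obtain ⟨θ, rfl⟩ := hF.frontier_exterior_subset hτ hz
    exact ⟨θ, hz.1⟩
  exact eq_univ_iff_forall.1 (hclopen.eq_univ hne) θ

/-- The domain and the exterior each fill one side of the curve near the point. Being disjoint they
fill opposite sides, and the normal is taken to point into the exterior. -/
theorem exists_normal (θ₀ : ℝ) : ∃ n : ℂ, ‖n‖ = 1 ∧ inner ℝ (D τ θ₀) n = 0 ∧ ∃ ρ > 0,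
    cone (γ τ θ₀) (-n) (1 / 2) ρ ⊆ Ω τ ∧
    cone (γ τ θ₀) n (1 / 2) ρ ⊆ connectedComponentIn (closure (Ω τ))ᶜ p := by
  set X := connectedComponentIn (closure (Ω τ))ᶜ p with hX
  have hXΩ : Disjoint X (Ω τ) :=
    (disjoint_compl_left.mono_right subset_closure).mono_left (connectedComponentIn_subset _ _)
  obtain ⟨n, hn, hnD⟩ := exists_unit_normal (hF.ne_zero τ hτ θ₀)
  obtain ⟨ρ₁, hρ₁, h1⟩ := hF.exists_side hτ (hF.isOpen τ hτ) (by
      rw [hF.range_eq τ hτ]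
      exact (disjoint_frontier_iff_isOpen.2 (hF.isOpen τ hτ)).symm)
    (hF.range_eq τ hτ).ge (θ₀ := θ₀)
    (frontier_subset_closure (hF.range_eq τ hτ ▸ mem_range_self θ₀)) hn hnD
  obtain ⟨ρ₂, hρ₂, h2⟩ := hF.exists_side hτ
    (isClosed_closure.isOpen_compl.connectedComponentIn) (by
      rw [hF.range_eq τ hτ]
      exact (disjoint_compl_left.mono_right frontier_subset_closure).mono_left
        (connectedComponentIn_subset _ _))
    (hF.frontier_exterior_subset hτ) (hF.mem_closure_exterior hτ θ₀) hn hnD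
  have hne : ∀ m : ℂ, ‖m‖ = 1 → cone (γ τ θ₀) m (1 / 2) ρ₁ ⊆ Ω τ →
      cone (γ τ θ₀) m (1 / 2) ρ₂ ⊆ X → False := by
    intro m hm hc1 hc2
    have hmem := add_smul_mem_cone (c := γ τ θ₀) (ζ := γ τ θ₀) (ρ := min ρ₁ ρ₂) (e := 0) hm
      (le_refl (1 / 2 : ℝ)) (by simp) (by simpa using ⟨hρ₁, hρ₂⟩)
    exact Set.disjoint_left.1 hXΩ (hc2 (cone_mono (min_le_right _ _) hmem))
      (hc1 (cone_mono (min_le_left _ _) hmem))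
  have hmin : 0 < min ρ₁ ρ₂ := lt_min hρ₁ hρ₂
  have hn' : ‖-n‖ = 1 := by rw [norm_neg, hn]
  rcases h1 with h1 | h1 <;> rcases h2 with h2 | h2
  · exact (hne n hn (h1 θ₀ (by simpa using hρ₁)) (h2 θ₀ (by simpa using hρ₂))).elim
  · refine ⟨-n, hn', by rw [inner_neg_right, hnD, neg_zero], min ρ₁ ρ₂, hmin, ?_,
      (cone_mono (min_le_right _ _)).trans (h2 θ₀ (by simpa using hρ₂))⟩
    rw [neg_neg]
    exact (cone_mono (min_le_left _ _)).trans (h1 θ₀ (by simpa using hρ₁))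
  · exact ⟨n, hn, hnD, min ρ₁ ρ₂, hmin,
      (cone_mono (min_le_left _ _)).trans (h1 θ₀ (by simpa using hρ₁)),
      (cone_mono (min_le_right _ _)).trans (h2 θ₀ (by simpa using hρ₂))⟩
  · exact (hne (-n) hn' (h1 θ₀ (by simpa using hρ₁)) (h2 θ₀ (by simpa using hρ₂))).elim

/-- The uniform cone condition: near a boundary point, all the nearby domains have uniform inner
and outer cones with axes in the normal direction. -/
theorem exists_uniform_cones (θ₀ : ℝ) : ∃ n : ℂ, ‖n‖ = 1 ∧ inner ℝ (D τ θ₀) n = 0 ∧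
    (∃ ρ > 0, cone (γ τ θ₀) n (1 / 2) ρ ⊆ connectedComponentIn (closure (Ω τ))ᶜ p) ∧
    ∀ δ > 0, δ ≤ 1 / 2 → ∃ ρ > 0, ∀ σ ∈ J, |σ - τ| < ρ → ∀ θ, |θ - θ₀| < ρ →
      cone (γ σ θ) (-n) δ ρ ⊆ Ω σ ∧ cone (γ σ θ) n δ ρ ⊆ (closure (Ω σ))ᶜ := by
  obtain ⟨n, hn, hnD, ρ₀, hρ₀, hin, hout⟩ := hF.exists_normal hτ θ₀
  refine ⟨n, hn, hnD, ⟨ρ₀, hρ₀, hout⟩, fun δ hδ hδ2 => ?_⟩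
  have hn' : ‖-n‖ = 1 := by rw [norm_neg, hn]
  obtain ⟨ρ₁, hρ₁, hcone⟩ := hF.exists_disjoint_cones hτ hn hnD hδ
  set ρ := min ρ₀ ρ₁ with hρ
  have hρpos : 0 < ρ := lt_min hρ₀ hρ₁
  have hmem : ∀ m : ℂ, ‖m‖ = 1 → γ τ θ₀ + (ρ / 2) • m ∈ cone (γ τ θ₀) m (1 / 2) ρ₀ :=
    fun m hm => cone_mono (min_le_left _ _)
      (add_smul_mem_cone hm le_rfl (e := 0) (by simp) (by rwa [mul_zero]))
  -- Two base points, one inside and one outside, keep their positions for nearby parameters. Every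
  -- nearby cone avoids its curve and contains the corresponding base point, since its apex has
  -- moved by at most `ρ/7 < ρ/6`, so it lies entirely on that side.
  have hev1 := hF.eventually_subset hτ isCompact_singleton isPreconnected_singleton
    (singleton_subset_iff.2 (hin (hmem (-n) hn')))
  have hev2 := hF.eventually_disjoint_closure hτ isCompact_singleton isPreconnected_singleton
    (singleton_subset_iff.2 (hout (hmem n hn)))
  obtain ⟨ρ₂, hρ₂, hev⟩ := Metric.mem_nhdsWithin_iff.1 (hev1.and hev2)
  obtain ⟨ρ₃, hρ₃, hcont⟩ := Metric.continuousWithinAt_iff.1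
    (hF.continuousOn (τ, θ₀) ⟨hτ, mem_univ _⟩) (ρ / 7) (by positivity)
  refine ⟨min ρ (min ρ₂ ρ₃), by positivity, fun σ hσ hστ θ hθ => ?_⟩
  simp only [lt_min_iff] at hστ hθ
  have hclose : ‖γ τ θ₀ - γ σ θ‖ ≤ ρ / 7 := by
    have h1 := hcont (x := (σ, θ)) ⟨hσ, mem_univ _⟩ (by
      rw [Prod.dist_eq, max_lt_iff]
      exact ⟨hστ.2.2, hθ.2.2⟩)
    rw [norm_sub_rev, ← dist_eq_norm]
    exact h1.le
  have hbase : ∀ m : ℂ, ‖m‖ = 1 → γ τ θ₀ + (ρ / 2) • m ∈ cone (γ σ θ) m δ ρ := fun m hm =>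
    add_smul_mem_cone hm hδ2 hclose (by linarith)
  obtain ⟨hz1, hz2⟩ := hev ⟨hστ.2.1, hσ⟩
  rw [singleton_subset_iff] at hz1
  rw [Set.disjoint_singleton_left] at hz2
  have hρ1 : ρ ≤ ρ₁ := min_le_right _ _
  obtain ⟨hd1, hd2⟩ := hcone σ hσ (hστ.1.trans_le hρ1) θ (hθ.1.trans_le hρ1)
  rw [hF.range_eq σ hσ] at hd1 hd2
  have hmono : ∀ m, cone (γ σ θ) m δ ρ ⊆ cone (γ σ θ) m δ ρ₁ := fun m => cone_mono hρ1
  refine ⟨(cone_mono (min_le_left _ _)).trans (subset_of_isPreconnected_of_disjoint_frontier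
    (hF.isOpen σ hσ) (convex_cone hδ.le).isPreconnected (hd2.mono_left (hmono _))
    ⟨_, hbase (-n) hn', hz1⟩), (cone_mono (min_le_left _ _)).trans ?_⟩
  have hdis : Disjoint (cone (γ σ θ) n δ ρ) (Ω σ) := by
    by_contra hcon
    exact hz2 (subset_closure (subset_of_isPreconnected_of_disjoint_frontier
      (hF.isOpen σ hσ) (convex_cone hδ.le).isPreconnected (hd1.mono_left (hmono _))
      (not_disjoint_iff_nonempty_inter.1 hcon) (hbase n hn)))
  exact subset_compl_iff_disjoint_right.2 (hdis.closure_right isOpen_cone)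

end IsDomainFlow


/-! ### Motion of the boundary along a normal line. -/

theorem norm_normalize_sub_le {x y : ℂ} (hx : x ≠ 0) (hy : y ≠ 0) :
    ‖(‖x‖⁻¹ : ℝ) • x - (‖y‖⁻¹ : ℝ) • y‖ ≤ 2 * ‖x - y‖ / ‖y‖ := by
  have hx' : ‖x‖ ≠ 0 := norm_ne_zero_iff.2 hx
  have hy' : ‖y‖ ≠ 0 := norm_ne_zero_iff.2 hy
  have h1 : (‖x‖⁻¹ : ℝ) • x - (‖y‖⁻¹ : ℝ) • y =
      (‖y‖⁻¹ : ℝ) • (x - y) + (‖x‖⁻¹ - ‖y‖⁻¹ : ℝ) • x := by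
    rw [smul_sub, sub_smul]; abel
  have h2 : ‖(‖x‖⁻¹ - ‖y‖⁻¹ : ℝ) • x‖ ≤ ‖x - y‖ / ‖y‖ := by
    rw [norm_smul, inv_sub_inv hx' hy', Real.norm_eq_abs, abs_div, abs_mul, abs_norm, abs_norm,
      div_mul_eq_mul_div, mul_comm ‖x‖ ‖y‖, mul_div_mul_right _ _ hx']
    gcongr
    rw [abs_sub_comm]
    exact abs_norm_sub_norm_le x y
  rw [h1]
  refine (norm_add_le _ _).trans ?_
  rw [norm_smul, norm_inv, norm_norm]
  calc ‖y‖⁻¹ * ‖x - y‖ + ‖(‖x‖⁻¹ - ‖y‖⁻¹ : ℝ) • x‖ ≤ ‖y‖⁻¹ * ‖x - y‖ + ‖x - y‖ / ‖y‖ := by gcongr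
    _ = 2 * ‖x - y‖ / ‖y‖ := by field_simp; ring

/-- Rotation by a right angle carries unit normals to unit normals. -/
theorem exists_rotated_normal {x y n : ℂ} (hx : x ≠ 0) (hy : y ≠ 0) (hn : ‖n‖ = 1)
    (hxn : inner ℝ x n = 0) :
    ∃ m : ℂ, ‖m‖ = 1 ∧ inner ℝ y m = 0 ∧ ‖m - n‖ ≤ 2 * ‖y - x‖ / ‖x‖ := by
  have hx' : ‖x‖ ≠ 0 := norm_ne_zero_iff.2 hx
  have hy' : ‖y‖ ≠ 0 := norm_ne_zero_iff.2 hy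
  -- This unimodular number turns the direction of `x` into `n`. It is purely imaginary, so it also
  -- turns `y` into a normal of `y`.
  set u : ℂ := (‖x‖ : ℝ) • n / x with hu
  have hu1 : ‖u‖ = 1 := by
    rw [hu, norm_div, norm_smul, norm_norm, hn, mul_one, div_self hx']
  have hnu : n = u * ((‖x‖⁻¹ : ℝ) • x) := by
    rw [hu, mul_smul_comm, div_mul_cancel₀ _ hx, smul_smul, inv_mul_cancel₀ hx', one_smul]
  have hin : ∀ z : ℂ, inner ℝ z (u * z) = ‖z‖ ^ 2 * u.re := by
    intro z
    rw [Complex.inner, ← Complex.normSq_eq_norm_sq, Complex.normSq_apply]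
    simp
    ring
  have hre : u.re = 0 := by
    have h1 : inner ℝ x n = ‖x‖⁻¹ * (‖x‖ ^ 2 * u.re) := by
      conv_lhs => rw [hnu, mul_smul_comm, real_inner_smul_right, hin]
    rw [hxn] at h1
    have h2 : ‖x‖⁻¹ * ‖x‖ ^ 2 ≠ 0 := by positivity
    rw [← mul_assoc] at h1
    exact (mul_eq_zero.1 h1.symm).resolve_left h2
  refine ⟨u * ((‖y‖⁻¹ : ℝ) • y), ?_, ?_, ?_⟩
  · rw [norm_mul, hu1, norm_smul, norm_inv, norm_norm, one_mul, inv_mul_cancel₀ hy']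
  · rw [mul_smul_comm, real_inner_smul_right, hin, hre]
    simp
  · conv_lhs => rw [hnu]
    rw [← mul_sub, norm_mul, hu1, one_mul]
    exact norm_normalize_sub_le hy hx

namespace IsRegularFlow

variable {γ A D : ℝ → ℝ → ℂ} {J : Set ℝ} (hF : IsRegularFlow γ A D J) {τ : ℝ} (hτ : τ ∈ J)

include hF hτ

/-- Control of the parameter of a curve point by the distance to the base point. -/
theorem exists_parameter_bound (θ₀ : ℝ) {ρ : ℝ} (hρ : 0 < ρ) :
    ∃ C, 0 ≤ C ∧ ∃ m > 0, ∀ σ ∈ J, |σ - τ| < m → ∀ z ∈ range (γ σ), ‖z - γ τ θ₀‖ < m →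
      ∃ θ, |θ - θ₀| < ρ ∧ γ σ θ = z ∧ |θ - θ₀| ≤ C * (|σ - τ| + ‖z - γ τ θ₀‖) := by
  obtain ⟨C, r, hr, hC0, hC⟩ := hF.taylor τ hτ θ₀
  have hD0 : 0 < ‖D τ θ₀‖ := norm_pos_iff.2 (hF.ne_zero τ hτ θ₀)
  set d := ‖D τ θ₀‖ with hd
  set e := min (min ρ r) (d / (4 * (C + 1))) with he
  have he0 : 0 < e := by positivity
  obtain ⟨m, hm, h⟩ := hF.exists_near_parameter hτ θ₀ he0
  refine ⟨2 * (‖A τ θ₀‖ + d + 1) / d, by positivity, min m e, by positivity,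
    fun σ hσ hστ z hz hzd => ?_⟩
  obtain ⟨θ₁, rfl⟩ := hz
  rw [lt_min_iff] at hστ hzd
  obtain ⟨θ, hθ, hθe⟩ := h σ hσ hστ.1 θ₁ hzd.1
  have her : e ≤ r := (min_le_left _ _).trans (min_le_right _ _)
  have heρ : e ≤ ρ := (min_le_left _ _).trans (min_le_left _ _)
  have hed : e ≤ d / (4 * (C + 1)) := min_le_right _ _
  refine ⟨θ, hθ.trans_le heρ, hθe, ?_⟩
  have h1 := (hC σ hσ θ (hστ.2.trans_le her) (hθ.trans_le her)).2
  rw [hθe] at h1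
  set v := γ σ θ₁ - γ τ θ₀ with hv
  set s := σ - τ with hs
  set k := θ - θ₀ with hk
  have h2 : |k| * d ≤ ‖v‖ + |s| * ‖A τ θ₀‖ + C * (|s| + |k|) ^ 2 := by
    calc |k| * d = ‖k • D τ θ₀‖ := by rw [norm_smul, Real.norm_eq_abs]
      _ = ‖v - s • A τ θ₀ - (v - (s • A τ θ₀ + k • D τ θ₀))‖ := by congr 1; abel
      _ ≤ ‖v‖ + ‖s • A τ θ₀‖ + ‖v - (s • A τ θ₀ + k • D τ θ₀)‖ :=
        (norm_sub_le _ _).trans (by gcongr; exact norm_sub_le _ _)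
      _ ≤ _ := by rw [norm_smul, Real.norm_eq_abs]; gcongr
  -- For parameters within `e` the quadratic remainder is at most `(d/2)(|s| + |k|)`, and its part
  -- `(d/2)|k|` is absorbed by `|k| d`.
  have h3 : C * (|s| + |k|) ^ 2 ≤ d / 2 * (|s| + |k|) := by
    have : C * (|s| + |k|) ≤ d / 2 := by
      calc C * (|s| + |k|) ≤ (C + 1) * (e + e) := by
            gcongr
            · linarith
            · exact hστ.2.le
        _ ≤ (C + 1) * (d / (4 * (C + 1)) + d / (4 * (C + 1))) := by gcongr
        _ = d / 2 := by field_simp; ring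
    calc C * (|s| + |k|) ^ 2 = C * (|s| + |k|) * (|s| + |k|) := by ring
      _ ≤ _ := by gcongr
  rw [div_mul_eq_mul_div, le_div_iff₀ hD0]
  have hA := norm_nonneg (A τ θ₀)
  have hvn := norm_nonneg v
  have hsn := abs_nonneg s
  nlinarith [mul_nonneg hA hvn, mul_nonneg hD0.le hvn, mul_nonneg hD0.le hsn]

theorem isLittleO_inner {θ : ℝ} {m : ℂ} (hm : ‖m‖ = 1) (hmD : inner ℝ (D τ θ) m = 0) :
    (fun z : ℂ => inner ℝ (z - γ τ θ) m) =o[𝓝[range (γ τ)] (γ τ θ)] fun z => z - γ τ θ := by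
  refine isLittleO_iff.2 fun c hc => ?_
  obtain ⟨ρ, hρ, h⟩ := hF.exists_inner_le hτ hm hmD hc
  filter_upwards [self_mem_nhdsWithin, mem_nhdsWithin_of_mem_nhds (ball_mem_nhds (γ τ θ) hρ)]
    with z hz hzρ
  rw [Real.norm_eq_abs]
  exact h τ hτ (by simpa using hρ) θ (by simpa using hρ) z hz (by simpa [dist_eq_norm] using hzρ)

/-- The nearby curves intersect the normal line. -/
theorem exists_normal_intersection {θ₀ : ℝ} {n : ℂ} (hn : ‖n‖ = 1)
    (hnD : inner ℝ (D τ θ₀) n = 0) :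
    ∃ C, 0 ≤ C ∧ ∃ r > 0, ∀ σ ∈ J, |σ - τ| < r →
      ∃ x : ℝ, γ τ θ₀ + x • n ∈ range (γ σ) ∧
        |x - (σ - τ) * inner ℝ (A τ θ₀) n| ≤ C * |σ - τ| ^ 2 := by
  obtain ⟨C, r, hr, hC0, hC⟩ := hF.taylor τ hτ θ₀
  have hT0 : D τ θ₀ ≠ 0 := hF.ne_zero τ hτ θ₀
  set T := D τ θ₀ with hT
  have hd : 0 < ‖T‖ := norm_pos_iff.2 hT0
  -- With this window, the tangential displacement `K |s| ‖T‖²` equals the largest possible error at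
  -- its ends. The tangential coordinate therefore changes sign across the window and vanishes
  -- inside it.
  set K := (‖A τ θ₀‖ + 1) / ‖T‖ with hK
  have hK0 : 0 < K := by positivity
  refine ⟨C * (1 + K) ^ 2, by positivity, min (r / (1 + K)) (1 / (C * (1 + K) ^ 2 + 1)),
    by positivity, fun σ hσ hστ => ?_⟩
  rw [lt_min_iff, lt_div_iff₀ (by positivity), lt_div_iff₀ (by positivity)] at hστ
  set s := σ - τ with hs
  have hs0 := abs_nonneg s
  have hsr : |s| < r := by nlinarith
  have hKr : K * |s| < r := by nlinarith
  have htay : ∀ k, |k| ≤ K * |s| → ‖γ σ (θ₀ + k) - γ τ θ₀ - (s • A τ θ₀ + k • T)‖ ≤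
      C * (1 + K) ^ 2 * |s| ^ 2 := by
    intro k hk
    have h1 := (hC σ hσ (θ₀ + k) hsr (by rw [add_sub_cancel_left]; exact hk.trans_lt hKr)).2
    rw [add_sub_cancel_left] at h1
    refine h1.trans ?_
    calc C * (|σ - τ| + |k|) ^ 2 ≤ C * (|s| + K * |s|) ^ 2 := by gcongr
      _ = _ := by ring
  have hval : ∀ k, |k| ≤ K * |s| → |inner ℝ (γ σ (θ₀ + k) - γ τ θ₀) T - k * ‖T‖ ^ 2| ≤
      (‖A τ θ₀‖ + 1) * ‖T‖ * |s| := by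
    intro k hk
    have e1 : inner ℝ (γ σ (θ₀ + k) - γ τ θ₀) T - k * ‖T‖ ^ 2 =
        inner ℝ (γ σ (θ₀ + k) - γ τ θ₀ - (s • A τ θ₀ + k • T) + s • A τ θ₀) T := by
      rw [← real_inner_self_eq_norm_sq, ← real_inner_smul_left, ← inner_sub_left]
      congr 1
      abel
    rw [e1]
    refine (abs_real_inner_le_norm _ _).trans ?_
    have e2 : C * (1 + K) ^ 2 * |s| ^ 2 ≤ |s| := by nlinarith
    calc _ ≤ (‖γ σ (θ₀ + k) - γ τ θ₀ - (s • A τ θ₀ + k • T)‖ + ‖s • A τ θ₀‖) * ‖T‖ := by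
          gcongr; exact norm_add_le _ _
      _ ≤ (|s| + |s| * ‖A τ θ₀‖) * ‖T‖ := by
          rw [norm_smul, Real.norm_eq_abs]
          gcongr
          exact (htay k hk).trans e2
      _ = _ := by ring
  have hKT : K * |s| * ‖T‖ ^ 2 = (‖A τ θ₀‖ + 1) * ‖T‖ * |s| := by
    rw [hK]; field_simp
  have hKs : 0 ≤ K * |s| := by positivity
  have hlo : inner ℝ (γ σ (θ₀ + -(K * |s|)) - γ τ θ₀) T ≤ 0 := by
    have h1 := (abs_le.1 (hval (-(K * |s|)) (by rw [abs_neg, abs_of_nonneg hKs]))).2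
    linarith
  have hhi : 0 ≤ inner ℝ (γ σ (θ₀ + K * |s|) - γ τ θ₀) T := by
    have h1 := (abs_le.1 (hval (K * |s|) (by rw [abs_of_nonneg hKs]))).1
    linarith
  have hcont : ContinuousOn (fun k => inner ℝ (γ σ (θ₀ + k) - γ τ θ₀) T)
      (Icc (-(K * |s|)) (K * |s|)) :=
    ((((hF.continuous_curve hσ).comp (continuous_const.add continuous_id)).sub
      continuous_const).inner continuous_const).continuousOn
  obtain ⟨k, hk, hk0⟩ := intermediate_value_Icc (by linarith) hcont ⟨hlo, hhi⟩
  have hdec := eq_inner_smul_of_orthogonal hn hT0 hnD hk0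
  refine ⟨inner ℝ (γ σ (θ₀ + k) - γ τ θ₀) n, ⟨θ₀ + k, ?_⟩, ?_⟩
  · rw [← hdec]; abel
  · have e1 : inner ℝ (γ σ (θ₀ + k) - γ τ θ₀) n - s * inner ℝ (A τ θ₀) n =
        inner ℝ (γ σ (θ₀ + k) - γ τ θ₀ - (s • A τ θ₀ + k • T)) n := by
      rw [inner_sub_left _ (s • A τ θ₀ + k • T), inner_add_left, real_inner_smul_left,
        real_inner_smul_left, hnD]
      ring
    rw [e1]
    refine (abs_real_inner_le_norm _ _).trans ?_
    rw [hn, mul_one]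
    exact htay k (abs_le.2 hk)

end IsRegularFlow

theorem exists_closest_point {A : Set ℂ} (hA : IsClosed A) {ζ v : ℂ} {t : ℝ} (ht : 0 ≤ t)
    (htA : ζ + t • v ∈ A) :
    ∃ t', 0 ≤ t' ∧ t' ≤ t ∧ IsClosestPoint (ray ζ v ∩ A) ζ (ζ + t' • v) := by
  have hc : IsCompact (Icc 0 t ∩ (fun x : ℝ => ζ + x • v) ⁻¹' A) :=
    isCompact_Icc.inter_right (hA.preimage (by fun_prop))
  obtain ⟨t', ⟨ht'1, ht'2⟩, hmin⟩ := hc.exists_isLeast ⟨t, ⟨⟨ht, le_rfl⟩, htA⟩⟩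
  refine ⟨t', ht'1.1, ht'1.2, ⟨⟨t', ht'1.1, rfl⟩, ht'2⟩, ?_⟩
  rintro _ ⟨⟨x, hx, rfl⟩, hxA⟩
  have hle : t' ≤ x := by
    by_cases hxt : x ≤ t
    · exact hmin ⟨⟨hx, hxt⟩, hxA⟩
    · exact ht'1.2.trans (not_le.1 hxt).le
  rw [dist_self_add_right, dist_self_add_right, norm_smul, norm_smul, Real.norm_of_nonneg hx,
    Real.norm_of_nonneg ht'1.1]
  gcongr

namespace IsDomainFlow

variable {γ A D : ℝ → ℝ → ℂ} {J : Set ℝ} {Ω : ℝ → Set ℂ} {w₀ p : ℂ}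
  (hF : IsDomainFlow γ A D J Ω w₀ p) {τ : ℝ} (hτ : τ ∈ J)

include hF

theorem isOuterUnitNormal {σ : ℝ} (hσ : σ ∈ J) {θ ρ : ℝ} {n m : ℂ} (hρ : 0 < ρ) (hn : ‖n‖ = 1)
    (h1 : cone (γ σ θ) (-n) (1 / 2) ρ ⊆ Ω σ) (h2 : cone (γ σ θ) n (1 / 2) ρ ⊆ (closure (Ω σ))ᶜ)
    (hm : ‖m‖ = 1) (hmD : inner ℝ (D σ θ) m = 0) (hmn : ‖m - n‖ < 1 / 2) :
    IsOuterUnitNormal (Ω σ) (γ σ θ) m := by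
  have hin : 1 / 2 < inner ℝ m n := by
    have e : inner ℝ m n = 1 + inner ℝ (m - n) n := by
      rw [inner_sub_left, real_inner_self_eq_norm_sq, hn]; ring
    have := (abs_le.1 (abs_real_inner_le_norm (m - n) n)).1
    rw [hn, mul_one] at this
    linarith
  refine ⟨hm, ?_, ?_, ?_⟩
  · have := hF.isLittleO_inner hσ hm hmD
    rwa [hF.range_eq σ hσ] at this
  · filter_upwards [Ioo_mem_nhdsGT hρ] with t ht
    refine h1 ⟨?_, ?_⟩
    · rw [sub_sub_cancel_left, norm_neg, norm_smul, hm, mul_one, Real.norm_of_nonneg ht.1.le]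
      exact ht.2
    · rw [sub_sub_cancel_left, norm_neg, norm_smul, hm, mul_one, Real.norm_of_nonneg ht.1.le,
        inner_neg_neg, real_inner_smul_left]
      nlinarith [ht.1]
  · filter_upwards [Ioo_mem_nhdsGT hρ] with t ht
    refine h2 ⟨?_, ?_⟩
    · rw [add_sub_cancel_left, norm_smul, hm, mul_one, Real.norm_of_nonneg ht.1.le]
      exact ht.2
    · rw [add_sub_cancel_left, norm_smul, hm, mul_one, Real.norm_of_nonneg ht.1.le,
        real_inner_smul_left]
      nlinarith [ht.1]

include hτ

/-- Motion of the boundary point along the normal, with quantitative bounds. -/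
theorem exists_motion_bound {θ₀ : ℝ} {n : ℂ} (hn : ‖n‖ = 1) (hnD : inner ℝ (D τ θ₀) n = 0)
    (hcone : ∃ ρ > 0, ∀ σ ∈ J, |σ - τ| < ρ → ∀ θ, |θ - θ₀| < ρ →
      cone (γ σ θ) (-n) (1 / 2) ρ ⊆ Ω σ ∧ cone (γ σ θ) n (1 / 2) ρ ⊆ (closure (Ω σ))ᶜ)
    (hV : 0 < inner ℝ (A τ θ₀) n) :
    ∃ C, ∃ r > 0, ∀ σ ∈ J, |σ - τ| < r → ∃ z m : ℂ,
      IsClosestPoint (ray (γ τ θ₀) (Real.sign (τ - σ) • (-n)) ∩ frontier (Ω σ)) (γ τ θ₀) z ∧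
      IsOuterUnitNormal (Ω σ) z m ∧
      ‖z - (γ τ θ₀ + ((σ - τ) * inner ℝ (A τ θ₀) n) • n)‖ ≤ C * |σ - τ| ^ 2 ∧
      ‖m - n‖ ≤ C * |σ - τ| := by
  set V := inner ℝ (A τ θ₀) n with hVdef
  set ζ := γ τ θ₀ with hζ
  have hT0 : D τ θ₀ ≠ 0 := hF.ne_zero τ hτ θ₀
  have hd : 0 < ‖D τ θ₀‖ := norm_pos_iff.2 hT0
  obtain ⟨ρ, hρ, hcone⟩ := hcone
  obtain ⟨C₁, hC₁, r₁, hr₁, h1⟩ := hF.exists_normal_intersection hτ hn hnD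
  obtain ⟨C₂, r₂, hr₂, hC₂, h2⟩ := hF.taylor τ hτ θ₀
  obtain ⟨C₃, hC₃, m₃, hm₃, h3⟩ := hF.exists_parameter_bound hτ θ₀ (lt_min hρ hr₂)
  set E := C₃ * (1 + 2 * V) with hE
  have hE0 : 0 ≤ E := by positivity
  set G := 2 * (C₂ * (1 + E)) / ‖D τ θ₀‖ with hG
  have hG0 : 0 ≤ G := by positivity
  refine ⟨max (C₂ * (1 + E) ^ 2) G, min (min (min ρ r₁) (min r₂ m₃))
    (min (V / (2 * (C₁ + 1))) (min (m₃ / (2 * V)) (1 / (2 * (G + 1))))), by positivity,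
    fun σ hσ hστ => ?_⟩
  simp only [lt_min_iff] at hστ
  obtain ⟨⟨⟨s1, s2⟩, s3, s4⟩, s5, s6, s7⟩ := hστ
  rw [lt_div_iff₀ (by positivity)] at s5 s6 s7
  obtain ⟨x, hxr, hx⟩ := h1 σ hσ s2
  set s := σ - τ with hs
  have hs0 := abs_nonneg s
  have hC₁s : C₁ * |s| ^ 2 ≤ V / 2 * |s| := by nlinarith
  have hxabs : |x| ≤ 2 * V * |s| := by
    calc |x| = |(x - s * V) + s * V| := by rw [sub_add_cancel]
      _ ≤ |x - s * V| + |s * V| := abs_add_le _ _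
      _ ≤ V / 2 * |s| + |s| * V := by
        rw [abs_mul, abs_of_pos hV]
        gcongr
        exact hx.trans hC₁s
      _ ≤ _ := by nlinarith
  -- As `V > 0`, the offset `x` has the sign of `σ - τ` when the error is small. The point is thus
  -- on the prescribed ray, which degenerates to its apex for `σ = τ`.
  have hsign : x • n = |x| • (Real.sign (τ - σ) • (-n)) := by
    have hx2 := abs_le.1 (hx.trans hC₁s)
    rcases lt_trichotomy s 0 with h | h | h
    · rw [abs_of_neg h] at hx2
      rw [Real.sign_of_pos (by linarith), abs_of_neg (by nlinarith)]
      simp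
    · rw [h, abs_zero, mul_zero] at hxabs
      rw [abs_nonpos_iff.1 hxabs]
      simp
    · rw [abs_of_pos h] at hx2
      rw [Real.sign_of_neg (by linarith), abs_of_pos (by nlinarith)]
      simp
  rw [hsign, hF.range_eq σ hσ] at hxr
  -- The closest point need not be the one just found. It is no farther from `ζ`, however, which is
  -- enough to control its parameter and apply Taylor's formula there.
  obtain ⟨t, ht0, htx, hclosest⟩ := exists_closest_point isClosed_frontier (abs_nonneg x) hxr
  set v : ℂ := Real.sign (τ - σ) • (-n) with hv
  obtain ⟨y, hy⟩ : ∃ y : ℝ, t • v = y • n := ⟨-(t * Real.sign (τ - σ)), by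
    rw [hv, smul_neg, smul_neg, smul_smul, neg_smul]⟩
  have hvn : ‖v‖ ≤ 1 := by
    rw [hv, norm_smul, norm_neg, hn, mul_one, Real.norm_eq_abs]
    rcases Real.sign_apply_eq (τ - σ) with h | h | h <;> rw [h] <;> simp
  have hnear : ‖ζ + t • v - ζ‖ ≤ 2 * V * |s| := by
    rw [add_sub_cancel_left, norm_smul, Real.norm_of_nonneg ht0]
    calc t * ‖v‖ ≤ |x| * 1 := by gcongr
      _ ≤ _ := by rw [mul_one]; exact hxabs
  obtain ⟨θ, hθ, hθz, hθb⟩ := h3 σ hσ s4 (ζ + t • v)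
    (hF.range_eq σ hσ ▸ hclosest.1.2) (hnear.trans_lt (by linarith))
  rw [lt_min_iff] at hθ
  have hθE : |θ - θ₀| ≤ E * |s| := by
    refine hθb.trans ?_
    rw [hE, mul_assoc]
    gcongr
    linarith
  obtain ⟨hD, htay⟩ := h2 σ hσ θ s3 hθ.2
  have hDE : ‖D σ θ - D τ θ₀‖ ≤ C₂ * (1 + E) * |s| := by
    refine hD.trans ?_
    rw [mul_assoc, one_add_mul]
    gcongr
  obtain ⟨m, hm1, hmD, hmn⟩ := exists_rotated_normal hT0 (hF.ne_zero σ hσ θ) hn hnD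
  have hmG : ‖m - n‖ ≤ G * |s| := by
    refine hmn.trans ?_
    rw [hG, div_mul_eq_mul_div, mul_assoc]
    gcongr
  have hm2 : ‖m - n‖ < 1 / 2 := by nlinarith
  obtain ⟨hc1, hc2⟩ := hcone σ hσ s1 θ hθ.1
  refine ⟨ζ + t • v, m, hclosest, ?_, ?_, ?_⟩
  · rw [← hθz]
    exact hF.isOuterUnitNormal hσ hρ hn hc1 hc2 hm1 hmD hm2
  · rw [hθz, hy, add_sub_cancel_left] at htay
    have e1 : ζ + t • v - (ζ + (s * V) • n) = (y - s * V) • n := by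
      rw [hy, sub_smul]; abel
    -- The inner product with `n` removes the tangential term, so the unknown parameter enters only
    -- through the quadratic remainder.
    have e2 : y - s * V = inner ℝ (y • n - (s • A τ θ₀ + (θ - θ₀) • D τ θ₀)) n := by
      rw [inner_sub_left, inner_add_left, real_inner_smul_left, real_inner_smul_left,
        real_inner_smul_left, hnD, real_inner_self_eq_norm_sq, hn, ← hVdef]
      ring
    rw [e1, norm_smul, hn, mul_one, Real.norm_eq_abs, e2]
    refine (abs_real_inner_le_norm _ _).trans ?_
    rw [hn, mul_one]
    refine htay.trans ?_
    calc C₂ * (|s| + |θ - θ₀|) ^ 2 ≤ C₂ * (|s| + E * |s|) ^ 2 := by gcongr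
      _ = C₂ * (1 + E) ^ 2 * |s| ^ 2 := by ring
      _ ≤ _ := by gcongr; exact le_max_left _ _
  · exact hmG.trans (by gcongr; exact le_max_right _ _)

/-- Motion of the boundary point along the normal. -/
theorem exists_motion {θ₀ : ℝ} {n : ℂ} (hn : ‖n‖ = 1) (hnD : inner ℝ (D τ θ₀) n = 0)
    (hcone : ∃ ρ > 0, ∀ σ ∈ J, |σ - τ| < ρ → ∀ θ, |θ - θ₀| < ρ →
      cone (γ σ θ) (-n) (1 / 2) ρ ⊆ Ω σ ∧ cone (γ σ θ) n (1 / 2) ρ ⊆ (closure (Ω σ))ᶜ)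
    (hV : 0 < inner ℝ (A τ θ₀) n) :
    ∃ ζ' n' : ℝ → ℂ,
      (∀ᶠ ε : ℝ in 𝓝[{ε | τ - ε ∈ J}] 0,
        IsClosestPoint (ray (γ τ θ₀) (Real.sign ε • (-n)) ∩ frontier (Ω (τ - ε))) (γ τ θ₀) (ζ' ε) ∧
        IsOuterUnitNormal (Ω (τ - ε)) (ζ' ε) (n' ε)) ∧
      (fun ε : ℝ => ζ' ε - (γ τ θ₀ + (ε * inner ℝ (A τ θ₀) n) • (-n)))
        =O[𝓝[{ε | τ - ε ∈ J}] 0] (fun ε : ℝ => ε ^ 2) ∧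
      (fun ε : ℝ => n' ε - n) =O[𝓝[{ε | τ - ε ∈ J}] 0] (fun ε : ℝ => ε) := by
  obtain ⟨C, r, hr, h⟩ := hF.exists_motion_bound hτ hn hnD hcone hV
  have hev : ∀ᶠ ε : ℝ in 𝓝[{ε | τ - ε ∈ J}] 0, ∃ q : ℂ × ℂ,
      (IsClosestPoint (ray (γ τ θ₀) (Real.sign ε • (-n)) ∩ frontier (Ω (τ - ε))) (γ τ θ₀) q.1 ∧
      IsOuterUnitNormal (Ω (τ - ε)) q.1 q.2) ∧
      ‖q.1 - (γ τ θ₀ + (ε * inner ℝ (A τ θ₀) n) • (-n))‖ ≤ C * |ε| ^ 2 ∧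
      ‖q.2 - n‖ ≤ C * |ε| := by
    filter_upwards [self_mem_nhdsWithin, mem_nhdsWithin_of_mem_nhds (ball_mem_nhds (0 : ℝ) hr)]
      with ε hε hεr
    have habs : |τ - ε - τ| = |ε| := by rw [sub_sub_cancel_left, abs_neg]
    obtain ⟨z, m, h1, h2, h3, h4⟩ := h (τ - ε) hε (by rw [habs]; simpa using hεr)
    rw [habs] at h3 h4
    rw [sub_sub_cancel] at h1
    refine ⟨(z, m), ⟨h1, h2⟩, ?_, h4⟩
    have e : (ε * inner ℝ (A τ θ₀) n) • (-n) = ((τ - ε - τ) * inner ℝ (A τ θ₀) n) • n := by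
      rw [sub_sub_cancel_left, smul_neg, ← neg_smul, neg_mul]
    rw [e]
    exact h3
  have hbot : (𝓝[{ε | τ - ε ∈ J}] (0 : ℝ)).NeBot :=
    mem_closure_iff_nhdsWithin_neBot.1 (subset_closure (by simpa using hτ))
  obtain ⟨q, hq⟩ := hev.choice
  refine ⟨fun ε => (q ε).1, fun ε => (q ε).2, hq.mono fun ε h => h.1, ?_, ?_⟩
  · refine IsBigO.of_bound C (hq.mono fun ε h => ?_)
    rw [norm_pow, Real.norm_eq_abs]
    exact h.2.1
  · refine IsBigO.of_bound C (hq.mono fun ε h => ?_)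
    rw [Real.norm_eq_abs]
    exact h.2.2

end IsDomainFlow


/-! ### Injective holomorphic maps and conformal charts. -/

section Holomorphic

variable {f : ℂ → ℂ} {U : Set ℂ}

theorem nhds_le_map_nhds_of_injOn (hU : IsOpen U) (hf : DifferentiableOn ℂ f U) (hi : InjOn f U)
    {z : ℂ} (hz : z ∈ U) : 𝓝 (f z) ≤ map f (𝓝 z) := by
  refine (hf.analyticAt (hU.mem_nhds hz)).eventually_constant_or_nhds_le_map_nhds.resolve_left
    fun h => ?_
  have h1 : ∀ᶠ w in 𝓝[≠] z, f w = f z ∧ w ∈ U := nhdsWithin_le_nhds (h.and (hU.mem_nhds hz))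
  obtain ⟨w, ⟨hw, hwU⟩, hne⟩ := (h1.and self_mem_nhdsWithin).exists
  exact hne (hi hwU hz hw)

theorem isOpen_image_of_injOn (hU : IsOpen U) (hf : DifferentiableOn ℂ f U) (hi : InjOn f U)
    {V : Set ℂ} (hV : IsOpen V) (hVU : V ⊆ U) : IsOpen (f '' V) := by
  refine isOpen_iff_mem_nhds.2 ?_
  rintro _ ⟨z, hz, rfl⟩
  exact nhds_le_map_nhds_of_injOn hU hf hi (hVU hz) (image_mem_map (hV.mem_nhds hz))

theorem continuousAt_of_leftInvOn (hU : IsOpen U) (hf : DifferentiableOn ℂ f U) (hi : InjOn f U)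
    {g : ℂ → ℂ} (hg : ∀ z ∈ U, g (f z) = z) {z : ℂ} (hz : z ∈ U) : ContinuousAt g (f z) := by
  intro N hN
  rw [hg z hz] at hN
  have h1 := nhds_le_map_nhds_of_injOn hU hf hi hz
    (image_mem_map (inter_mem hN (hU.mem_nhds hz)))
  refine mem_map.2 (mem_of_superset h1 ?_)
  rintro _ ⟨w, hw, rfl⟩
  rw [mem_preimage, hg w hw.2]
  exact hw.1

/-- The derivative of an injective holomorphic function has no zeros. -/
theorem deriv_ne_zero_of_injOn (hU : IsOpen U) (hf : DifferentiableOn ℂ f U) (hi : InjOn f U)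
    {z : ℂ} (hz : z ∈ U) : deriv f z ≠ 0 := by
  set g := Function.invFunOn f U with hg
  have hgf : ∀ w ∈ U, g (f w) = w := fun w hw => hi.leftInvOn_invFunOn hw
  have hd : ∀ w ∈ U, HasDerivAt f (deriv f w) w := fun w hw =>
    (hf.differentiableAt (hU.mem_nhds hw)).hasDerivAt
  have han : AnalyticAt ℂ (deriv f) z := (hf.analyticAt (hU.mem_nhds hz)).deriv
  obtain ⟨r, hr, hrU⟩ := Metric.isOpen_iff.1 hU z hz
  rcases han.eventually_eq_zero_or_eventually_ne_zero with h0 | h0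
  · exfalso
    obtain ⟨r', hr', h0'⟩ := Metric.eventually_nhds_iff_ball.1 h0
    have hm : 0 < min r r' := lt_min hr hr'
    have hconst : ∀ w ∈ ball z (min r r'), w = z := fun w hw => by
      have h1 := (convex_ball z (min r r')).norm_image_sub_le_of_norm_deriv_le (f := f) (C := 0)
        (fun x hx => (hd x (hrU (ball_subset_ball (min_le_left _ _) hx))).differentiableAt)
        (fun x hx => by rw [h0' x (ball_subset_ball (min_le_right _ _) hx), norm_zero])
        (mem_ball_self hm) hw
      rw [zero_mul, norm_le_zero_iff, sub_eq_zero] at h1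
      exact hi (hrU (ball_subset_ball (min_le_left _ _) hw)) hz h1
    have h2 := hconst (z + ((min r r' / 2 : ℝ) : ℂ)) (by
      rw [mem_ball, dist_self_add_left, Complex.norm_real, Real.norm_of_nonneg (by positivity)]
      linarith)
    rw [add_eq_left, Complex.ofReal_eq_zero] at h2
    linarith
  · obtain ⟨r', hr', h0'⟩ := Metric.mem_nhdsWithin_iff.1 h0
    set B := ball z (min r r') with hB
    have hm : 0 < min r r' := lt_min hr hr'
    have hBU : B ⊆ U := (ball_subset_ball (min_le_left _ _)).trans hrU
    have hop : ∀ w ∈ U, ∀ᶠ y in 𝓝 (f w), f (g y) = y := fun w hw => by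
      filter_upwards [(isOpen_image_of_injOn hU hf hi hU le_rfl).mem_nhds ⟨w, hw, rfl⟩]
      rintro _ ⟨x, hx, rfl⟩
      rw [hgf x hx]
    -- The inverse is holomorphic wherever `f'` does not vanish, and it is continuous at the
    -- remaining point, which is thus removable. The chain rule for `g ∘ f` then excludes a zero of
    -- `f'`.
    have hgd : DifferentiableOn ℂ g (f '' B) := by
      refine (Complex.differentiableOn_compl_singleton_and_continuousAt_iff (c := f z)
        ((isOpen_image_of_injOn hU hf hi isOpen_ball hBU).mem_nhds
          ⟨z, mem_ball_self hm, rfl⟩)).1 ⟨?_, continuousAt_of_leftInvOn hU hf hi hgf hz⟩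
      rintro _ ⟨⟨w, hw, rfl⟩, hne⟩
      have hwz : w ≠ z := by
        rintro rfl
        exact hne rfl
      have hne' : deriv f w ≠ 0 := h0' ⟨ball_subset_ball (min_le_right _ _) hw, hwz⟩
      have h3 : HasDerivAt f (deriv f w) (g (f w)) := by
        rw [hgf w (hBU hw)]
        exact hd w (hBU hw)
      exact (HasDerivAt.of_local_left_inverse (continuousAt_of_leftInvOn hU hf hi hgf (hBU hw))
        h3 hne' (hop w (hBU hw))).differentiableAt.differentiableWithinAt
    have hgz : HasDerivAt g (deriv g (f z)) (f z) :=
      (hgd.differentiableAt ((isOpen_image_of_injOn hU hf hi isOpen_ball hBU).mem_nhds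
        ⟨z, mem_ball_self hm, rfl⟩)).hasDerivAt
    have hcomp : HasDerivAt (g ∘ f) (deriv g (f z) * deriv f z) z := hgz.comp z (hd z hz)
    have hid : HasDerivAt (g ∘ f) 1 z := (hasDerivAt_id z).congr_of_eventuallyEq (by
      filter_upwards [hU.mem_nhds hz] with w hw using hgf w hw)
    intro h0
    have := hcomp.unique hid
    rw [h0, mul_zero] at this
    exact zero_ne_one this

theorem hasDerivAt_of_leftInvOn (hU : IsOpen U) (hf : DifferentiableOn ℂ f U) (hi : InjOn f U)
    {g : ℂ → ℂ} (hg : ∀ z ∈ U, g (f z) = z) {z : ℂ} (hz : z ∈ U) :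
    HasDerivAt g (deriv f z)⁻¹ (f z) := by
  refine HasDerivAt.of_local_left_inverse (f := f) (continuousAt_of_leftInvOn hU hf hi hg hz) ?_
    (deriv_ne_zero_of_injOn hU hf hi hz) ?_
  · rw [hg z hz]
    exact (hf.differentiableAt (hU.mem_nhds hz)).hasDerivAt
  · filter_upwards [(isOpen_image_of_injOn hU hf hi hU le_rfl).mem_nhds ⟨z, hz, rfl⟩]
    rintro _ ⟨x, hx, rfl⟩
    rw [hg x hx]

/-- Holomorphic change of variables in area integrals. -/
theorem setIntegral_image_eq (hU : IsOpen U) (hf : DifferentiableOn ℂ f U) (hi : InjOn f U)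
    {s : Set ℂ} (hs : MeasurableSet s) (hsU : s ⊆ U) (g : ℂ → ℝ) :
    ∫ w in f '' s, g w = ∫ z in s, ‖deriv f z‖ ^ 2 * g (f z) := by
  have hd : ∀ z ∈ s, HasFDerivWithinAt f
      ((ContinuousLinearMap.toSpanSingleton ℂ (deriv f z)).restrictScalars ℝ) s z := fun z hz =>
    ((hf.differentiableAt (hU.mem_nhds (hsU hz))).hasDerivAt.hasFDerivAt.restrictScalars
      ℝ).hasFDerivWithinAt
  rw [integral_image_eq_integral_abs_det_fderiv_smul volume hs hd (hi.mono hsU)]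
  refine setIntegral_congr_fun hs fun z _ => ?_
  have hdet : ((ContinuousLinearMap.toSpanSingleton ℂ (deriv f z)).restrictScalars ℝ).det =
      ‖deriv f z‖ ^ 2 := by
    simp [ContinuousLinearMap.det, LinearMap.det_restrictScalars, Algebra.norm_complex_eq,
      Complex.normSq_eq_norm_sq]
  simp only [hdet, smul_eq_mul, abs_of_nonneg (sq_nonneg ‖deriv f z‖)]

end Holomorphic

/-- `φ`, with inverse `ψ`, maps a neighborhood `U` of the closure of `Ω` conformally onto an open
set which contains the closed disk of radius `1 + η`, and it maps `Ω` onto the unit disk. -/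
structure IsConformalChart (Ω U : Set ℂ) (φ ψ : ℂ → ℂ) (η : ℝ) : Prop where
  isOpen : IsOpen U
  closure_subset : closure Ω ⊆ U
  differentiableOn : DifferentiableOn ℂ φ U
  injOn : InjOn φ U
  left_inv : ∀ z ∈ U, ψ (φ z) = z
  pos : 0 < η
  closedBall_subset : closedBall 0 (1 + η) ⊆ φ '' U
  norm_lt_iff : ∀ z ∈ U, ‖φ z‖ < 1 ↔ z ∈ Ω
  norm_eq : ∀ z ∈ frontier Ω, ‖φ z‖ = 1
  norm_gt : ∀ z ∈ U, z ∉ closure Ω → 1 < ‖φ z‖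

/-- The image of the compact closure of `Ω` contains the closed disk. The image of `U` is open, so
it contains a slightly larger one, and injectivity sends the points off the closure of `Ω` outside
the unit disk. -/
theorem IsRiemannMap.exists_chart {Ω : Set ℂ} {w₀ : ℂ} {φ : ℂ → ℂ} (h : IsRiemannMap Ω w₀ φ)
    (hΩ : IsOpen Ω) (hb : Bornology.IsBounded Ω) :
    ∃ U ψ η, IsConformalChart Ω U φ ψ η := by
  obtain ⟨U, hU, hcl, hd, hi⟩ := h.conformal
  have hcont : ContinuousOn φ U := hd.continuousOn
  have hΩU : Ω ⊆ U := subset_closure.trans hcl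
  have hlt : ∀ z ∈ U, ‖φ z‖ < 1 ↔ z ∈ Ω := by
    intro z hz
    constructor
    · intro hlt
      obtain ⟨z', hz', he⟩ := h.bijOn.surjOn (mem_ball_zero_iff.2 hlt)
      rwa [← hi (hΩU hz') hz he]
    · intro hzΩ
      simpa using h.bijOn.mapsTo hzΩ
  have hcb : closedBall (0 : ℂ) 1 ⊆ φ '' closure Ω := by
    rw [← closure_ball (0 : ℂ) one_ne_zero, ← h.bijOn.image_eq]
    exact closure_minimal (image_mono subset_closure)
      (hb.isCompact_closure.image_of_continuousOn (hcont.mono hcl)).isClosed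
  have hle : ∀ z ∈ closure Ω, ‖φ z‖ ≤ 1 := by
    intro z hz
    have h1 : φ z ∈ closure (φ '' Ω) := by
      have := ((hcont z (hcl hz)).mono hΩU).mem_closure_image hz
      exact this
    rw [h.bijOn.image_eq, closure_ball (0 : ℂ) one_ne_zero] at h1
    simpa using h1
  obtain ⟨η, hη, hηU⟩ := (isCompact_closedBall (0 : ℂ) 1).exists_cthickening_subset_open
    (isOpen_image_of_injOn hU hd hi hU le_rfl) (hcb.trans (image_mono hcl))
  refine ⟨U, Function.invFunOn φ U, η, hU, hcl, hd, hi, fun z hz => hi.leftInvOn_invFunOn hz, hη,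
    ?_, hlt, ?_, ?_⟩
  · refine subset_trans (fun w hw => ?_) hηU
    rw [cthickening_closedBall hη.le zero_le_one, add_comm η]
    exact hw
  · intro z hz
    refine le_antisymm (hle z hz.1) (not_lt.1 fun hcon => ?_)
    have := (hlt z (hcl hz.1)).1 hcon
    rw [← hΩ.interior_eq] at this
    exact hz.2 this
  · intro z hz hzc
    by_contra hcon
    obtain ⟨z', hz', he⟩ := hcb (mem_closedBall_zero_iff.2 (not_lt.1 hcon))
    exact hzc (hi (hcl hz') hz he ▸ hz')

namespace IsConformalChart

variable {Ω U : Set ℂ} {φ ψ : ℂ → ℂ} {η : ℝ} (hφ : IsConformalChart Ω U φ ψ η)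

include hφ

theorem right_inv {w : ℂ} (hw : ‖w‖ ≤ 1 + η) : φ (ψ w) = w ∧ ψ w ∈ U := by
  obtain ⟨z, hz, rfl⟩ := hφ.closedBall_subset (mem_closedBall_zero_iff.2 hw)
  rw [hφ.left_inv z hz]
  exact ⟨rfl, hz⟩

theorem continuousOn_inv : ContinuousOn ψ (closedBall 0 (1 + η)) := by
  intro w hw
  obtain ⟨z, hz, rfl⟩ := hφ.closedBall_subset hw
  exact (continuousAt_of_leftInvOn hφ.isOpen hφ.differentiableOn hφ.injOn hφ.left_inv
    hz).continuousWithinAt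

theorem deriv_ne_zero {z : ℂ} (hz : z ∈ U) : deriv φ z ≠ 0 :=
  deriv_ne_zero_of_injOn hφ.isOpen hφ.differentiableOn hφ.injOn hz

theorem hasDerivAt {z : ℂ} (hz : z ∈ U) : HasDerivAt φ (deriv φ z) z :=
  (hφ.differentiableOn.differentiableAt (hφ.isOpen.mem_nhds hz)).hasDerivAt

theorem continuousOn_deriv : ContinuousOn (deriv φ) U :=
  (hφ.differentiableOn.deriv hφ.isOpen).continuousOn

theorem frontier_subset : frontier Ω ⊆ U := frontier_subset_closure.trans hφ.closure_subset

end IsConformalChart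


/-! ### The flow in conformal coordinates. -/

/-- The hypothesis is the relation `φ · conj φ' = |φ'| n` at a boundary point. It converts the
radial velocity of the image in the disk into `|φ'|` times the normal velocity. -/
theorem inner_mul_eq_of_mul_conj_eq {w d a n : ℂ}
    (h : w * (starRingEnd ℂ) d = (‖d‖ : ℝ) • n) :
    inner ℝ w (d * a) = inner ℝ a n * ‖d‖ := by
  rw [mul_comm (inner ℝ a n), ← real_inner_smul_right, ← h, real_inner_comm, Complex.inner,
    Complex.inner]
  congr 1
  rw [map_mul]
  ring

namespace IsDomainFlow

variable {γ A D : ℝ → ℝ → ℂ} {J : Set ℝ} {Ω : ℝ → Set ℂ} {w₀ p : ℂ}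
  (hF : IsDomainFlow γ A D J Ω w₀ p) {τ : ℝ} (hτ : τ ∈ J)
  {U : Set ℂ} {φ ψ : ℂ → ℂ} {η : ℝ} (hφ : IsConformalChart (Ω τ) U φ ψ η)

include hF hτ

/-- First order description of the nearby domains near a boundary point. -/
theorem exists_first_order {θ₀ : ℝ} {n : ℂ} (hn : ‖n‖ = 1)
    (hcone : ∀ δ > 0, δ ≤ 1 / 2 → ∃ ρ > 0, ∀ σ ∈ J, |σ - τ| < ρ → ∀ θ, |θ - θ₀| < ρ →
      cone (γ σ θ) (-n) δ ρ ⊆ Ω σ ∧ cone (γ σ θ) n δ ρ ⊆ (closure (Ω σ))ᶜ)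
    {δ : ℝ} (hδ : 0 < δ) :
    ∃ ρ > 0, ∀ σ ∈ J, |σ - τ| < ρ → ∀ z, ‖z - γ τ θ₀‖ < ρ →
      (inner ℝ (z - γ τ θ₀) n < (σ - τ) * inner ℝ (A τ θ₀) n -
          δ * (|σ - τ| + ‖z - γ τ θ₀‖) → z ∈ Ω σ) ∧
      ((σ - τ) * inner ℝ (A τ θ₀) n + δ * (|σ - τ| + ‖z - γ τ θ₀‖) <
          inner ℝ (z - γ τ θ₀) n → z ∉ Ω σ) := by
  obtain ⟨C, r, hr, hC0, hC⟩ := hF.taylor τ hτ θ₀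
  set a := ‖A τ θ₀‖ with ha
  have ha0 : 0 ≤ a := norm_nonneg _
  set δ' := min (1 / 2) (δ / (2 * (a + 2))) with hδ'
  have hδ'0 : 0 < δ' := by positivity
  have hδ'1 : δ' ≤ 1 / 2 := min_le_left _ _
  have hδ'2 : δ' * (a + 1) ≤ δ / 2 := by
    calc δ' * (a + 1) ≤ δ / (2 * (a + 2)) * (a + 2) := by
          gcongr
          · exact min_le_right _ _
          · norm_num
      _ = δ / 2 := by field_simp
  obtain ⟨ρ, hρ, hc⟩ := hcone δ' hδ'0 hδ'1
  refine ⟨min (min r ρ) (min (ρ / (2 * (a + 1))) (min (ρ / 2) (min (1 / (C + 1))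
    (δ / (2 * (C + 1)))))), by positivity, fun σ hσ hστ z hz => ?_⟩
  simp only [lt_min_iff] at hστ hz
  obtain ⟨⟨s1, s2⟩, s3, -, s5, s6⟩ := hστ
  have hz1 := hz.2.2.1
  rw [lt_div_iff₀ (by positivity)] at s3 s5 s6
  set s := σ - τ with hs
  set V := inner ℝ (A τ θ₀) n with hV
  set u := z - γ τ θ₀ with hu
  have hs0 := abs_nonneg s
  have hu0 := norm_nonneg u
  have htay := (hC σ hσ θ₀ s1 (by simpa using hr)).2
  rw [sub_self, abs_zero, add_zero, zero_smul, add_zero] at htay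
  have hCs : C * |s| ^ 2 ≤ |s| := by nlinarith
  have hCs2 : C * |s| ^ 2 ≤ δ / 2 * |s| := by nlinarith
  -- The cones are taken at the same parameter `θ₀`, with an apex displaced by `s A` up to `O(s²)`.
  -- The tangential part of `A` costs only `δ' |s| (a + 1)`.
  set e := γ σ θ₀ - γ τ θ₀ - s • A τ θ₀ with he
  have hv : z - γ σ θ₀ = u - s • A τ θ₀ - e := by
    rw [he, hu]; abel
  have hvn : ‖z - γ σ θ₀‖ ≤ ‖u‖ + |s| * (a + 1) := by
    rw [hv]
    refine (norm_sub_le _ _).trans ?_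
    have h1 := norm_sub_le u (s • A τ θ₀)
    rw [norm_smul, Real.norm_eq_abs] at h1
    linarith
  have hvi : |inner ℝ (z - γ σ θ₀) n - (inner ℝ u n - s * V)| ≤ C * |s| ^ 2 := by
    have e1 : inner ℝ (z - γ σ θ₀) n - (inner ℝ u n - s * V) = -inner ℝ e n := by
      rw [hv, inner_sub_left _ e, inner_sub_left u, real_inner_smul_left]; ring
    rw [e1, abs_neg]
    refine (abs_real_inner_le_norm _ _).trans ?_
    rw [hn, mul_one]
    exact htay
  have hlt : ‖z - γ σ θ₀‖ < ρ := by linarith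
  have hδv : δ' * ‖z - γ σ θ₀‖ ≤ δ * (|s| + ‖u‖) - C * |s| ^ 2 := by
    have h1 : δ' * ‖u‖ ≤ δ * ‖u‖ := by
      gcongr
      nlinarith
    calc δ' * ‖z - γ σ θ₀‖ ≤ δ' * (‖u‖ + |s| * (a + 1)) := by gcongr
      _ = δ' * ‖u‖ + δ' * (a + 1) * |s| := by ring
      _ ≤ δ * ‖u‖ + δ / 2 * |s| := by gcongr
      _ ≤ _ := by linarith
  obtain ⟨hc1, hc2⟩ := hc σ hσ s2 θ₀ (by simpa using hρ)
  rw [abs_le] at hvi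
  refine ⟨fun hlow => hc1 ⟨hlt, ?_⟩, fun hhigh hzΩ => hc2 ⟨hlt, ?_⟩ (subset_closure hzΩ)⟩
  · rw [inner_neg_right]
    linarith [hvi.2]
  · linarith [hvi.1]

include hφ

/-- The normal vector in terms of the conformal map. -/
theorem normal_eq {θ₀ : ℝ} {n : ℂ} (hn : ‖n‖ = 1) (hnD : inner ℝ (D τ θ₀) n = 0)
    (hout : ∃ ρ > 0, cone (γ τ θ₀) n (1 / 2) ρ ⊆ (closure (Ω τ))ᶜ) :
    φ (γ τ θ₀) * (starRingEnd ℂ) (deriv φ (γ τ θ₀)) = (‖deriv φ (γ τ θ₀)‖ : ℝ) • n := by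
  have hfr : ∀ θ, γ τ θ ∈ frontier (Ω τ) := fun θ => hF.range_eq τ hτ ▸ mem_range_self θ
  set ζ := γ τ θ₀ with hζ
  have hζU : ζ ∈ U := hφ.frontier_subset (hfr θ₀)
  -- Twice `q` is the gradient of `|φ|²`. It is orthogonal to the curve, where `|φ| = 1`, and it
  -- points outwards because `|φ| > 1` in the outer cone.
  set q := φ ζ * (starRingEnd ℂ) (deriv φ ζ) with hq
  have hqn : ‖q‖ = ‖deriv φ ζ‖ := by
    rw [hq, norm_mul, hφ.norm_eq ζ (hfr θ₀), one_mul, RCLike.norm_conj]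
  have hin : ∀ v, inner ℝ q v = inner ℝ (φ ζ) (deriv φ ζ * v) := fun v => by
    rw [Complex.inner, Complex.inner, hq, map_mul, Complex.conj_conj]
    congr 1
    ring
  have hqD : inner ℝ q (D τ θ₀) = 0 := by
    have h1 : HasDerivAt (fun θ => φ (γ τ θ)) (deriv φ ζ * D τ θ₀) θ₀ :=
      (hφ.hasDerivAt hζU).comp θ₀ (hF.hasDerivAt τ hτ θ₀)
    have h2 := h1.norm_sq
    have h3 : (fun θ => ‖φ (γ τ θ)‖ ^ 2) = fun _ => (1 : ℝ) := by
      ext θ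
      rw [hφ.norm_eq _ (hfr θ), one_pow]
    rw [h3] at h2
    have h4 := h2.unique (hasDerivAt_const θ₀ (1 : ℝ))
    rw [hin]
    linarith
  have hqpos : 0 ≤ inner ℝ q n := by
    have h0 : HasDerivAt (fun t : ℝ => ζ + t • n) n 0 := by
      simpa using ((hasDerivAt_id (0 : ℝ)).smul_const n).const_add ζ
    have h1 : HasDerivAt (fun t : ℝ => φ (ζ + t • n)) (deriv φ ζ * n) 0 := by
      have h2 : HasDerivAt φ (deriv φ ζ) (ζ + (0 : ℝ) • n) := by
        rw [zero_smul, add_zero]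
        exact hφ.hasDerivAt hζU
      exact h2.comp (0 : ℝ) h0
    have h2 := h1.norm_sq.tendsto_slope_zero_right
    rw [zero_smul, add_zero] at h2
    have h3 : 0 ≤ 2 * inner ℝ (φ ζ) (deriv φ ζ * n) := by
      refine ge_of_tendsto h2 ?_
      obtain ⟨ρ, hρ, hout⟩ := hout
      have hU : ∀ᶠ t : ℝ in 𝓝[>] 0, ζ + t • n ∈ U := by
        have : Tendsto (fun t : ℝ => ζ + t • n) (𝓝 0) (𝓝 ζ) := by
          simpa using h0.continuousAt.tendsto
        exact nhdsWithin_le_nhds (this.eventually (hφ.isOpen.mem_nhds hζU))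
      filter_upwards [hU, Ioo_mem_nhdsGT hρ] with t htU ht
      have hmem : ζ + t • n ∈ cone ζ n (1 / 2) ρ := by
        refine ⟨?_, ?_⟩ <;>
          rw [add_sub_cancel_left, norm_smul, hn, mul_one, Real.norm_of_nonneg ht.1.le]
        · exact ht.2
        · rw [real_inner_smul_left, real_inner_self_eq_norm_sq, hn]
          linarith [ht.1]
      have hgt := hφ.norm_gt _ htU (hout hmem)
      rw [zero_add, hφ.norm_eq ζ (hfr θ₀), smul_eq_mul]
      refine mul_nonneg (inv_nonneg.2 ht.1.le) ?_
      nlinarith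
    rw [hin]
    linarith
  have hdec := eq_inner_smul_of_orthogonal hn (hF.ne_zero τ hτ θ₀) hnD hqD
  have hval : inner ℝ q n = ‖deriv φ ζ‖ := by
    rw [← hqn]
    conv_rhs => rw [hdec]
    rw [norm_smul, hn, mul_one, Real.norm_of_nonneg hqpos]
  rw [hdec, hval]

/-- First order description, in conformal coordinates and along a radius, of the nearby domains. -/
theorem exists_first_order_radial {θ₀ : ℝ} {n : ℂ} (hn : ‖n‖ = 1) (hnD : inner ℝ (D τ θ₀) n = 0)
    (hout : ∃ ρ > 0, cone (γ τ θ₀) n (1 / 2) ρ ⊆ (closure (Ω τ))ᶜ)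
    (hcone : ∀ δ > 0, δ ≤ 1 / 2 → ∃ ρ > 0, ∀ σ ∈ J, |σ - τ| < ρ → ∀ θ, |θ - θ₀| < ρ →
      cone (γ σ θ) (-n) δ ρ ⊆ Ω σ ∧ cone (γ σ θ) n δ ρ ⊆ (closure (Ω σ))ᶜ)
    {δ : ℝ} (hδ : 0 < δ) :
    ∃ ρ > 0, ∀ σ ∈ J, |σ - τ| < ρ → ∀ x : ℝ, |x| < ρ →
      (x < (σ - τ) * inner ℝ (φ (γ τ θ₀)) (deriv φ (γ τ θ₀) * A τ θ₀) - δ * (|σ - τ| + |x|) →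
        ψ (φ (γ τ θ₀) + x • φ (γ τ θ₀)) ∈ Ω σ) ∧
      ((σ - τ) * inner ℝ (φ (γ τ θ₀)) (deriv φ (γ τ θ₀) * A τ θ₀) + δ * (|σ - τ| + |x|) < x →
        ψ (φ (γ τ θ₀) + x • φ (γ τ θ₀)) ∉ Ω σ) := by
  have hnφ := hF.normal_eq hτ hφ hn hnD hout
  rw [inner_mul_eq_of_mul_conj_eq hnφ]
  set ζ := γ τ θ₀ with hζ
  have hfr : ζ ∈ frontier (Ω τ) := hF.range_eq τ hτ ▸ mem_range_self θ₀
  have hζU : ζ ∈ U := hφ.frontier_subset hfr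
  set d := ‖deriv φ ζ‖ with hd
  have hd0' : deriv φ ζ ≠ 0 := hφ.deriv_ne_zero hζU
  have hd0 : 0 < d := norm_pos_iff.2 hd0'
  set V := inner ℝ (A τ θ₀) n with hV
  set w := φ ζ with hw
  have hwn : w * (deriv φ ζ)⁻¹ = (d⁻¹ : ℝ) • n := by
    have h1 : (starRingEnd ℂ) (deriv φ ζ) * deriv φ ζ = ((d ^ 2 : ℝ) : ℂ) := by
      rw [mul_comm, Complex.mul_conj, Complex.normSq_eq_norm_sq]
    have h2 : ((d ^ 2 : ℝ) : ℂ) * (w * (deriv φ ζ)⁻¹) = ((d ^ 2 : ℝ) : ℂ) * ((d⁻¹ : ℝ) • n) := by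
      rw [← h1]
      calc _ = w * (starRingEnd ℂ) (deriv φ ζ) := by field_simp
        _ = (d : ℝ) • n := hnφ
        _ = _ := by
          rw [h1, ← Complex.real_smul, smul_smul]
          congr 1
          field_simp
    exact mul_left_cancel₀ (by exact_mod_cast (pow_pos hd0 2).ne') h2
  set B := d⁻¹ + 1 with hB
  have hB0 : 0 < B := by positivity
  set e := min 1 (δ / (2 * d)) with he
  have he0 : 0 < e := by positivity
  set δ' := min (δ / (2 * d * B)) (δ / d) with hδ'
  have hδ'0 : 0 < δ' := by positivity
  obtain ⟨ρ₁, hρ₁, h1⟩ := hF.exists_first_order hτ hn hcone hδ'0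
  -- Moving radially by `x` in the disk moves the preimage by `x n / |φ'|` to first order. The
  -- first-order description therefore transfers with factor `d = |φ'|`.
  have hψ : HasDerivAt (fun x : ℝ => ψ (w + x • w)) ((d⁻¹ : ℝ) • n) 0 := by
    have h2 : HasDerivAt ψ (deriv φ ζ)⁻¹ (w + (0 : ℝ) • w) := by
      rw [zero_smul, add_zero]
      exact hasDerivAt_of_leftInvOn hφ.isOpen hφ.differentiableOn hφ.injOn hφ.left_inv hζU
    have h3 : HasDerivAt (fun x : ℝ => w + x • w) w 0 := by
      simpa using ((hasDerivAt_id (0 : ℝ)).smul_const w).const_add w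
    rw [← hwn, mul_comm]
    exact h2.comp (0 : ℝ) h3
  have hψ0 : ψ w = ζ := hφ.left_inv ζ hζU
  have hlit := hψ.isLittleO.def he0
  simp only [zero_smul, add_zero, sub_zero, hψ0] at hlit
  obtain ⟨ρ₂, hρ₂, h2⟩ := Metric.eventually_nhds_iff.1 hlit
  refine ⟨min ρ₁ (min ρ₂ (ρ₁ / B)), by positivity, fun σ hσ hστ x hx => ?_⟩
  simp only [lt_min_iff] at hστ hx
  have hx3 := hx.2.2
  rw [lt_div_iff₀ hB0] at hx3
  set z := ψ (w + x • w) with hz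
  set s := σ - τ with hs
  have hx0 := abs_nonneg x
  have h3 : ‖z - ζ - x • ((d⁻¹ : ℝ) • n)‖ ≤ e * |x| := by
    have := h2 (y := x) (by simpa using hx.2.1)
    rwa [Real.norm_eq_abs] at this
  have h4 : ‖z - ζ‖ ≤ B * |x| := by
    have h5 := norm_sub_norm_le (z - ζ) (x • ((d⁻¹ : ℝ) • n))
    rw [norm_smul, norm_smul, hn, mul_one, Real.norm_eq_abs,
      Real.norm_of_nonneg (inv_nonneg.2 hd0.le)] at h5
    have h6 : e * |x| ≤ 1 * |x| := by
      gcongr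
      exact min_le_left _ _
    rw [hB]
    linarith
  have h5 : |inner ℝ (z - ζ) n - x * d⁻¹| ≤ δ / (2 * d) * |x| := by
    have e1 : inner ℝ (z - ζ) n - x * d⁻¹ = inner ℝ (z - ζ - x • ((d⁻¹ : ℝ) • n)) n := by
      rw [inner_sub_left _ (x • _), real_inner_smul_left, real_inner_smul_left,
        real_inner_self_eq_norm_sq, hn]
      ring
    rw [e1]
    refine (abs_real_inner_le_norm _ _).trans ?_
    rw [hn, mul_one]
    refine h3.trans ?_
    gcongr
    exact min_le_right _ _
  have h6 : δ' * (|s| + ‖z - ζ‖) ≤ δ / d * |s| + δ / (2 * d) * |x| := by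
    have e1 : δ' * |s| ≤ δ / d * |s| := by
      gcongr
      exact min_le_right _ _
    have e2 : δ' * ‖z - ζ‖ ≤ δ / (2 * d * B) * (B * |x|) := by
      gcongr
      exact min_le_left _ _
    have e3 : δ / (2 * d * B) * (B * |x|) = δ / (2 * d) * |x| := by field_simp
    linarith
  obtain ⟨h7, h8⟩ := h1 σ hσ hστ.1 z (h4.trans_lt (by linarith))
  rw [abs_le] at h5
  have e4 : δ / d = 2 * (δ / (2 * d)) := by field_simp
  refine ⟨fun h => h7 ?_, fun h => h8 ?_⟩
  · have h9 : x * d⁻¹ < s * V - δ / d * (|s| + |x|) := by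
      rw [← div_eq_mul_inv, div_lt_iff₀ hd0]
      calc x < s * (V * d) - δ * (|s| + |x|) := h
        _ = _ := by field_simp
    have h10 : δ / d * (|s| + |x|) = δ / d * |s| + 2 * (δ / (2 * d)) * |x| := by rw [← e4]; ring
    linarith [h5.2]
  · have h9 : s * V + δ / d * (|s| + |x|) < x * d⁻¹ := by
      rw [← div_eq_mul_inv, lt_div_iff₀ hd0]
      calc _ = s * (V * d) + δ * (|s| + |x|) := by field_simp
        _ < x := h
    have h10 : δ / d * (|s| + |x|) = δ / d * |s| + 2 * (δ / (2 * d)) * |x| := by rw [← e4]; ring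
    linarith [h5.1]

/-- In conformal coordinates the nearby curves stay close to the unit circle. -/
theorem exists_abs_norm_sub_one_le :
    ∃ C > 0, (∀ θ ∈ Icc 0 (2 * Real.pi), ‖A τ θ‖ * ‖deriv φ (γ τ θ)‖ ≤ C) ∧
      ∀ᶠ σ in 𝓝[J] τ, ∀ z ∈ frontier (Ω σ), z ∈ U ∧ |‖φ z‖ - 1| ≤ C * |σ - τ| := by
  have hfr : ∀ θ, γ τ θ ∈ frontier (Ω τ) := fun θ => hF.range_eq τ hτ ▸ mem_range_self θ
  have hrc : IsCompact (frontier (Ω τ)) := by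
    rw [← hF.range_eq τ hτ]
    have : range (γ τ) = γ τ '' Icc 0 (2 * Real.pi) := by
      refine Subset.antisymm ?_ (image_subset_range _ _)
      rintro _ ⟨θ, rfl⟩
      obtain ⟨θ', hθ', -, he⟩ := hF.exists_int_add_mem hτ 0 θ
      rw [zero_add] at hθ'
      exact ⟨θ', Ico_subset_Icc_self hθ', he⟩
    rw [this]
    exact isCompact_Icc.image (hF.continuous_curve hτ)
  obtain ⟨e, he, heU⟩ := hrc.exists_cthickening_subset_open hφ.isOpen hφ.frontier_subset
  obtain ⟨B, hB⟩ := (hrc.cthickening (r := e)).exists_bound_of_continuousOn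
    (hφ.continuousOn_deriv.mono heU)
  obtain ⟨M, hM⟩ := (hF.isCompact.prod (isCompact_Icc (a := 0)
    (b := 2 * Real.pi))).exists_bound_of_continuousOn
    (hF.continuousOn_velocity.mono (prod_mono le_rfl (subset_univ _)))
  have h0 : (0 : ℝ) ∈ Icc 0 (2 * Real.pi) := ⟨le_rfl, Real.two_pi_pos.le⟩
  have hM0 : 0 ≤ M := (norm_nonneg _).trans (hM (τ, 0) ⟨hτ, h0⟩)
  have hthick : ∀ θ, closedBall (γ τ θ) e ⊆ cthickening e (frontier (Ω τ)) := fun θ =>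
    closedBall_subset_cthickening (hfr θ) e
  have hB0 : 0 ≤ B := (norm_nonneg _).trans (hB (γ τ 0) (hthick 0 (mem_closedBall_self he.le)))
  refine ⟨M * B + 1, by positivity, fun θ hθ => ?_, ?_⟩
  · have h1 := hM (τ, θ) ⟨hτ, hθ⟩
    have h2 := hB (γ τ θ) (hthick θ (mem_closedBall_self he.le))
    calc ‖A τ θ‖ * ‖deriv φ (γ τ θ)‖ ≤ M * B := by gcongr
      _ ≤ _ := by linarith
  · filter_upwards [self_mem_nhdsWithin, mem_nhdsWithin_of_mem_nhds
      (ball_mem_nhds τ (show 0 < e / (M + 1) by positivity))] with σ hσ hστ z hz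
    rw [mem_ball, Real.dist_eq, lt_div_iff₀ (by positivity)] at hστ
    rw [← hF.range_eq σ hσ] at hz
    obtain ⟨θ₁, rfl⟩ := hz
    obtain ⟨θ, hθ, -, heq⟩ := hF.exists_int_add_mem hσ 0 θ₁
    rw [zero_add] at hθ
    rw [← heq]
    have hs0 := abs_nonneg (σ - τ)
    have h1 : ‖γ σ θ - γ τ θ‖ ≤ M * |σ - τ| := by
      rw [← Real.norm_eq_abs]
      exact hF.convex.norm_image_sub_le_of_norm_hasDerivWithin_le (f := fun s => γ s θ)
        (fun s hs => hF.hasDerivWithinAt s hs θ)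
        (fun s hs => hM (s, θ) ⟨hs, Ico_subset_Icc_self hθ⟩) hτ hσ
    have hmem : γ σ θ ∈ closedBall (γ τ θ) e := by
      rw [mem_closedBall, dist_eq_norm]
      nlinarith
    refine ⟨heU (hthick θ hmem), ?_⟩
    have h2 : ‖φ (γ σ θ) - φ (γ τ θ)‖ ≤ B * ‖γ σ θ - γ τ θ‖ :=
      (convex_closedBall (γ τ θ) e).norm_image_sub_le_of_norm_deriv_le
        (fun x hx => (hφ.hasDerivAt (heU (hthick θ hx))).differentiableAt)
        (fun x hx => hB x (hthick θ hx)) (mem_closedBall_self he.le) hmem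
    have h3 := abs_norm_sub_norm_le (φ (γ σ θ)) (φ (γ τ θ))
    rw [hφ.norm_eq _ (hfr θ)] at h3
    calc |‖φ (γ σ θ)‖ - 1| ≤ B * ‖γ σ θ - γ τ θ‖ := h3.trans h2
      _ ≤ B * (M * |σ - τ|) := by gcongr
      _ ≤ _ := by nlinarith

/-- Points of the exterior accumulate at the curve, so one of them has `1 < |φ| < 1 + η`. A radial
segment joins its image to the circle of radius `1 + η` within `|w| > 1`, and the preimage of
segment and circle stays in the component of `p`. -/
theorem sphere_subset_exterior :
    ψ '' sphere 0 (1 + η) ⊆ connectedComponentIn (closure (Ω τ))ᶜ p := by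
  have hη := hφ.pos
  have hfr : γ τ 0 ∈ frontier (Ω τ) := hF.range_eq τ hτ ▸ mem_range_self 0
  set X := connectedComponentIn (closure (Ω τ))ᶜ p with hX
  have hζU : γ τ 0 ∈ U := hφ.frontier_subset hfr
  have hN : U ∩ φ ⁻¹' ball 0 (1 + η) ∈ 𝓝 (γ τ 0) := by
    refine inter_mem (hφ.isOpen.mem_nhds hζU)
      ((hφ.hasDerivAt hζU).continuousAt.preimage_mem_nhds (isOpen_ball.mem_nhds ?_))
    rw [mem_ball_zero_iff, hφ.norm_eq _ hfr]
    linarith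
  obtain ⟨z, ⟨hzU, hzη⟩, hzX⟩ := mem_closure_iff_nhds.1 (hF.mem_closure_exterior hτ 0) _ hN
  have hzη' : ‖φ z‖ < 1 + η := by simpa using hzη
  have hz1 : 1 < ‖φ z‖ := hφ.norm_gt z hzU (connectedComponentIn_subset _ _ hzX)
  set R := (1 + η) / ‖φ z‖ with hR
  have hR1 : 1 ≤ R := by
    rw [hR, le_div_iff₀ (by linarith)]
    linarith
  set S := (fun t : ℝ => t • φ z) '' Icc 1 R with hS
  have hSn : ∀ w ∈ S, 1 < ‖w‖ ∧ ‖w‖ ≤ 1 + η := by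
    rintro _ ⟨t, ht, rfl⟩
    simp only [norm_smul]
    rw [Real.norm_of_nonneg (by linarith [ht.1])]
    constructor
    · nlinarith [ht.1]
    · calc t * ‖φ z‖ ≤ R * ‖φ z‖ := by gcongr; exact ht.2
        _ = 1 + η := div_mul_cancel₀ _ (by linarith)
  have hrank : 1 < Module.rank ℝ ℂ := by
    rw [Complex.rank_real_complex]
    exact Cardinal.one_lt_two
  have hSc : IsPreconnected (S ∪ sphere (0 : ℂ) (1 + η)) := by
    refine IsPreconnected.union (R • φ z) ⟨R, ⟨hR1, le_rfl⟩, rfl⟩ ?_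
      (isPreconnected_Icc.image _ (by fun_prop)) (isPreconnected_sphere hrank 0 _)
    rw [mem_sphere_zero_iff_norm, norm_smul, Real.norm_of_nonneg (by linarith)]
    exact div_mul_cancel₀ _ (by linarith)
  have hn : ∀ w ∈ S ∪ sphere (0 : ℂ) (1 + η), 1 < ‖w‖ ∧ ‖w‖ ≤ 1 + η := by
    rintro w (hw | hw)
    · exact hSn w hw
    · rw [mem_sphere_zero_iff_norm] at hw
      constructor <;> linarith
  have himg : IsPreconnected (ψ '' (S ∪ sphere 0 (1 + η))) :=
    hSc.image _ (hφ.continuousOn_inv.mono fun w hw => by simpa using (hn w hw).2)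
  have hsub : ψ '' (S ∪ sphere 0 (1 + η)) ⊆ (closure (Ω τ))ᶜ := by
    rintro _ ⟨w, hw, rfl⟩ hcl
    obtain ⟨h1, h2⟩ := hn w hw
    obtain ⟨h3, h4⟩ := hφ.right_inv h2
    rw [closure_eq_self_union_frontier] at hcl
    rcases hcl with hcl | hcl
    · have := (hφ.norm_lt_iff _ h4).2 hcl
      rw [h3] at this
      linarith
    · have := hφ.norm_eq _ hcl
      rw [h3] at this
      linarith
  have hz : z ∈ ψ '' (S ∪ sphere 0 (1 + η)) :=
    ⟨φ z, Or.inl ⟨1, ⟨le_rfl, hR1⟩, one_smul _ _⟩, hφ.left_inv z hzU⟩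
  have := himg.subset_connectedComponentIn hz hsub
  rw [← connectedComponentIn_eq hzX] at this
  exact (image_mono subset_union_right).trans this

/-- Nearby boundaries lie in the annulus where `|‖w‖ - 1| ≤ C |σ - τ|`. The inner disk contains the
image of the root. A point beyond the annulus is joined radially to the circle of radius `1 + η`,
which is exterior for all nearby domains, and this circle also confines these connected domains to
the chart. -/
theorem exists_radial_localization (hroot : φ w₀ = 0) :
    ∃ C > 0, (∀ θ ∈ Icc 0 (2 * Real.pi), ‖A τ θ‖ * ‖deriv φ (γ τ θ)‖ ≤ C) ∧
      ∀ᶠ σ in 𝓝[J] τ, (∀ w, ‖w‖ < 1 - C * |σ - τ| → ψ w ∈ Ω σ) ∧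
        (∀ w, 1 + C * |σ - τ| < ‖w‖ → ‖w‖ ≤ 1 + η → ψ w ∉ Ω σ) ∧
        ∀ z ∈ Ω σ, z ∈ U ∧ ‖φ z‖ < 1 + η := by
  have hη := hφ.pos
  obtain ⟨C, hC, hAC, hev⟩ := hF.exists_abs_norm_sub_one_le hτ hφ
  have hw₀U : w₀ ∈ U := hφ.closure_subset (subset_closure (hF.root_mem τ hτ))
  have hψ0 : ψ 0 = w₀ := by rw [← hroot, hφ.left_inv w₀ hw₀U]
  have hrank : 1 < Module.rank ℝ ℂ := by
    rw [Complex.rank_real_complex]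
    exact Cardinal.one_lt_two
  have hcs : IsCompact (ψ '' sphere 0 (1 + η)) :=
    (isCompact_sphere 0 _).image_of_continuousOn
      (hφ.continuousOn_inv.mono sphere_subset_closedBall)
  have hsp := hF.eventually_disjoint_closure hτ hcs
    ((isPreconnected_sphere hrank 0 _).image _ (hφ.continuousOn_inv.mono sphere_subset_closedBall))
    (hF.sphere_subset_exterior hτ hφ)
  refine ⟨C, hC, hAC, ?_⟩
  filter_upwards [hev, hsp, self_mem_nhdsWithin] with σ hσ hσs hσJ
  have hs0 : 0 ≤ C * |σ - τ| := by positivity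
  refine ⟨fun w hw => ?_, fun w hw hwη hwΩ => ?_, ?_⟩
  · have hb : ball (0 : ℂ) (1 - C * |σ - τ|) ⊆ closedBall 0 (1 + η) := fun v hv => by
      rw [mem_ball_zero_iff] at hv
      rw [mem_closedBall_zero_iff]
      linarith
    refine subset_of_isPreconnected_of_disjoint_frontier (hF.isOpen σ hσJ)
      ((convex_ball (0 : ℂ) _).isPreconnected.image ψ (hφ.continuousOn_inv.mono hb)) ?_
      ⟨w₀, ⟨0, mem_ball_self ((norm_nonneg w).trans_lt hw), hψ0⟩, hF.root_mem σ hσJ⟩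
      ⟨w, mem_ball_zero_iff.2 hw, rfl⟩
    rw [Set.disjoint_left]
    rintro _ ⟨v, hv, rfl⟩ hvf
    obtain ⟨-, h2⟩ := hσ _ hvf
    rw [(hφ.right_inv (mem_closedBall_zero_iff.1 (hb hv))).1] at h2
    rw [mem_ball_zero_iff] at hv
    linarith [(abs_le.1 h2).1]
  · set R := (1 + η) / ‖w‖ with hR
    have hw0 : 0 < ‖w‖ := by linarith
    have hR1 : 1 ≤ R := by
      rw [hR, le_div_iff₀ hw0]
      linarith
    set S := (fun t : ℝ => t • w) '' Icc 1 R with hS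
    have hSn : ∀ v ∈ S, ‖w‖ ≤ ‖v‖ ∧ ‖v‖ ≤ 1 + η := by
      rintro _ ⟨t, ht, rfl⟩
      simp only [norm_smul]
      rw [Real.norm_of_nonneg (by linarith [ht.1])]
      constructor
      · nlinarith [ht.1]
      · calc t * ‖w‖ ≤ R * ‖w‖ := by gcongr; exact ht.2
          _ = 1 + η := div_mul_cancel₀ _ hw0.ne'
    have hSb : S ⊆ closedBall 0 (1 + η) := fun v hv => by simpa using (hSn v hv).2
    have h1 : ψ '' S ⊆ Ω σ := by
      refine subset_of_isPreconnected_of_disjoint_frontier (hF.isOpen σ hσJ)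
        ((isPreconnected_Icc.image _ (by fun_prop)).image ψ (hφ.continuousOn_inv.mono hSb)) ?_
        ⟨ψ w, ⟨w, ⟨1, ⟨le_rfl, hR1⟩, one_smul _ _⟩, rfl⟩, hwΩ⟩
      rw [Set.disjoint_left]
      rintro _ ⟨v, hv, rfl⟩ hvf
      obtain ⟨-, h2⟩ := hσ _ hvf
      rw [(hφ.right_inv (hSn v hv).2).1] at h2
      linarith [(abs_le.1 h2).2, (hSn v hv).1]
    refine Set.disjoint_left.1 hσs (mem_image_of_mem ψ (x := R • w) ?_)
      (subset_closure (h1 ⟨R • w, ⟨R, ⟨hR1, le_rfl⟩, rfl⟩, rfl⟩))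
    rw [mem_sphere_zero_iff_norm, norm_smul, Real.norm_of_nonneg (by linarith)]
    exact div_mul_cancel₀ _ hw0.ne'
  · have hM : IsOpen (U ∩ φ ⁻¹' ball 0 (1 + η)) :=
      hφ.differentiableOn.continuousOn.isOpen_inter_preimage hφ.isOpen isOpen_ball
    have hMe : U ∩ φ ⁻¹' ball 0 (1 + η) = ψ '' ball 0 (1 + η) := by
      ext z
      constructor
      · rintro ⟨h1, h2⟩
        exact ⟨φ z, h2, hφ.left_inv z h1⟩
      · rintro ⟨w, hw, rfl⟩
        obtain ⟨h1, h2⟩ := hφ.right_inv (mem_ball_zero_iff.1 hw).le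
        refine ⟨h2, ?_⟩
        rw [mem_preimage, h1]
        exact hw
    have hMf : frontier (U ∩ φ ⁻¹' ball 0 (1 + η)) ⊆ ψ '' sphere 0 (1 + η) := by
      intro z hz
      have hcl : closure (U ∩ φ ⁻¹' ball 0 (1 + η)) ⊆ ψ '' closedBall 0 (1 + η) := by
        rw [hMe]
        exact closure_minimal (image_mono ball_subset_closedBall)
          ((isCompact_closedBall 0 _).image_of_continuousOn hφ.continuousOn_inv).isClosed
      obtain ⟨w, hw, rfl⟩ := hcl hz.1
      refine ⟨w, ?_, rfl⟩
      rw [mem_closedBall_zero_iff] at hw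
      rw [mem_sphere_zero_iff_norm]
      refine le_antisymm hw (not_lt.1 fun hlt => hz.2 ?_)
      rw [hM.interior_eq, hMe]
      exact ⟨w, mem_ball_zero_iff.2 hlt, rfl⟩
    have hsub := subset_of_isPreconnected_of_disjoint_frontier hM (hF.isPreconnected σ hσJ)
      ((hσs.symm.mono_left subset_closure).mono_right hMf)
      ⟨w₀, hF.root_mem σ hσJ, hw₀U, by
        rw [mem_preimage, hroot]
        exact mem_ball_self (by linarith)⟩
    intro z hz
    exact ⟨(hsub hz).1, mem_ball_zero_iff.1 (hsub hz).2⟩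

end IsDomainFlow


/-! ### First variation of area integrals over nearly circular domains. -/

/-- This signed length is the limit of the rescaled difference between a radius of `1 + s κ` and a
radius of `1`. -/
theorem integral_indicator_Iio_sub {C κ : ℝ} (h : |κ| ≤ C) :
    ∫ y in (-C)..C, ((Iio κ).indicator 1 y - (Iio (0 : ℝ)).indicator 1 y : ℝ) = κ := by
  have key : ∀ x, |x| ≤ C → IntervalIntegrable ((Iio x).indicator (1 : ℝ → ℝ)) volume (-C) C ∧
      ∫ y in (-C)..C, (Iio x).indicator (1 : ℝ → ℝ) y = x + C := by
    intro x hx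
    have hC : -C ≤ C := by linarith [abs_nonneg x]
    rw [abs_le] at hx
    constructor
    · rw [intervalIntegrable_iff]
      exact (integrableOn_const (by simp) : IntegrableOn (fun _ => (1 : ℝ)) _ _).indicator
        measurableSet_Iio
    · have hset : Ioc (-C) C ∩ Iio x = Ioo (-C) x := by
        ext y
        simp only [mem_inter_iff, mem_Ioc, mem_Iio, mem_Ioo]
        constructor
        · rintro ⟨⟨h1, h2⟩, h3⟩
          exact ⟨h1, h3⟩
        · rintro ⟨h1, h2⟩
          exact ⟨⟨h1, by linarith⟩, h2⟩
      rw [intervalIntegral.integral_of_le hC, setIntegral_indicator measurableSet_Iio, hset]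
      simp only [Pi.one_apply, integral_const, smul_eq_mul, mul_one]
      rw [measureReal_restrict_apply_univ, Real.volume_real_Ioo_of_le (by linarith)]
      ring
  have hC0 : 0 ≤ C := (abs_nonneg κ).trans h
  obtain ⟨h1, h2⟩ := key κ h
  obtain ⟨h3, h4⟩ := key 0 (by simpa using hC0)
  rw [intervalIntegral.integral_sub h1 h3, h2, h4]
  ring

/-- The unit circle. -/
noncomputable def circlePoint (t : ℝ) : ℂ := Complex.exp (t * Complex.I)

theorem norm_circlePoint (t : ℝ) : ‖circlePoint t‖ = 1 := Complex.norm_exp_ofReal_mul_I t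

theorem continuous_circlePoint : Continuous circlePoint := by
  unfold circlePoint
  fun_prop

theorem polarCoord_symm_eq (r t : ℝ) :
    Complex.polarCoord.symm (r, t) = (r : ℂ) * circlePoint t := by
  rw [Complex.polarCoord_symm_apply, circlePoint, Complex.exp_mul_I]
  push_cast
  ring

theorem norm_mul_circlePoint (r t : ℝ) : ‖(r : ℂ) * circlePoint t‖ = |r| := by
  rw [norm_mul, norm_circlePoint, mul_one, Complex.norm_real, Real.norm_eq_abs]

/-- The sign of the parameter times the difference of two indicator functions. -/
theorem sign_mul_indicator_sub {s y κ : ℝ} (hs : s ≠ 0) (hκ : y ≠ κ) (hy : y ≠ 0) {P R : Prop}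
    [Decidable P] [Decidable R] (hP : 0 < s * (κ - y) → P) (hP' : s * (κ - y) < 0 → ¬P)
    (hR : R ↔ s * y < 0) :
    Real.sign s * ((if P then 1 else 0) - (if R then 1 else 0)) =
      (Iio κ).indicator (1 : ℝ → ℝ) y - (Iio (0 : ℝ)).indicator (1 : ℝ → ℝ) y := by
  have hP2 : P ↔ 0 < s * (κ - y) := by
    refine ⟨fun h => ?_, hP⟩
    by_contra hcon
    refine hP' (lt_of_le_of_ne (not_lt.1 hcon) ?_) h
    exact mul_ne_zero hs (sub_ne_zero.2 hκ.symm)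
  rcases lt_or_gt_of_ne hs with h | h
  · have e1 : P ↔ κ < y := by
      rw [hP2]
      constructor <;> intro h' <;> nlinarith
    have e2 : R ↔ 0 < y := by
      rw [hR]
      constructor <;> intro h' <;> nlinarith
    rw [Real.sign_of_neg h]
    rcases lt_or_gt_of_ne hκ with h1 | h1 <;> rcases lt_or_gt_of_ne hy with h2 | h2 <;>
      simp [e1, e2, indicator, h1, h2, not_lt.2 h1.le, not_lt.2 h2.le]
  · have e1 : P ↔ y < κ := by
      rw [hP2]
      constructor <;> intro h' <;> nlinarith
    have e2 : R ↔ y < 0 := by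
      rw [hR]
      constructor <;> intro h' <;> nlinarith
    rw [Real.sign_of_pos h]
    rcases lt_or_gt_of_ne hκ with h1 | h1 <;> rcases lt_or_gt_of_ne hy with h2 | h2 <;>
      simp [e1, e2, indicator, h1, h2, not_lt.2 h1.le, not_lt.2 h2.le]

section RadialVariation

variable {l : Filter ℝ} {W : ℝ → Set ℂ} {C : ℝ}

/-- The density of the difference of the measures of `W` and of the unit disk. -/
noncomputable def diskDifference (W : Set ℂ) (F : ℂ → ℝ) (w : ℂ) : ℝ :=
  W.indicator F w - (ball (0 : ℂ) 1).indicator F w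

theorem measurable_diskDifference {W : Set ℂ} {F : ℂ → ℝ} (hW : IsOpen W) (hF : Measurable F) :
    Measurable (diskDifference W F) :=
  (hF.indicator hW.measurableSet).sub (hF.indicator measurableSet_ball)

theorem abs_diskDifference_le {W : Set ℂ} {F : ℂ → ℝ} {M : ℝ} (hM : ∀ w, |F w| ≤ M) (w : ℂ) :
    |diskDifference W F w| ≤ M := by
  have hM0 : 0 ≤ M := (abs_nonneg _).trans (hM w)
  have h := hM w
  rw [diskDifference]
  by_cases h1 : w ∈ W <;> by_cases h2 : w ∈ ball (0 : ℂ) 1 <;> simp [h1, h2, hM0, h]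

theorem diskDifference_eq (W : Set ℂ) [DecidablePred (· ∈ W)] (F : ℂ → ℝ) (w : ℂ)
    [Decidable (‖w‖ < 1)] :
    diskDifference W F w =
      F w * ((if w ∈ W then 1 else 0) - (if ‖w‖ < 1 then 1 else 0)) := by
  rw [diskDifference]
  by_cases h1 : w ∈ W <;> by_cases h2 : ‖w‖ < 1 <;> simp [h1, h2]

/-- The limit of the rescaled radial integral. -/
theorem tendsto_radial_integral [l.IsCountablyGenerated] (hl : l ≤ 𝓝[≠] 0)
    (hW : ∀ᶠ s in l, IsOpen (W s)) {F : ℂ → ℝ} (hF : Measurable F) {M : ℝ} (hM : ∀ w, |F w| ≤ M)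
    {t : ℝ} (hFt : ContinuousAt F (circlePoint t)) {κ : ℝ} (hκ : |κ| ≤ C)
    (hfo : ∀ δ > 0, ∃ ρ > 0, ∀ᶠ s in l, ∀ x : ℝ, |x| < ρ →
      (x < s * κ - δ * (|s| + |x|) → ((1 + x : ℝ) : ℂ) * circlePoint t ∈ W s) ∧
      (s * κ + δ * (|s| + |x|) < x → ((1 + x : ℝ) : ℂ) * circlePoint t ∉ W s)) :
    Tendsto (fun s => ∫ y in (-C)..C, Real.sign s * ((1 + s * y) *
      diskDifference (W s) F (((1 + s * y : ℝ) : ℂ) * circlePoint t))) l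
      (𝓝 (F (circlePoint t) * κ)) := by
  classical
  have hl0 : Tendsto (fun s : ℝ => s) l (𝓝 0) := hl.trans nhdsWithin_le_nhds
  have hne : ∀ᶠ s in l, s ≠ 0 := hl self_mem_nhdsWithin
  have hC0 : 0 ≤ C := (abs_nonneg κ).trans hκ
  have hM0 : 0 ≤ M := (abs_nonneg _).trans (hM 0)
  rw [← integral_indicator_Iio_sub hκ, ← intervalIntegral.integral_const_mul]
  refine intervalIntegral.tendsto_integral_filter_of_dominated_convergence
    (fun _ => (1 + C) * M) ?_ ?_ intervalIntegrable_const ?_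
  · filter_upwards [hW] with s hs
    have h1 : Measurable fun y : ℝ => ((1 + s * y : ℝ) : ℂ) * circlePoint t := by fun_prop
    have h2 : Measurable fun y : ℝ => 1 + s * y := by fun_prop
    exact (measurable_const.mul
      (h2.mul ((measurable_diskDifference hs hF).comp h1))).aestronglyMeasurable
  · have h1 : ∀ᶠ s in l, |s| < 1 := by
      have := hl0.abs
      rw [abs_zero] at this
      exact this.eventually (gt_mem_nhds one_pos)
    filter_upwards [h1] with s hs
    refine Eventually.of_forall fun y hy => ?_
    rw [uIoc_of_le (by linarith)] at hy
    have hy' : |y| ≤ C := abs_le.2 ⟨hy.1.le, hy.2⟩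
    have h2 : |Real.sign s| ≤ 1 := by
      rcases Real.sign_apply_eq s with h | h | h <;> rw [h] <;> simp
    have h3 : |1 + s * y| ≤ 1 + C := by
      refine (abs_add_le _ _).trans ?_
      rw [abs_one, abs_mul]
      nlinarith [abs_nonneg s, abs_nonneg y]
    rw [Real.norm_eq_abs, abs_mul, abs_mul]
    calc _ ≤ 1 * ((1 + C) * M) := by
          gcongr
          exact abs_diskDifference_le hM _
      _ = _ := one_mul _
  · have hae : ∀ᵐ y : ℝ, y ≠ κ ∧ y ≠ 0 := by
      have h1 : ∀ x : ℝ, ∀ᵐ y : ℝ, y ≠ x := fun x => by simp [ae_iff]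
      filter_upwards [h1 κ, h1 0] with y hy hy0 using ⟨hy, hy0⟩
    filter_upwards [hae] with y hy _
    have hlim : Tendsto (fun s : ℝ => (1 + s * y) *
        F (((1 + s * y : ℝ) : ℂ) * circlePoint t) *
        ((Iio κ).indicator (1 : ℝ → ℝ) y - (Iio (0 : ℝ)).indicator (1 : ℝ → ℝ) y)) l
        (𝓝 (F (circlePoint t) *
        ((Iio κ).indicator (1 : ℝ → ℝ) y - (Iio (0 : ℝ)).indicator (1 : ℝ → ℝ) y))) := by
      refine Tendsto.mul_const _ ?_
      have h1 : Tendsto (fun s : ℝ => 1 + s * y) l (𝓝 1) := by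
        simpa using (hl0.mul_const y).const_add 1
      have h2 : Tendsto (fun s : ℝ => ((1 + s * y : ℝ) : ℂ) * circlePoint t) l
          (𝓝 (circlePoint t)) := by
        have := ((Complex.continuous_ofReal.tendsto (1 : ℝ)).comp h1).mul_const (circlePoint t)
        simpa using this
      simpa using h1.mul (hFt.tendsto.comp h2)
    refine hlim.congr' ?_
    have hgap : 0 < |κ - y| := abs_pos.2 (sub_ne_zero.2 hy.1.symm)
    -- For fixed `y` and radius `1 + s y`, this `δ` makes the error in the first-order description
    -- half of `|s (κ - y)|`. Membership is thus decided for all small `s`, except for `y` in a null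
    -- set.
    set δ := |κ - y| / (2 * (1 + |y|)) with hδ
    have hδ0 : 0 < δ := by positivity
    obtain ⟨ρ, hρ, hev⟩ := hfo δ hδ0
    have hsmall : ∀ᶠ s in l, |s * y| < min ρ 1 := by
      have : Tendsto (fun s : ℝ => |s * y|) l (𝓝 0) := by
        simpa using (hl0.mul_const y).abs
      exact this.eventually (gt_mem_nhds (by positivity))
    filter_upwards [hev, hsmall, hne] with s hs hsy hs0
    rw [lt_min_iff] at hsy
    obtain ⟨h1, h2⟩ := hs (s * y) hsy.1
    have habs : δ * (|s| + |s * y|) < |s * (κ - y)| := by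
      have hs' : 0 < |s| := abs_pos.2 hs0
      rw [abs_mul, abs_mul, show |s| + |s| * |y| = |s| * (1 + |y|) by ring, hδ]
      have : |κ - y| / (2 * (1 + |y|)) * (|s| * (1 + |y|)) = |s| * |κ - y| / 2 := by
        field_simp
      rw [this]
      nlinarith [mul_pos hs' hgap]
    have hnorm : ‖((1 + s * y : ℝ) : ℂ) * circlePoint t‖ = 1 + s * y := by
      rw [norm_mul_circlePoint, abs_of_pos]
      linarith [(abs_lt.1 hsy.2).1]
    have hkey := sign_mul_indicator_sub (P := ((1 + s * y : ℝ) : ℂ) * circlePoint t ∈ W s)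
      (R := ‖((1 + s * y : ℝ) : ℂ) * circlePoint t‖ < 1) hs0 hy.1 hy.2
      (fun h => h1 (by rw [abs_of_pos h] at habs; linarith))
      (fun h => h2 (by rw [abs_of_neg h] at habs; linarith))
      (by rw [hnorm]; constructor <;> intro h <;> linarith)
    rw [diskDifference_eq, ← hkey]
    ring

/-- Rescaling of the radial integral. -/
theorem integral_radial_eq {s η : ℝ} (hs0 : s ≠ 0) (hC : 0 < C) (hsη : C * |s| < η)
    (hs1 : C * |s| < 1) {W : Set ℂ} {F : ℂ → ℝ} (hin : ∀ w, ‖w‖ < 1 - C * |s| → w ∈ W)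
    (hout : ∀ w, 1 + C * |s| < ‖w‖ → w ∉ W) (t : ℝ) :
    ∫ r in Ioc 0 (1 + η), r * diskDifference W F ((r : ℂ) * circlePoint t) =
      s * ∫ y in (-C)..C, Real.sign s * ((1 + s * y) *
        diskDifference W F (((1 + s * y : ℝ) : ℂ) * circlePoint t)) := by
  classical
  set g : ℝ → ℝ := fun r => r * diskDifference W F ((r : ℂ) * circlePoint t) with hg
  have hCs : 0 < C * |s| := by positivity
  have hzero : ∀ r, 0 < r → r ∉ Icc (1 - C * |s|) (1 + C * |s|) → g r = 0 := by
    intro r hr hrn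
    have hnorm : ‖(r : ℂ) * circlePoint t‖ = r := by rw [norm_mul_circlePoint, abs_of_pos hr]
    simp only [hg]
    rw [diskDifference_eq, hnorm]
    rcases not_and_or.1 hrn with h | h
    · rw [if_pos (hin _ (by rw [hnorm]; exact not_le.1 h)), if_pos (by linarith)]
      ring
    · rw [if_neg (hout _ (by rw [hnorm]; exact not_le.1 h)), if_neg (by linarith)]
      ring
  have h1 : ∫ r in Ioc 0 (1 + η), g r = ∫ r in (1 - C * |s|)..(1 + C * |s|), g r := by
    rw [intervalIntegral.integral_of_le (by linarith)]
    have h0 : ∫ r in Ioc 0 (1 + η), g r = ∫ r in Icc (1 - C * |s|) (1 + C * |s|), g r :=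
      setIntegral_eq_of_subset_of_forall_sdiff_eq_zero measurableSet_Ioc
        (fun r hr => ⟨by linarith [hr.1], by linarith [hr.2]⟩) fun r hr => hzero r hr.1.1 hr.2
    rw [h0, integral_Icc_eq_integral_Ioc]
  -- The substitution `r = 1 + s y` reverses orientation for negative `s`, and the factor `Real.sign
  -- s` compensates.
  have h2 : s * ∫ y in (-C)..C, g (1 + s * y) = ∫ r in (1 + s * (-C))..(1 + s * C), g r :=
    intervalIntegral.smul_integral_comp_add_mul g s 1
  rw [h1, intervalIntegral.integral_const_mul, mul_left_comm, h2]
  rcases lt_or_gt_of_ne hs0 with h | h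
  · rw [Real.sign_of_neg h, abs_of_neg h, neg_one_mul, ← intervalIntegral.integral_symm]
    congr 1 <;> ring
  · rw [Real.sign_of_pos h, abs_of_pos h, one_mul]
    congr 1 <;> ring

/-- The first variation of area integrals over nearly circular domains. -/
theorem tendsto_radial_variation [l.IsCountablyGenerated] (hl : l ≤ 𝓝[≠] 0) (hC : 0 < C)
    {η : ℝ} (hη : 0 < η) (hW : ∀ᶠ s in l, IsOpen (W s) ∧ W s ⊆ closedBall 0 (1 + η) ∧
      (∀ w, ‖w‖ < 1 - C * |s| → w ∈ W s) ∧ ∀ w, 1 + C * |s| < ‖w‖ → w ∉ W s)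
    {F : ℂ → ℝ} (hF : ContinuousOn F (closedBall 0 (1 + η))) {κ : ℝ → ℝ} (hκ : ∀ t, |κ t| ≤ C)
    (hfo : ∀ t, ∀ δ > 0, ∃ ρ > 0, ∀ᶠ s in l, ∀ x : ℝ, |x| < ρ →
      (x < s * κ t - δ * (|s| + |x|) → ((1 + x : ℝ) : ℂ) * circlePoint t ∈ W s) ∧
      (s * κ t + δ * (|s| + |x|) < x → ((1 + x : ℝ) : ℂ) * circlePoint t ∉ W s)) :
    Tendsto (fun s => s⁻¹ * ((∫ w in W s, F w) - ∫ w in ball (0 : ℂ) 1, F w)) l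
      (𝓝 (∫ t in Ioo (-Real.pi) Real.pi, F (circlePoint t) * κ t)) := by
  classical
  -- Extension by zero makes the density globally bounded and measurable. It keeps the continuity at
  -- the unit circle, which is interior to the larger disk.
  set G : ℂ → ℝ := (closedBall (0 : ℂ) (1 + η)).piecewise F (fun _ => 0) with hG
  have hGm : Measurable G := hF.measurable_piecewise continuousOn_const measurableSet_closedBall
  have hGF : ∀ w ∈ closedBall (0 : ℂ) (1 + η), G w = F w := fun w hw =>
    piecewise_eq_of_mem _ _ _ hw
  obtain ⟨M, hM⟩ := (isCompact_closedBall (0 : ℂ) (1 + η)).exists_bound_of_continuousOn hF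
  have hM0 : 0 ≤ M := (norm_nonneg _).trans (hM 0 (by simp; linarith))
  have hGM : ∀ w, |G w| ≤ M := fun w => by
    by_cases hw : w ∈ closedBall (0 : ℂ) (1 + η)
    · rw [hGF w hw]
      exact hM w hw
    · simp only [hG, piecewise_eq_of_notMem _ _ _ hw, abs_zero]
      exact hM0
  have hGt : ∀ t, ContinuousAt G (circlePoint t) := fun t => by
    have hmem : closedBall (0 : ℂ) (1 + η) ∈ 𝓝 (circlePoint t) := by
      refine mem_of_superset (isOpen_ball.mem_nhds ?_) ball_subset_closedBall
      rw [mem_ball_zero_iff, norm_circlePoint]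
      linarith
    exact (hF.continuousAt hmem).congr (by filter_upwards [hmem] with w hw using (hGF w hw).symm)
  have hl0 : Tendsto (fun s : ℝ => s) l (𝓝 0) := hl.trans nhdsWithin_le_nhds
  have hsmall : ∀ᶠ s in l, C * |s| < min η 1 := by
    have : Tendsto (fun s : ℝ => C * |s|) l (𝓝 0) := by simpa using hl0.abs.const_mul C
    exact this.eventually (gt_mem_nhds (by positivity))
  have hlim : Tendsto (fun s => ∫ t in Ioo (-Real.pi) Real.pi, ∫ y in (-C)..C, Real.sign s *
      ((1 + s * y) * diskDifference (W s) G (((1 + s * y : ℝ) : ℂ) * circlePoint t))) l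
      (𝓝 (∫ t in Ioo (-Real.pi) Real.pi, G (circlePoint t) * κ t)) := by
    refine tendsto_integral_filter_of_dominated_convergence (fun _ => 2 * C * ((1 + 1) * M)) ?_ ?_
      (integrableOn_const (by simp)) ?_
    · filter_upwards [hW] with s hs
      have h1 : Measurable fun p : ℝ × ℝ => ((1 + s * p.2 : ℝ) : ℂ) * circlePoint p.1 := by
        have := continuous_circlePoint.measurable
        fun_prop
      have h2 : Measurable fun p : ℝ × ℝ => 1 + s * p.2 := by fun_prop
      have h3 : StronglyMeasurable (Function.uncurry fun t y : ℝ => Real.sign s *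
          ((1 + s * y) * diskDifference (W s) G (((1 + s * y : ℝ) : ℂ) * circlePoint t))) :=
        (measurable_const.mul
          (h2.mul ((measurable_diskDifference hs.1 hGm).comp h1))).stronglyMeasurable
      simp_rw [intervalIntegral.integral_of_le (show -C ≤ C by linarith)]
      exact h3.integral_prod_right.aestronglyMeasurable
    · filter_upwards [hsmall] with s hs
      rw [lt_min_iff] at hs
      refine Eventually.of_forall fun t => ?_
      refine (intervalIntegral.norm_integral_le_of_norm_le_const (C := (1 + 1) * M)
        fun y hy => ?_).trans ?_
      · rw [uIoc_of_le (by linarith)] at hy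
        have hy' : |y| ≤ C := abs_le.2 ⟨hy.1.le, hy.2⟩
        have h2 : |Real.sign s| ≤ 1 := by
          rcases Real.sign_apply_eq s with h | h | h <;> rw [h] <;> simp
        have h3 : |1 + s * y| ≤ 1 + 1 := by
          refine (abs_add_le _ _).trans ?_
          rw [abs_one, abs_mul]
          nlinarith [abs_nonneg s, abs_nonneg y]
        rw [Real.norm_eq_abs, abs_mul, abs_mul]
        calc _ ≤ 1 * ((1 + 1) * M) := by
              gcongr
              exact abs_diskDifference_le hGM _
          _ = _ := one_mul _
      · rw [show C - -C = 2 * C by ring, abs_of_pos (by positivity)]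
        linarith
    · exact Eventually.of_forall fun t => tendsto_radial_integral hl (hW.mono fun s hs => hs.1)
        hGm hGM (hGt t) (hκ t) (hfo t)
  have hcirc : ∀ t, G (circlePoint t) = F (circlePoint t) := fun t => hGF _ (by
    rw [mem_closedBall_zero_iff, norm_circlePoint]
    linarith)
  simp only [hcirc] at hlim
  refine hlim.congr' ?_
  have hne : ∀ᶠ s in l, s ≠ 0 := hl self_mem_nhdsWithin
  filter_upwards [hW, hsmall, hne] with s hs hss hs0
  obtain ⟨hWo, hWb, hin, hout⟩ := hs
  rw [lt_min_iff] at hss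
  have hball : ball (0 : ℂ) 1 ⊆ closedBall 0 (1 + η) :=
    ball_subset_closedBall.trans (closedBall_subset_closedBall (by linarith))
  have hint : ∀ S ⊆ closedBall (0 : ℂ) (1 + η), MeasurableSet S → Integrable (S.indicator G) := by
    intro S hS hSm
    rw [integrable_indicator_iff hSm]
    have : IsFiniteMeasure (volume.restrict S) :=
      ⟨by simpa using (isBounded_closedBall.subset hS).measure_lt_top⟩
    exact Integrable.of_bound hGm.aestronglyMeasurable M (Eventually.of_forall hGM)
  have hsub : (∫ w in W s, F w) - ∫ w in ball (0 : ℂ) 1, F w = ∫ w, diskDifference (W s) G w := by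
    simp only [diskDifference]
    rw [integral_sub (hint _ hWb hWo.measurableSet) (hint _ hball measurableSet_ball),
      integral_indicator hWo.measurableSet, integral_indicator measurableSet_ball,
      setIntegral_congr_fun hWo.measurableSet fun w hw => (hGF w (hWb hw)).symm,
      setIntegral_congr_fun measurableSet_ball fun w hw => (hGF w (hball hw)).symm]
  have hR : ∀ z : ℂ, 1 + η < ‖z‖ → diskDifference (W s) G z = 0 := by
    intro z hz
    rw [diskDifference, indicator_of_notMem (hout z (by linarith)), indicator_of_notMem, sub_zero]
    rw [mem_ball_zero_iff]
    linarith
  rw [hsub, integral_eq_polar hR, integral_prod_symm _ (integrable_polar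
    (measurable_diskDifference hWo hGm) (abs_diskDifference_le hGM))]
  simp only [polarCoord_symm_eq]
  simp_rw [integral_radial_eq hs0 hC hss.1 hss.2 hin hout]
  rw [integral_const_mul, ← mul_assoc, inv_mul_cancel₀ hs0, one_mul]

end RadialVariation


/-! ### Moments on the circle and the velocity of the boundary. -/

theorem integral_circlePoint_pow (k : ℕ) :
    ∫ t in Ioo (-Real.pi) Real.pi, circlePoint t ^ k = 2 * Real.pi * 0 ^ k := by
  have hpi := Real.pi_pos
  rw [← integral_Ioc_eq_integral_Ioo, ← intervalIntegral.integral_of_le (by linarith)]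
  rcases Nat.eq_zero_or_pos k with rfl | hk
  · simp
    ring
  have hk' : (k : ℂ) * Complex.I ≠ 0 :=
    mul_ne_zero (Nat.cast_ne_zero.2 hk.ne') Complex.I_ne_zero
  have h : ∀ t : ℝ, circlePoint t ^ k = Complex.exp (k * Complex.I * t) := fun t => by
    rw [circlePoint, ← Complex.exp_nat_mul]
    ring_nf
  simp_rw [h]
  rw [integral_exp_mul_complex hk', zero_pow hk.ne', mul_zero, div_eq_zero_iff, sub_eq_zero]
  left
  rw [Complex.exp_eq_exp_iff_exists_int]
  refine ⟨k, ?_⟩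
  push_cast
  ring

theorem periodic_circlePoint : Function.Periodic circlePoint (2 * Real.pi) := fun t => by
  rw [circlePoint, circlePoint]
  push_cast
  rw [add_mul, Complex.exp_periodic]

/-- A continuous periodic function is determined by its moments. -/
theorem eq_zero_of_integral_circlePoint_pow {G : ℝ → ℝ} (hG : Continuous G)
    (hp : Function.Periodic G (2 * Real.pi))
    (h : ∀ (k : ℕ) (c : ℂ), ∫ t in Ioo (-Real.pi) Real.pi, (c * circlePoint t ^ k).re * G t = 0) :
    G = 0 := by
  have hpi := Real.pi_pos
  have : Fact (0 < 2 * Real.pi) := ⟨by linarith⟩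
  have hc := continuous_circlePoint
  have hmom : ∀ k : ℕ, ∫ t in Ioo (-Real.pi) Real.pi, circlePoint t ^ k * (G t : ℂ) = 0 := by
    intro k
    set I := ∫ t in Ioo (-Real.pi) Real.pi, circlePoint t ^ k * (G t : ℂ) with hI
    have hint : IntegrableOn (fun t => circlePoint t ^ k * (G t : ℂ)) (Ioo (-Real.pi) Real.pi) :=
      ((by fun_prop : Continuous fun t => circlePoint t ^ k * (G t : ℂ)).integrableOn_Icc).mono_set
        Ioo_subset_Icc_self
    have hre : ∀ c : ℂ, (c * I).re = 0 := by
      intro c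
      rw [hI, ← integral_const_mul]
      have h2 := integral_re (𝕜 := ℂ) (hint.const_mul c)
      simp only [RCLike.re_to_complex] at h2
      rw [← h2, ← h k c]
      refine integral_congr_ae (Eventually.of_forall fun t => ?_)
      simp only [← mul_assoc, Complex.re_mul_ofReal]
    -- The choice `c = conj I` turns the vanishing real part into `|I|² = 0`.
    have := hre ((starRingEnd ℂ) I)
    rw [mul_comm, Complex.mul_conj, Complex.ofReal_re, Complex.normSq_eq_zero] at this
    exact this
  have hpC : Function.Periodic (fun t => (G t : ℂ)) (2 * Real.pi) := fun t => by
    simp only [hp t]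
  set f : C(AddCircle (2 * Real.pi), ℂ) :=
    ⟨hpC.lift, continuous_coinduced_dom.2 (by
      have : Continuous fun t => (G t : ℂ) := by fun_prop
      exact this)⟩ with hf
  have hfc : ∀ t : ℝ, f t = (G t : ℂ) := fun t => hpC.lift_coe t
  have hfour : ∀ (n : ℤ) (t : ℝ), fourier n (t : AddCircle (2 * Real.pi)) = circlePoint t ^ n := by
    intro n t
    rw [fourier_coe_apply, circlePoint, ← Complex.exp_int_mul]
    congr 1
    push_cast
    have : (Real.pi : ℂ) ≠ 0 := by exact_mod_cast hpi.ne'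
    field_simp
  have hcoeff : ∀ n : ℤ, fourierCoeff f n = 0 := by
    intro n
    rw [fourierCoeff_eq_intervalIntegral f n (-Real.pi)]
    have e : -Real.pi + 2 * Real.pi = Real.pi := by ring
    rw [e, intervalIntegral.integral_of_le (by linarith), integral_Ioc_eq_integral_Ioo]
    have h0 : ∫ t in Ioo (-Real.pi) Real.pi,
        fourier (-n) (t : AddCircle (2 * Real.pi)) • f t = 0 := by
      simp_rw [hfour, hfc, smul_eq_mul]
      rcases Int.le_total n 0 with hn | hn
      · obtain ⟨k, hk⟩ := Int.eq_ofNat_of_zero_le (show 0 ≤ -n by omega)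
        simp_rw [hk, zpow_natCast]
        exact hmom k
      · obtain ⟨k, rfl⟩ := Int.eq_ofNat_of_zero_le hn
        -- As `G` is real, the remaining Fourier coefficients are conjugates of the moments already
        -- treated.
        have h1 : ∀ t, circlePoint t ^ (-(k : ℤ)) * (G t : ℂ) =
            (starRingEnd ℂ) (circlePoint t ^ k * (G t : ℂ)) := by
          intro t
          rw [map_mul, map_pow, Complex.conj_ofReal, zpow_neg, zpow_natCast, ← inv_pow,
            Complex.inv_eq_conj (norm_circlePoint t)]
        simp_rw [h1]
        rw [integral_conj, hmom k, map_zero]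
    rw [h0, smul_zero]
  -- Vanishing coefficients are summable, so the Fourier series represents the continuous function
  -- pointwise.
  have hsum : Summable (fourierCoeff f) := by
    rw [funext hcoeff]
    exact summable_zero
  funext t
  have h1 := has_pointwise_sum_fourier_series_of_summable hsum (t : AddCircle (2 * Real.pi))
  simp only [hcoeff, zero_smul] at h1
  have h2 := h1.unique hasSum_zero
  rw [hfc] at h2
  exact_mod_cast h2


namespace IsRegularFlow

variable {γ A D : ℝ → ℝ → ℂ} {J : Set ℝ} (hF : IsRegularFlow γ A D J) {τ : ℝ} (hτ : τ ∈ J)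

include hF hτ

/-- Parameters of the same point differ by periods, so the velocity is a function on the curve. -/
theorem velocity_eq_of_curve_eq {θ θ' : ℝ} (h : γ τ θ = γ τ θ') : A τ θ = A τ θ' := by
  have key : ∀ x, ∃ x' ∈ Ico 0 (2 * Real.pi), γ τ x' = γ τ x ∧ A τ x' = A τ x := by
    intro x
    obtain ⟨x', hx', ⟨k, hk⟩, hγ⟩ := hF.exists_int_add_mem hτ 0 x
    rw [zero_add] at hx'
    refine ⟨x', hx', hγ, ?_⟩
    rw [hk]
    exact (hF.velocity_periodic τ hτ).sub_zsmul_eq k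
  obtain ⟨x, hx, h1, h2⟩ := key θ
  obtain ⟨y, hy, h3, h4⟩ := key θ'
  rw [← h2, ← h4, hF.injOn τ hτ hx hy (by rw [h1, h3, h])]

theorem continuous_velocity : Continuous (A τ) := by
  rw [← continuousOn_univ]
  exact hF.continuousOn_velocity.comp (f := fun θ : ℝ => (τ, θ)) (by fun_prop)
    fun θ _ => ⟨hτ, mem_univ _⟩

end IsRegularFlow

namespace IsDomainFlow

variable {γ A D : ℝ → ℝ → ℂ} {J : Set ℝ} {Ω : ℝ → Set ℂ} {w₀ p : ℂ}
  (hF : IsDomainFlow γ A D J Ω w₀ p) {τ : ℝ} (hτ : τ ∈ J)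
  {U : Set ℂ} {φ ψ : ℂ → ℂ} {η : ℝ} (hφ : IsConformalChart (Ω τ) U φ ψ η)

include hF hτ

theorem curve_mem (θ : ℝ) : γ τ θ ∈ frontier (Ω τ) := by
  rw [← hF.range_eq τ hτ]
  exact mem_range_self θ

include hφ

theorem norm_chart_curve (θ : ℝ) : ‖φ (γ τ θ)‖ = 1 := hφ.norm_eq _ (hF.curve_mem hτ θ)

theorem exists_parameter {c : ℂ} (hc : ‖c‖ = 1) :
    ∃ θ ∈ Icc 0 (2 * Real.pi), φ (γ τ θ) = c := by
  obtain ⟨h1, h2⟩ := hφ.right_inv (w := c) (by rw [hc]; linarith [hφ.pos])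
  have h3 : ψ c ∉ Ω τ := by
    rw [← hφ.norm_lt_iff _ h2, h1, hc]
    exact lt_irrefl 1
  have h4 : ψ c ∈ closure (Ω τ) := by
    by_contra hcon
    have := hφ.norm_gt _ h2 hcon
    rw [h1, hc] at this
    exact lt_irrefl 1 this
  have h5 : ψ c ∈ range (γ τ) := by
    rw [hF.range_eq τ hτ, (hF.isOpen τ hτ).frontier_eq]
    exact ⟨h4, h3⟩
  obtain ⟨θ, hθ⟩ := h5
  obtain ⟨θ', hθ', -, h6⟩ := hF.exists_int_add_mem hτ 0 θ
  rw [zero_add] at hθ'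
  exact ⟨θ', Ico_subset_Icc_self hθ', by rw [h6, hθ, h1]⟩

/-- The radial velocity in the conformal chart is a continuous function on the circle. -/
theorem exists_radial_velocity : ∃ g : ℂ → ℝ, ContinuousOn g (sphere 0 1) ∧
    ∀ θ, g (φ (γ τ θ)) = inner ℝ (φ (γ τ θ)) (deriv φ (γ τ θ) * A τ θ) := by
  have hex : ∀ c : ℂ, ∃ θ, ‖c‖ = 1 → θ ∈ Icc 0 (2 * Real.pi) ∧ φ (γ τ θ) = c := by
    intro c
    by_cases hc : ‖c‖ = 1
    · obtain ⟨θ, h1, h2⟩ := hF.exists_parameter hτ hφ hc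
      exact ⟨θ, fun _ => ⟨h1, h2⟩⟩
    · exact ⟨0, fun h => absurd h hc⟩
  choose Θ hΘ using hex
  set k : ℝ → ℝ := fun θ => inner ℝ (φ (γ τ θ)) (deriv φ (γ τ θ) * A τ θ) with hk
  have hU : ∀ θ, γ τ θ ∈ U := fun θ => hφ.frontier_subset (hF.curve_mem hτ θ)
  have hγc := hF.continuous_curve hτ
  have hφc : Continuous fun θ => φ (γ τ θ) := by
    rw [← continuousOn_univ]
    exact hφ.differentiableOn.continuousOn.comp hγc.continuousOn fun θ _ => hU θ
  have hdc : Continuous fun θ => deriv φ (γ τ θ) := by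
    rw [← continuousOn_univ]
    exact hφ.continuousOn_deriv.comp hγc.continuousOn fun θ _ => hU θ
  have hkc : Continuous k := hφc.inner (hdc.mul (hF.continuous_velocity hτ))
  have hval : ∀ θ, k (Θ (φ (γ τ θ))) = k θ := by
    intro θ
    have h1 := (hΘ _ (hF.norm_chart_curve hτ hφ θ)).2
    have h2 : γ τ (Θ (φ (γ τ θ))) = γ τ θ := hφ.injOn (hU _) (hU _) h1
    simp only [hk]
    rw [hF.velocity_eq_of_curve_eq hτ h2, h2]
  refine ⟨fun c => k (Θ c), ?_, hval⟩
  -- A continuous map from a compact interval onto the circle is a quotient map, so continuity in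
  -- the parameter descends to the circle although `Θ` is chosen arbitrarily.
  set f : Icc (0 : ℝ) (2 * Real.pi) → sphere (0 : ℂ) 1 := fun θ =>
    ⟨φ (γ τ θ), by rw [mem_sphere_zero_iff_norm]; exact hF.norm_chart_curve hτ hφ θ⟩ with hf
  have hfc : Continuous f := (hφc.comp continuous_subtype_val).subtype_mk _
  have hfs : Function.Surjective f := by
    rintro ⟨c, hc⟩
    rw [mem_sphere_zero_iff_norm] at hc
    obtain ⟨h1, h2⟩ := hΘ c hc
    exact ⟨⟨Θ c, h1⟩, Subtype.ext h2⟩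
  rw [continuousOn_iff_continuous_domRestrict,
    (Topology.IsQuotientMap.of_surjective_continuous hfs hfc).continuous_iff]
  have : (sphere (0 : ℂ) 1).domRestrict (fun c => k (Θ c)) ∘ f =
      fun θ : Icc (0 : ℝ) (2 * Real.pi) => k θ :=
    funext fun θ => hval θ
  rw [this]
  exact hkc.comp continuous_subtype_val

/-- The velocity of the boundary, in terms of the conformal map, for a flow of domains with
linearly growing harmonic moments. -/
theorem weight_mul_radial_velocity (hroot : φ w₀ = 0) (hacc : AccPt τ (𝓟 J)) {K : ℂ → ℝ}
    (hK : Continuous K) (hmean : ∀ σ ∈ J, ∀ (h : ℂ → ℝ) (M : ℝ), HarmonicOnNhd h (Ω σ) →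
      (∀ z ∈ Ω σ, |h z| ≤ M) → ∫ z in Ω σ, h z * K z = Real.pi * (σ * h w₀)) (θ : ℝ) :
    K (γ τ θ) * inner ℝ (φ (γ τ θ)) (deriv φ (γ τ θ) * A τ θ) =
      ‖deriv φ (γ τ θ)‖ ^ 2 / 2 := by
  have hpi := Real.pi_pos
  have hη := hφ.pos
  obtain ⟨g, hg, hgv⟩ := hF.exists_radial_velocity hτ hφ
  obtain ⟨C, hC, hCb, hloc⟩ := hF.exists_radial_localization hτ hφ hroot
  -- The density of the measure `K` times area after transport by `φ`.
  set H : ℂ → ℝ := fun w => K (ψ w) / ‖deriv φ (ψ w)‖ ^ 2 with hH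
  have hψU : ∀ w ∈ closedBall (0 : ℂ) (1 + η), φ (ψ w) = w ∧ ψ w ∈ U := fun w hw =>
    hφ.right_inv (by simpa using hw)
  have hHc : ContinuousOn H (closedBall 0 (1 + η)) := by
    refine (hK.comp_continuousOn hφ.continuousOn_inv).div ?_ ?_
    · exact ((hφ.continuousOn_deriv.comp hφ.continuousOn_inv fun w hw => (hψU w hw).2).norm).pow 2
    · intro w hw
      have := hφ.deriv_ne_zero (hψU w hw).2
      positivity
  have hcirc : ∀ t, circlePoint t ∈ closedBall (0 : ℂ) (1 + η) := fun t => by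
    rw [mem_closedBall_zero_iff, norm_circlePoint]
    linarith
  set κ : ℝ → ℝ := fun t => g (circlePoint t) with hκ
  -- Increments stay within `J`, so the derivative is one-sided at the ends of the parameter
  -- interval.
  set l : Filter ℝ := map (fun σ => σ - τ) (𝓝[J \ {τ}] τ) with hl
  have hNe : (𝓝[J \ {τ}] τ).NeBot := accPt_principal_iff_nhdsWithin.1 hacc
  have hlne : l ≤ 𝓝[≠] 0 := by
    have h1 : Tendsto (fun σ => σ - τ) (𝓝[J \ {τ}] τ) (𝓝[≠] 0) := by
      refine tendsto_nhdsWithin_iff.2 ⟨?_, ?_⟩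
      · have : Tendsto (fun σ : ℝ => σ - τ) (𝓝 τ) (𝓝 (τ - τ)) := tendsto_id.sub_const τ
        rw [sub_self] at this
        exact this.mono_left nhdsWithin_le_nhds
      · filter_upwards [self_mem_nhdsWithin] with σ hσ
        exact sub_ne_zero.2 hσ.2
    exact h1
  have hlJ : 𝓝[J \ {τ}] τ ≤ 𝓝[J] τ := nhdsWithin_mono _ sdiff_subset
  set W : ℝ → Set ℂ := fun s => φ '' Ω (τ + s) with hWdef
  have hWmem : ∀ᶠ σ in 𝓝[J] τ, (∀ w, ‖w‖ ≤ 1 + η → (w ∈ W (σ - τ) ↔ ψ w ∈ Ω σ)) ∧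
      W (σ - τ) ⊆ ball 0 (1 + η) := by
    filter_upwards [hloc] with σ hσ
    simp only [hWdef, add_sub_cancel]
    refine ⟨fun w hw => ⟨?_, fun h => ⟨ψ w, h, (hφ.right_inv hw).1⟩⟩, ?_⟩
    · rintro ⟨z, hz, rfl⟩
      rwa [hφ.left_inv z (hσ.2.2 z hz).1]
    · rintro _ ⟨z, hz, rfl⟩
      rw [mem_ball_zero_iff]
      exact (hσ.2.2 z hz).2
  have hκC : ∀ t, |κ t| ≤ C := by
    intro t
    obtain ⟨x, hx, hxt⟩ := hF.exists_parameter hτ hφ (norm_circlePoint t)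
    simp only [hκ]
    rw [← hxt, hgv]
    refine (abs_real_inner_le_norm _ _).trans ?_
    rw [hF.norm_chart_curve hτ hφ, one_mul, norm_mul, mul_comm]
    exact hCb x hx
  have hev : ∀ᶠ s in l, IsOpen (W s) ∧ W s ⊆ closedBall 0 (1 + η) ∧
      (∀ w, ‖w‖ < 1 - C * |s| → w ∈ W s) ∧ ∀ w, 1 + C * |s| < ‖w‖ → w ∉ W s := by
    rw [hl, eventually_map]
    refine hlJ ?_
    filter_upwards [hWmem, hloc, self_mem_nhdsWithin] with σ ⟨h1, h2⟩ ⟨h3, h4, h5⟩ hσ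
    refine ⟨?_, h2.trans ball_subset_closedBall, fun w hw => (h1 w ?_).2 (h3 w hw),
      fun w hw hwW => ?_⟩
    · simp only [hWdef, add_sub_cancel]
      exact isOpen_image_of_injOn hφ.isOpen hφ.differentiableOn hφ.injOn (hF.isOpen σ hσ)
        fun z hz => (h5 z hz).1
    · have : 0 ≤ C * |σ - τ| := by positivity
      linarith
    · have h6 : ‖w‖ ≤ 1 + η := (mem_ball_zero_iff.1 (h2 hwW)).le
      exact h4 w hw h6 ((h1 w h6).1 hwW)
  have hfo : ∀ t, ∀ δ > 0, ∃ ρ > 0, ∀ᶠ s in l, ∀ x : ℝ, |x| < ρ →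
      (x < s * κ t - δ * (|s| + |x|) → ((1 + x : ℝ) : ℂ) * circlePoint t ∈ W s) ∧
      (s * κ t + δ * (|s| + |x|) < x → ((1 + x : ℝ) : ℂ) * circlePoint t ∉ W s) := by
    intro t δ hδ
    obtain ⟨x₀, -, hxt⟩ := hF.exists_parameter hτ hφ (norm_circlePoint t)
    obtain ⟨n, hn, hnD, ⟨r, hr, hcr⟩, hcone⟩ := hF.exists_uniform_cones hτ x₀
    obtain ⟨ρ, hρ, hfirst⟩ := hF.exists_first_order_radial hτ hφ hn hnD
      ⟨r, hr, hcr.trans (connectedComponentIn_subset _ _)⟩ hcone hδ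
    refine ⟨min ρ (min η 1), by positivity, ?_⟩
    rw [hl, eventually_map]
    refine hlJ ?_
    have hnear : ∀ᶠ σ in 𝓝[J] τ, |σ - τ| < ρ :=
      nhdsWithin_le_nhds (Metric.ball_mem_nhds τ hρ)
    filter_upwards [hWmem, self_mem_nhdsWithin, hnear] with σ ⟨h1, _⟩ hσ hσρ x hx
    rw [lt_min_iff, lt_min_iff] at hx
    have h2 := hfirst σ hσ hσρ x hx.1
    rw [← hgv x₀, hxt] at h2
    have h3 : circlePoint t + x • circlePoint t = ((1 + x : ℝ) : ℂ) * circlePoint t := by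
      rw [Complex.real_smul]
      push_cast
      ring
    rw [h3] at h2
    have h4 : ‖((1 + x : ℝ) : ℂ) * circlePoint t‖ ≤ 1 + η := by
      rw [norm_mul_circlePoint]
      refine (abs_add_le _ _).trans ?_
      rw [abs_one]
      linarith [hx.2.1]
    rw [h1 _ h4]
    exact h2
  have hball : φ '' Ω τ = ball 0 1 := by
    ext w
    rw [mem_ball_zero_iff]
    constructor
    · rintro ⟨z, hz, rfl⟩
      exact (hφ.norm_lt_iff z (hφ.closure_subset (subset_closure hz))).2 hz
    · intro hw
      obtain ⟨h1, h2⟩ := hφ.right_inv (w := w) (by linarith)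
      refine ⟨ψ w, ?_, h1⟩
      rw [← hφ.norm_lt_iff _ h2, h1]
      exact hw
  have hmom : ∀ (k : ℕ) (c : ℂ), ∫ t in Ioo (-Real.pi) Real.pi,
      (c * circlePoint t ^ k).re * H (circlePoint t) * κ t = Real.pi * (c * 0 ^ k).re := by
    intro k c
    -- The test function pulls back to `Re (c φ^k)`, harmonic on all of `U` and hence on the nearby
    -- domains even when these are larger than `Ω τ`. Its value at the root vanishes unless `k = 0`.
    set F : ℂ → ℝ := fun w => (c * w ^ k).re * H w with hFdef
    have hFc : ContinuousOn F (closedBall 0 (1 + η)) :=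
      (by fun_prop : Continuous fun w : ℂ => (c * w ^ k).re).continuousOn.mul hHc
    have hlim := tendsto_radial_variation hlne hC hη hev hFc hκC hfo
    have hint : ∀ σ ∈ J, (∀ z ∈ Ω σ, z ∈ U ∧ ‖φ z‖ < 1 + η) →
        ∫ w in φ '' Ω σ, F w = Real.pi * (σ * (c * 0 ^ k).re) := by
      intro σ hσ hσU
      have hsub : Ω σ ⊆ U := fun z hz => (hσU z hz).1
      rw [setIntegral_image_eq hφ.isOpen hφ.differentiableOn hφ.injOn
        (hF.isOpen σ hσ).measurableSet hsub]
      have h1 : ∀ z ∈ Ω σ, ‖deriv φ z‖ ^ 2 * F (φ z) = (c * φ z ^ k).re * K z := by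
        intro z hz
        have := hφ.deriv_ne_zero (hsub hz)
        simp only [hFdef, hH]
        rw [hφ.left_inv z (hsub hz)]
        field_simp
      rw [setIntegral_congr_fun (hF.isOpen σ hσ).measurableSet h1,
        hmean σ hσ (fun z => (c * φ z ^ k).re) (‖c‖ * (1 + η) ^ k), hroot]
      · intro z hz
        have han : AnalyticAt ℂ φ z :=
          hφ.differentiableOn.analyticAt (hφ.isOpen.mem_nhds (hsub hz))
        exact (analyticAt_const.mul (han.pow k)).harmonicAt_re
      · intro z hz
        refine (Complex.abs_re_le_norm _).trans ?_
        rw [norm_mul, norm_pow]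
        gcongr
        exact (hσU z hz).2.le
    have hτU : ∀ z ∈ Ω τ, z ∈ U ∧ ‖φ z‖ < 1 + η := fun z hz => by
      have hzU := hφ.closure_subset (subset_closure hz)
      exact ⟨hzU, ((hφ.norm_lt_iff z hzU).2 hz).trans (by linarith)⟩
    have hconst : ∀ᶠ s in l, s⁻¹ * ((∫ w in W s, F w) - ∫ w in ball (0 : ℂ) 1, F w) =
        Real.pi * (c * 0 ^ k).re := by
      rw [hl, eventually_map]
      filter_upwards [hlJ hloc, self_mem_nhdsWithin] with σ hσ hσJ
      have hne : σ - τ ≠ 0 := sub_ne_zero.2 hσJ.2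
      simp only [hWdef, add_sub_cancel]
      rw [hint σ hσJ.1 hσ.2.2, ← hball, hint τ hτ hτU]
      field_simp
    have hlN : l.NeBot := hNe.map _
    have := tendsto_nhds_unique (hlim.congr' hconst) tendsto_const_nhds
    exact this
  have hκc : Continuous κ := by
    rw [← continuousOn_univ]
    exact hg.comp continuous_circlePoint.continuousOn fun t _ => by
      rw [mem_sphere_zero_iff_norm, norm_circlePoint]
  have hHcirc : Continuous fun t => H (circlePoint t) := by
    rw [← continuousOn_univ]
    exact hHc.comp continuous_circlePoint.continuousOn fun t _ => hcirc t
  -- The constant `1/2` has the moments `π Re (c 0^k)`, the same as those of `H κ`.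
  have hzero : (fun t => H (circlePoint t) * κ t - 1 / 2) = 0 := by
    refine eq_zero_of_integral_circlePoint_pow ((hHcirc.mul hκc).sub continuous_const) (fun t => ?_) fun k c => ?_
    · simp only [hκ, periodic_circlePoint t]
    · have hcc := continuous_circlePoint
      have h1 : IntegrableOn (fun t => (c * circlePoint t ^ k).re * H (circlePoint t) * κ t)
          (Ioo (-Real.pi) Real.pi) :=
        (((by fun_prop : Continuous fun t => (c * circlePoint t ^ k).re).mul hHcirc).mul
          hκc).integrableOn_Icc.mono_set Ioo_subset_Icc_self
      have h2 : IntegrableOn (fun t => c * circlePoint t ^ k) (Ioo (-Real.pi) Real.pi) :=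
        (by fun_prop : Continuous fun t => c * circlePoint t ^ k).integrableOn_Icc.mono_set
          Ioo_subset_Icc_self
      have h3 : ∫ t in Ioo (-Real.pi) Real.pi, (c * circlePoint t ^ k).re =
          2 * Real.pi * (c * 0 ^ k).re := by
        have h4 := integral_re (𝕜 := ℂ) h2
        simp only [RCLike.re_to_complex] at h4
        rw [h4, integral_const_mul, integral_circlePoint_pow, ← Complex.re_ofReal_mul]
        congr 1
        push_cast
        ring
      have h5 : IntegrableOn (fun t => (c * circlePoint t ^ k).re) (Ioo (-Real.pi) Real.pi) :=
        h2.re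
      calc _ = ∫ t in Ioo (-Real.pi) Real.pi, ((c * circlePoint t ^ k).re * H (circlePoint t) *
              κ t - (c * circlePoint t ^ k).re * (1 / 2)) := by
            congr 1
            funext t
            ring
        _ = 0 := by
            rw [integral_sub h1 (h5.mul_const _), hmom, integral_mul_const, h3]
            ring
  have hnorm := hF.norm_chart_curve hτ hφ θ
  obtain ⟨t, ht⟩ : ∃ t, circlePoint t = φ (γ τ θ) :=
    ⟨Complex.arg (φ (γ τ θ)), by
      have := Complex.norm_mul_exp_arg_mul_I (φ (γ τ θ))
      rw [hnorm] at this
      simpa [circlePoint] using this⟩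
  have h1 : H (circlePoint t) * κ t = 1 / 2 := by
    have := congrFun hzero t
    simp only [Pi.zero_apply] at this
    linarith
  simp only [hκ, ht, hgv, hH] at h1
  have hγU := hφ.frontier_subset (hF.curve_mem hτ θ)
  rw [hφ.left_inv _ hγU] at h1
  have hd : ‖deriv φ (γ τ θ)‖ ≠ 0 := norm_ne_zero_iff.2 (hφ.deriv_ne_zero hγU)
  field_simp at h1
  linarith

end IsDomainFlow


/-! ### The flow of off-spectral domains. -/

theorem IsRegularFlow.exists_bound {γ A D : ℝ → ℝ → ℂ} {J : Set ℝ} (hF : IsRegularFlow γ A D J) :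
    ∃ R > 0, ∀ σ ∈ J, ∀ θ, ‖γ σ θ‖ < R := by
  obtain ⟨M, hM⟩ := (hF.isCompact.prod (isCompact_Icc (a := (0 : ℝ)) (b := 2 * Real.pi)))
    |>.exists_bound_of_continuousOn
    (hF.continuousOn.mono (prod_mono_right (subset_univ _)))
  refine ⟨max M 0 + 1, by positivity, fun σ hσ θ => ?_⟩
  obtain ⟨θ', hθ', -, h⟩ := hF.exists_int_add_mem hσ 0 θ
  rw [zero_add] at hθ'
  rw [← h]
  exact (hM (σ, θ') ⟨hσ, Ico_subset_Icc_self hθ'⟩).trans_lt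
    ((le_max_left _ _).trans_lt (lt_add_one _))

/-- A point outside a disk containing the boundary of a bounded domain is outside the domain. -/
theorem notMem_closure_of_isBounded {Ω : Set ℂ} (hΩ : IsOpen Ω) (hb : Bornology.IsBounded Ω)
    {R : ℝ} (hR : ∀ z ∈ frontier Ω, ‖z‖ < R) {p : ℂ} (hp : 0 < ‖p‖) (hpR : R ≤ ‖p‖) :
    p ∉ closure Ω := by
  intro hpc
  have hpΩ : p ∈ Ω := by
    by_contra hcon
    have := hR p (by rw [hΩ.frontier_eq]; exact ⟨hpc, hcon⟩)
    linarith
  -- The outward ray from `p` misses the boundary, so it would lie in the bounded domain.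
  set S : Set ℂ := (fun t : ℝ => t • p) '' Ici 1 with hS
  have hSc : IsPreconnected S := isPreconnected_Ici.image _ (by fun_prop)
  have hnorm : ∀ t : ℝ, 1 ≤ t → ‖t • p‖ = t * ‖p‖ := fun t ht => by
    rw [norm_smul, Real.norm_eq_abs, abs_of_nonneg (by linarith)]
  have hSf : Disjoint S (frontier Ω) := by
    rw [disjoint_left]
    rintro _ ⟨t, ht, rfl⟩ hf
    have h1 := hR _ hf
    simp only [hnorm t ht] at h1
    have := mem_Ici.1 ht
    nlinarith
  have hsub : S ⊆ Ω := subset_of_isPreconnected_of_disjoint_frontier hΩ hSc hSf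
    ⟨p, ⟨1, mem_Ici.2 le_rfl, one_smul ℝ p⟩, hpΩ⟩
  obtain ⟨M, hM⟩ := hb.exists_norm_le
  have h1 : (1 : ℝ) ≤ 1 + |M| / ‖p‖ := by
    have : 0 ≤ |M| / ‖p‖ := by positivity
    linarith
  have h2 := hM _ (hsub ⟨1 + |M| / ‖p‖, h1, rfl⟩)
  simp only [hnorm _ h1] at h2
  have h3 : (1 + |M| / ‖p‖) * ‖p‖ = ‖p‖ + |M| := by field_simp
  linarith [le_abs_self M]

section

variable {Q : ℂ → ℝ} {w₀ : ℂ}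

/-- A boundary point of the component belongs to the droplet and is a limit of points outside it. It
is therefore on the frontier of the droplet, where positivity is assumed. -/
theorem IsAdmissible.ddbar_pos {τ : ℝ} (hQ : IsAdmissible Q w₀ τ) {ζ : ℂ}
    (hζ : ζ ∈ frontier (offSpectral Q w₀ τ)) : 0 < ddbar Q ζ := by
  obtain ⟨U, -, hU, -, hpos⟩ := hQ.regular
  refine hpos ζ (hU ⟨subset_closure (frontier_offSpectral_subset hQ.contDiff.continuous hζ), ?_⟩)
  intro hint
  obtain ⟨z, hz1, hz2⟩ := mem_closure_iff.1 (frontier_subset_closure hζ) _ isOpen_interior hint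
  exact offSpectral_subset hz2 (interior_subset hz1)

/-- The exterior point is the real number `R`, the radius of a disk about `0` that contains every
curve of the flow. -/
theorem IsAdmissibleOn.exists_isDomainFlow {a b : ℝ} (hab : a < b)
    (hQ : IsAdmissibleOn Q w₀ (Icc a b)) :
    ∃ γ A D p, IsDomainFlow γ A D (Icc a b) (offSpectral Q w₀) w₀ p := by
  obtain ⟨γ, hγ, hJ⟩ := hQ.smoothFlow
  obtain ⟨A, D, hF⟩ := exists_isRegularFlow hab hγ hJ
  obtain ⟨R, hR, hb⟩ := hF.exists_bound
  have hopen : ∀ σ ∈ Icc a b, IsOpen (offSpectral Q w₀ σ) := fun σ hσ =>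
    isOpen_offSpectral (hQ.admissible σ hσ).contDiff.continuous
  have hpR : ‖(R : ℂ)‖ = R := by rw [Complex.norm_real, Real.norm_eq_abs, abs_of_pos hR]
  refine ⟨γ, A, D, R, { hF with
    isOpen := hopen
    isPreconnected := fun σ _ => isPreconnected_connectedComponentIn
    range_eq := fun σ hσ => (hJ σ hσ).range_eq
    root_mem := fun σ hσ => (hQ.admissible σ hσ).root_mem
    notMem_closure := fun σ hσ => notMem_closure_of_isBounded (hopen σ hσ)
      (hQ.admissible σ hσ).isBounded (R := R) ?_ (by rw [hpR]; exact hR) hpR.ge }⟩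
  intro z hz
  rw [← (hJ σ hσ).range_eq] at hz
  obtain ⟨θ, rfl⟩ := hz
  exact hb σ hσ θ

/-- The motion of the boundary points along the normal, and the variation of the normal. -/
theorem boundary_motion {a b : ℝ} (ha : 0 ≤ a) (hab : a < b)
    (hQ : IsAdmissibleOn Q w₀ (Icc a b)) {τ : ℝ} (hτ : τ ∈ Icc a b) {φ : ℂ → ℂ}
    (hφ : IsRiemannMap (offSpectral Q w₀ τ) w₀ φ) {ζ : ℂ}
    (hζ : ζ ∈ frontier (offSpectral Q w₀ τ)) :
    ∃ n : ℂ, IsOuterUnitNormal (offSpectral Q w₀ τ) ζ n ∧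
      ∃ ζ' n' : ℝ → ℂ,
        (∀ᶠ ε : ℝ in 𝓝[{ε | τ - ε ∈ Icc a b}] 0,
          IsClosestPoint (ray ζ (Real.sign ε • (-n)) ∩ frontier (offSpectral Q w₀ (τ - ε)))
            ζ (ζ' ε) ∧
          IsOuterUnitNormal (offSpectral Q w₀ (τ - ε)) (ζ' ε) (n' ε)) ∧
        (fun ε : ℝ => ζ' ε - (ζ + (ε * (‖deriv φ ζ‖ / (4 * ddbar Q ζ))) • (-n)))
          =O[𝓝[{ε | τ - ε ∈ Icc a b}] 0] (fun ε : ℝ => ε ^ 2) ∧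
        (fun ε : ℝ => n' ε - n)
          =O[𝓝[{ε | τ - ε ∈ Icc a b}] 0] (fun ε : ℝ => ε) := by
  obtain ⟨γ, A, D, p, hF⟩ := hQ.exists_isDomainFlow hab
  have hpos := (hQ.admissible τ hτ).ddbar_pos hζ
  obtain ⟨U, ψ, η, hchart⟩ := hφ.exists_chart (hF.isOpen τ hτ) (hQ.admissible τ hτ).isBounded
  rw [← hF.range_eq τ hτ] at hζ
  obtain ⟨θ, rfl⟩ := hζ
  have hd := hchart.deriv_ne_zero (hchart.frontier_subset (hF.curve_mem hτ θ))
  have hd' : 0 < ‖deriv φ (γ τ θ)‖ := norm_pos_iff.2 hd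
  obtain ⟨n, hn, hnD, ⟨r, hr, hcr⟩, hcone⟩ := hF.exists_uniform_cones hτ θ
  have hacc : AccPt τ (𝓟 (Icc a b)) := isPreconnected_Icc.preperfect_of_nontrivial
    ⟨a, left_mem_Icc.2 hab.le, b, right_mem_Icc.2 hab.le, hab.ne⟩ τ hτ
  have hC2 := (hQ.admissible τ hτ).contDiff
  have hvel := hF.weight_mul_radial_velocity hτ hchart hφ.map_root hacc
    (K := fun z => 2 * ddbar Q z) (continuous_const.mul (continuous_ddbar hC2))
    (fun σ hσ h M hh hM => (hQ.admissible σ hσ).setIntegral_eq (ha.trans hσ.1) hh hM) θ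
  rw [inner_mul_eq_of_mul_conj_eq (hF.normal_eq hτ hchart hn hnD
    ⟨r, hr, hcr.trans (connectedComponentIn_subset _ _)⟩)] at hvel
  -- With weight `2ΔQ` the velocity law reads `2ΔQ · V |φ'| = |φ'|² / 2`, and `φ'` does not vanish.
  have hV : inner ℝ (A τ θ) n = ‖deriv φ (γ τ θ)‖ / (4 * ddbar Q (γ τ θ)) := by
    have h4 : 2 * ddbar Q (γ τ θ) * inner ℝ (A τ θ) n = ‖deriv φ (γ τ θ)‖ / 2 :=
      mul_right_cancel₀ hd'.ne' (by rw [mul_assoc, hvel]; ring)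
    rw [eq_div_iff (by positivity)]
    linarith
  obtain ⟨ρ, hρ, hhalf⟩ := hcone (1 / 2) (by norm_num) le_rfl
  obtain ⟨h1, h2⟩ := hhalf τ hτ (by simpa using hρ) θ (by simpa using hρ)
  refine ⟨n, hF.isOuterUnitNormal hτ hρ hn h1 h2 hn hnD (by simp), ?_⟩
  rw [← hV]
  exact hF.exists_motion hτ hn hnD ⟨ρ, hρ, hhalf⟩ (by rw [hV]; positivity)

end

end LaplacianGrowth

theorem mainTheorem9 (Q : ℂ → ℝ) (w₀ : ℂ) (a b : ℝ) (ha : 0 ≤ a) (hab : a < b)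
    (hQ : IsAdmissibleOn Q w₀ (Icc a b)) :
    -- weighted Laplacian growth
    (∀ τ ∈ Icc a b, ∀ τ' ∈ Icc a b, τ' < τ →
      ∀ h : ℂ → ℝ, InnerProductSpace.HarmonicOnNhd h (offSpectral Q w₀ τ) →
        (∃ M : ℝ, ∀ z ∈ offSpectral Q w₀ τ, |h z| ≤ M) →
        IntegrableOn (fun z => h z * (2 * ddbar Q z))
          (offSpectral Q w₀ τ \ offSpectral Q w₀ τ') area ∧
        ∫ z in offSpectral Q w₀ τ \ offSpectral Q w₀ τ', h z * (2 * ddbar Q z) ∂area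
          = (τ - τ') * h w₀) ∧
    -- motion of the boundary points along the normal, and variation of the normal
    (∀ τ ∈ Icc a b, ∀ φ : ℂ → ℂ, IsRiemannMap (offSpectral Q w₀ τ) w₀ φ →
      ∀ ζ ∈ frontier (offSpectral Q w₀ τ),
        ∃ n : ℂ, IsOuterUnitNormal (offSpectral Q w₀ τ) ζ n ∧
        ∃ ζ' n' : ℝ → ℂ,
          (∀ᶠ ε : ℝ in 𝓝[{ε | τ - ε ∈ Icc a b}] 0,
            -- the inward ray for positive `ε`, the outward ray for negative `ε`
            IsClosestPoint (ray ζ (Real.sign ε • (-n)) ∩ frontier (offSpectral Q w₀ (τ - ε)))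
              ζ (ζ' ε) ∧
            IsOuterUnitNormal (offSpectral Q w₀ (τ - ε)) (ζ' ε) (n' ε)) ∧
          (fun ε : ℝ => ζ' ε - (ζ + (ε * (‖deriv φ ζ‖ / (4 * ddbar Q ζ))) • (-n)))
            =O[𝓝[{ε | τ - ε ∈ Icc a b}] 0] (fun ε : ℝ => ε ^ 2) ∧
          (fun ε : ℝ => n' ε - n)
            =O[𝓝[{ε | τ - ε ∈ Icc a b}] 0] (fun ε : ℝ => ε)) := by
  exact ⟨fun τ hτ τ' hτ' hlt h hh ⟨M, hM⟩ => weighted_laplacian_growth (hQ.admissible τ hτ)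
    (hQ.admissible τ' hτ') (ha.trans hτ'.1) hlt hh hM,
    fun τ hτ φ hφ ζ hζ => boundary_motion ha hab hQ hτ hφ hζ⟩
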